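/- Let $\pi:Y\to X$ be a smooth fibre bundle over an $n$-dimensional smooth manifold $X$, with fibred coordinates $(x^\lambda,y^i)$, and put $\omega=dx^1\wedge\dots\wedge dx^n$, $\omega_\lambda=\partial_\lambda\rfloor\omega$. Let $J^1Y$, with coordinates $(x^\lambda,y^i,y^i_\lambda)$, be its first jet bundle, and let $\Pi=\wedge^nT^*X\otimes_YV^*Y\otimes_YTX$, with coordinates $(x^\lambda,y^i,p^\lambda_i)$, be its Legendre bundle. All sections below are smooth and global. Let $L=\mathcal L\,\omega:J^1Y\to\wedge^nT^*X$ be a smooth first-order Lagrangian, put $\pi^\lambda_i=\partial\mathcal L/\partial y^i_\lambda$, let $\widehat L:J^1Y\to\Pi$, $p^\lambda_i\circ\widehat L=\pi^\lambda_i$, be its Legendre map, and let $N_L=\widehat L(J^1Y)\subset\Pi$ be the Lagrangian constraint space. The Cartan equations for $L$ are the Euler–Lagrange equations, for sections $\bar s$ of $J^1Y\to X$, of the Lagrangian $$\overline L=\bigl(\mathcal L+(\widehat y^i_\lambda-y^i_\lambda)\pi^\lambda_i\bigr)\omega$$ on $J^1J^1Y$, where $\widehat y^i_\lambda$ are the derivatives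 of the coordinates $y^i$. The Lagrangian $L$ is called almost-regular if $N_L$ is a closed imbedded subbundle of $\Pi\to Y$ and $\widehat L:J^1Y\to N_L$ is a surjective submersion with connected fibres. A Hamiltonian is a smooth section $p=-\mathcal H$ of the bundle $T^*Y\wedge(\wedge^{n-1}T^*X)\to\Pi$, where $p^\lambda_i\,dy^i\wedge\omega_\lambda+p\,\omega$ is the general element of $T^*Y\wedge(\wedge^{n-1}T^*X)$. It defines the form $H=p^\lambda_i\,dy^i\wedge\omega_\lambda-\mathcal H\,\omega$ on $\Pi$ and the Hamiltonian map $\widehat H:\Pi\to J^1Y$, $y^i_\lambda\circ\widehat H=\partial\mathcal H/\partial p^\lambda_i$. It is said to be associated to $L$ if at every point of $N_L$ $$p^\mu_i=\pi^\mu_i\bigl(x,y,\partial\mathcal H/\partial p\bigr),\qquad p^\mu_i\,\frac{\partial\mathcal H}{\partial p^\mu_i}-\mathcal H=\mathcal L\bigl(x,y,\partial\mathcal H/\partial p\bigr).$$ The constrained Hamilton equations are the Euler–Lagrange equations, for sections $r$ of $N_L\to X$, of the Lagrangian $L_N=h_0(i_N^*H)$ on $J^1N_L$, where $i_N:N_L\to\Pi$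 is the inclusion and $h_0$ is the horizontal projection; in coordinates, $L_N$ is the restriction of $(p^\lambda_iy^i_\lambda-\mathcal H)\omega$ to $N_L\times_YJ^1Y$. **Theorem.** Let $L$ be an almost-regular Lagrangian, and let $\mathcal H$ be any Hamiltonian associated to $L$. Then a section $\bar s$ of $J^1Y\to X$ is a solution of the Cartan equations for $L$ if and only if $\widehat L\circ\bar s$ is a solution of the constrained Hamilton equations (formed with $\mathcal H$). In particular, for every solution $r$ of the constrained Hamilton equations and every Hamiltonian $\mathcal H'$ associated to $L$, the section $\bar s=\widehat{H'}\circ r$ of $J^1Y\to X$ is a solution of the Cartan equations for $L$. -/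

import Mathlib

/-!
# First-order Lagrangian and polysymplectic Hamiltonian field theory on a fibre bundle

`X` is a smooth `n`-manifold, `M → X` a smooth fibre bundle with typical fibre modelled on `G`
(for the configuration bundle, `G = ℝᵐ`), with fibred coordinates `(x^l, y^i)`.

* `Jet`, `JetBundle`: the first jet bundle `J¹M`, with its smooth structure given by the fibred
  coordinates `(x^l, y^i, y^i_l)`;
* `LegendreBundle`: `Π = Λⁿ T*X ⊗ V*M ⊗ TX`, with coordinates `(x^l, y^i, p^l_i)`;
* `IsEulerLagrangeSolution`: the Euler-Lagrange equations of a first-order Lagrangian on `J¹M`;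
* `legendreMap`, `IsCartanSolution`: Legendre map and Cartan equations of a Lagrangian;
* `Hamiltonian`, `hamiltonianMap`, `IsAssociated`;
* `constraintSpace`, `IsAlmostRegular`, `IsConstrainedHamiltonSolution`.
-/

open scoped Manifold ContDiff Topology

noncomputable section

namespace Polysymplectic

universe u

/-- The model space `ℝⁿ`. -/
abbrev Eu (n : ℕ) : Type := EuclideanSpace ℝ (Fin n)

/-- `p : M → B` is a smooth fibre bundle whose fibres are manifolds modelled on `F`: a surjection
with smooth local trivializations `p⁻¹(U) ≅ U × V`. -/
class IsSmoothFibreBundle (EB EM F : Type*) [NormedAddCommGroup EB] [NormedSpace ℝ EB]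
    [NormedAddCommGroup EM] [NormedSpace ℝ EM] [NormedAddCommGroup F] [NormedSpace ℝ F]
    {B : Type*} [TopologicalSpace B] [ChartedSpace EB B]
    {M : Type u} [TopologicalSpace M] [ChartedSpace EM M]
    (p : M → B) : Prop where
  surjective : Function.Surjective p
  exists_trivialization : ∀ b : B, ∃ (V : Type u) (_ : TopologicalSpace V) (_ : ChartedSpace F V)
    (_ : IsManifold 𝓘(ℝ, F) ∞ V) (t : Bundle.Trivialization V p), b ∈ t.baseSet ∧
      ContMDiffOn 𝓘(ℝ, EM) (𝓘(ℝ, EB).prod 𝓘(ℝ, F)) ∞ t t.source ∧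
      ContMDiffOn (𝓘(ℝ, EB).prod 𝓘(ℝ, F)) 𝓘(ℝ, EM) ∞ t.toOpenPartialHomeomorph.symm t.target

section Jets

variable (n : ℕ) (G : Type*) [NormedAddCommGroup G] [NormedSpace ℝ G]
  {X : Type*} [TopologicalSpace X] [ChartedSpace (Eu n) X]
  {M : Type*} [TopologicalSpace M] [ChartedSpace (Eu n × G) M]

/-- The tangent map `T_e p : T_e M → T_{p e} X`. -/
abbrev tangentMapAt (p : M → X) (e : M) :
    TangentSpace 𝓘(ℝ, Eu n × G) e →L[ℝ] TangentSpace 𝓘(ℝ, Eu n) (p e) :=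
  mfderiv 𝓘(ℝ, Eu n × G) 𝓘(ℝ, Eu n) p e

/-- The fibre over `e` of `J¹M → M`: linear maps `A : T_{p e} X → T_e M` with `Tp ∘ A = id`, that is,
the possible values at `p e` of the differential of a section through `e`. -/
def Jet (p : M → X) (e : M) : Type _ :=
  {A : TangentSpace 𝓘(ℝ, Eu n) (p e) →L[ℝ] TangentSpace 𝓘(ℝ, Eu n × G) e //
    (tangentMapAt n G p e).comp A = ContinuousLinearMap.id ℝ _}

/-- `T*X ⊗ VM` at `e`: linear maps from `T_{p e} X` to the vertical tangent space `ker (T_e p)`.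
This is the vector space on which the affine space `Jet n G p e` is modelled. -/
def VertHom (p : M → X) (e : M) :
    Submodule ℝ (TangentSpace 𝓘(ℝ, Eu n) (p e) →L[ℝ] TangentSpace 𝓘(ℝ, Eu n × G) e) where
  carrier := {w | (tangentMapAt n G p e).comp w = 0}
  add_mem' := fun {a b} (ha : _ = _) (hb : _ = _) => by
    show (tangentMapAt n G p e).comp (a + b) = 0
    rw [ContinuousLinearMap.comp_add, ha, hb, add_zero]
  zero_mem' := ContinuousLinearMap.comp_zero _
  smul_mem' := fun r a (ha : _ = _) => by
    show (tangentMapAt n G p e).comp (r • a) = 0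
    rw [ContinuousLinearMap.comp_smul, ha, smul_zero]

variable {n G}

namespace Jet

variable {p : M → X} {e : M}

@[ext] theorem ext {j k : Jet n G p e} (h : j.1 = k.1) : j = k := Subtype.ext h

/-- The affine action of `VertHom` on jets. -/
def translate (j : Jet n G p e) (w : VertHom n G p e) : Jet n G p e :=
  ⟨j.1 + w.1, by
    have h : (tangentMapAt n G p e).comp w.1 = 0 := w.2
    rw [ContinuousLinearMap.comp_add, j.2, h, add_zero]⟩

/-- The difference of two jets. -/
def diff (j k : Jet n G p e) : VertHom n G p e :=
  ⟨j.1 - k.1, by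
    show (tangentMapAt n G p e).comp (j.1 - k.1) = 0
    rw [ContinuousLinearMap.comp_sub, j.2, k.2, sub_self]⟩

end Jet

variable (n G) in
/-- Fibred coordinates `(x^l, y^i)` on `p : M → X`: a chart `chart` of `M` and a chart `base` of `X`,
both from the maximal smooth atlases, in which `p` is the projection `(x, y) ↦ x`. -/
structure FibredChart (p : M → X) where
  base : OpenPartialHomeomorph X (Eu n)
  chart : OpenPartialHomeomorph M (Eu n × G)
  base_mem : base ∈ IsManifold.maximalAtlas 𝓘(ℝ, Eu n) ∞ X
  chart_mem : chart ∈ IsManifold.maximalAtlas 𝓘(ℝ, Eu n × G) ∞ M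
  mapsTo : ∀ e ∈ chart.source, p e ∈ base.source
  fst_chart : ∀ e ∈ chart.source, (chart e).1 = base (p e)

namespace FibredChart

variable {p : M → X} (c : FibredChart n G p)

/-- The differential of the base chart, `dx^l` in components. -/
def baseDeriv (x : X) : TangentSpace 𝓘(ℝ, Eu n) x →L[ℝ] Eu n :=
  (NormedSpace.fromTangentSpace (𝕜 := ℝ) (c.base x)).toContinuousLinearMap.comp
    (mfderiv 𝓘(ℝ, Eu n) 𝓘(ℝ, Eu n) c.base x)

/-- The differential of the chart of `M`. -/
def chartDeriv (e : M) : TangentSpace 𝓘(ℝ, Eu n × G) e →L[ℝ] Eu n × G :=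
  (NormedSpace.fromTangentSpace (𝕜 := ℝ) (c.chart e)).toContinuousLinearMap.comp
    (mfderiv 𝓘(ℝ, Eu n × G) 𝓘(ℝ, Eu n × G) c.chart e)

/-- Inverse of `baseDeriv`; it maps the `l`-th basis vector to `∂_l`. -/
def frame (x : X) : Eu n →L[ℝ] TangentSpace 𝓘(ℝ, Eu n) x := (c.baseDeriv x).inverse

/-- Inverse of `chartDeriv`. -/
def chartFrame (e : M) : Eu n × G →L[ℝ] TangentSpace 𝓘(ℝ, Eu n × G) e := (c.chartDeriv e).inverse

variable {c}

theorem base_mdiff : c.base.MDifferentiable 𝓘(ℝ, Eu n) 𝓘(ℝ, Eu n) :=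
  ⟨fun _ hx => (mdifferentiableAt_of_mem_maximalAtlas
      (IsManifold.maximalAtlas_subset_of_le (by simp) c.base_mem) hx).mdifferentiableWithinAt,
   fun _ hx => (mdifferentiableAt_symm_of_mem_maximalAtlas
      (IsManifold.maximalAtlas_subset_of_le (by simp) c.base_mem) hx).mdifferentiableWithinAt⟩

theorem chart_mdiff : c.chart.MDifferentiable 𝓘(ℝ, Eu n × G) 𝓘(ℝ, Eu n × G) :=
  ⟨fun _ hx => (mdifferentiableAt_of_mem_maximalAtlas
      (IsManifold.maximalAtlas_subset_of_le (by simp) c.chart_mem) hx).mdifferentiableWithinAt,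
   fun _ hx => (mdifferentiableAt_symm_of_mem_maximalAtlas
      (IsManifold.maximalAtlas_subset_of_le (by simp) c.chart_mem) hx).mdifferentiableWithinAt⟩

theorem baseDeriv_isInvertible {x : X} (hx : x ∈ c.base.source) :
    (c.baseDeriv x).IsInvertible :=
  ⟨(base_mdiff.mfderiv hx).trans (NormedSpace.fromTangentSpace (c.base x)), rfl⟩

theorem chartDeriv_isInvertible {e : M} (he : e ∈ c.chart.source) :
    (c.chartDeriv e).IsInvertible :=
  ⟨(chart_mdiff.mfderiv he).trans (NormedSpace.fromTangentSpace (c.chart e)), rfl⟩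

theorem baseDeriv_frame {x : X} (hx : x ∈ c.base.source) (v : Eu n) :
    c.baseDeriv x (c.frame x v) = v := by
  obtain ⟨f, hf⟩ := baseDeriv_isInvertible hx
  rw [frame, ← hf]; simp

theorem frame_baseDeriv {x : X} (hx : x ∈ c.base.source) (v) :
    c.frame x (c.baseDeriv x v) = v := by
  obtain ⟨f, hf⟩ := baseDeriv_isInvertible hx
  rw [frame, ← hf]; simp

theorem chartDeriv_chartFrame {e : M} (he : e ∈ c.chart.source) (v : Eu n × G) :
    c.chartDeriv e (c.chartFrame e v) = v := by
  obtain ⟨f, hf⟩ := chartDeriv_isInvertible he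
  rw [chartFrame, ← hf]; simp

theorem chartFrame_chartDeriv {e : M} (he : e ∈ c.chart.source) (v) :
    c.chartFrame e (c.chartDeriv e v) = v := by
  obtain ⟨f, hf⟩ := chartDeriv_isInvertible he
  rw [chartFrame, ← hf]; simp

theorem proj_mdifferentiableAt {e : M} (he : e ∈ c.chart.source) :
    MDifferentiableAt 𝓘(ℝ, Eu n × G) 𝓘(ℝ, Eu n) p e := by
  have h1 := chart_mdiff.mdifferentiableAt he
  have h2 : MDifferentiableAt 𝓘(ℝ, Eu n × G) 𝓘(ℝ, Eu n) (Prod.fst : Eu n × G → Eu n) (c.chart e) :=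
    differentiableAt_fst.mdifferentiableAt
  have h3 := (c.base_mdiff).mdifferentiableAt_symm (c.base.map_source (c.mapsTo e he))
  rw [← c.fst_chart e he] at h3
  refine ((h3.comp e (h2.comp e h1))).congr_of_eventuallyEq ?_
  filter_upwards [c.chart.open_source.mem_nhds he] with y hy
  simp [c.fst_chart y hy, c.base.left_inv (c.mapsTo y hy)]

theorem chartDeriv_fst {e : M} (he : e ∈ c.chart.source) (v : TangentSpace 𝓘(ℝ, Eu n × G) e) :
    (c.chartDeriv e v).1 = c.baseDeriv (p e) (tangentMapAt n G p e v) := by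
  have h1 := chart_mdiff.mdifferentiableAt he
  have h2 : MDifferentiableAt 𝓘(ℝ, Eu n × G) 𝓘(ℝ, Eu n) (Prod.fst : Eu n × G → Eu n) (c.chart e) :=
    differentiableAt_fst.mdifferentiableAt
  have h3 := (c.base_mdiff).mdifferentiableAt (c.mapsTo e he)
  have h4 := proj_mdifferentiableAt he
  have key : mfderiv 𝓘(ℝ, Eu n × G) 𝓘(ℝ, Eu n) (Prod.fst ∘ c.chart) e
      = mfderiv 𝓘(ℝ, Eu n × G) 𝓘(ℝ, Eu n) (c.base ∘ p) e := by
    apply Filter.EventuallyEq.mfderiv_eq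
    filter_upwards [c.chart.open_source.mem_nhds he] with y hy
    simp [c.fst_chart y hy]
  rw [mfderiv_comp e h2 h1, mfderiv_comp e h3 h4, mfderiv_eq_fderiv, fderiv_fst] at key
  exact congrArg (fun f => f v) key

theorem tangentMapAt_chartFrame {e : M} (he : e ∈ c.chart.source) (v : Eu n × G) :
    tangentMapAt n G p e (c.chartFrame e v) = c.frame (p e) v.1 := by
  have := chartDeriv_fst he (c.chartFrame e v)
  rw [chartDeriv_chartFrame he] at this
  rw [this, frame_baseDeriv (c.mapsTo e he)]

variable (c)

/-- The jet at `e` with coordinates `y^i_l = a`. -/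
def jetOf {e : M} (he : e ∈ c.chart.source) (a : Eu n →L[ℝ] G) : Jet n G p e :=
  ⟨(c.chartFrame e).comp (((ContinuousLinearMap.id ℝ (Eu n)).prod a).comp (c.baseDeriv (p e))), by
    ext v
    simp [tangentMapAt_chartFrame he, frame_baseDeriv (c.mapsTo e he)]⟩

/-- The coordinates `y^i_l` of a jet at `e`. -/
def jetCoord (e : M) (j : Jet n G p e) : Eu n →L[ℝ] G :=
  (ContinuousLinearMap.snd ℝ (Eu n) G).comp
    ((c.chartDeriv e).comp (j.1.comp (c.frame (p e))))

/-- The element of `VertHom` with given coordinates. -/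
def vertOf {e : M} (he : e ∈ c.chart.source) : (Eu n →L[ℝ] G) →ₗ[ℝ] VertHom n G p e where
  toFun b := 
    ⟨(c.chartFrame e).comp
        ((ContinuousLinearMap.inr ℝ (Eu n) G).comp (b.comp (c.baseDeriv (p e)))), by
      show (tangentMapAt n G p e).comp _ = 0
      ext v
      simp [tangentMapAt_chartFrame he]⟩
  map_add' b b' := by ext v; simp
  map_smul' r b := by ext v; simp

theorem ext_jet {e : M} (he : e ∈ c.chart.source) {j k : Jet n G p e}
    (h : c.jetCoord e j = c.jetCoord e k) : j = k := by
  have hb := c.mapsTo e he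
  ext v
  apply (c.chartDeriv_isInvertible he).injective
  have h1 : ∀ i : Jet n G p e, (c.chartDeriv e (i.1 v)).1 = c.baseDeriv (p e) v := by
    intro i
    rw [chartDeriv_fst he]
    have := congrArg (fun f => f v) i.2
    simp only [ContinuousLinearMap.comp_apply, ContinuousLinearMap.id_apply] at this
    rw [this]
  have h2 : ∀ i : Jet n G p e, (c.chartDeriv e (i.1 v)).2 = c.jetCoord e i (c.baseDeriv (p e) v) := by
    intro i
    simp [jetCoord, frame_baseDeriv hb]
  apply Prod.ext
  · rw [h1, h1]
  · rw [h2, h2, h]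

theorem jetCoord_jetOf {e : M} (he : e ∈ c.chart.source) (a : Eu n →L[ℝ] G) :
    c.jetCoord e (c.jetOf he a) = a := by
  ext v
  simp [jetCoord, jetOf, chartDeriv_chartFrame he, baseDeriv_frame (c.mapsTo e he)]

theorem jetOf_jetCoord {e : M} (he : e ∈ c.chart.source) (j : Jet n G p e) :
    c.jetOf he (c.jetCoord e j) = j :=
  c.ext_jet he (c.jetCoord_jetOf he _)

end FibredChart

section Transition

variable {E : Type*} [NormedAddCommGroup E] [NormedSpace ℝ E]
  {M : Type*} [TopologicalSpace M] [ChartedSpace E M]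

theorem contDiffOn_transition {φ φ' : OpenPartialHomeomorph M E}
    (h : φ ∈ IsManifold.maximalAtlas 𝓘(ℝ, E) ∞ M) (h' : φ' ∈ IsManifold.maximalAtlas 𝓘(ℝ, E) ∞ M) :
    ContDiffOn ℝ ∞ (φ' ∘ φ.symm) (φ.target ∩ φ.symm ⁻¹' φ'.source) := by
  rw [← contMDiffOn_iff_contDiffOn]
  exact (contMDiffOn_of_mem_maximalAtlas h').comp
    ((contMDiffOn_symm_of_mem_maximalAtlas h).mono Set.inter_subset_left) (fun x hx => hx.2)

theorem contDiffOn_fderiv_transition {φ φ' : OpenPartialHomeomorph M E}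
    (h : φ ∈ IsManifold.maximalAtlas 𝓘(ℝ, E) ∞ M) (h' : φ' ∈ IsManifold.maximalAtlas 𝓘(ℝ, E) ∞ M) :
    ContDiffOn ℝ ∞ (fderiv ℝ (φ' ∘ φ.symm)) (φ.target ∩ φ.symm ⁻¹' φ'.source) :=
  (contDiffOn_transition h h').fderiv_of_isOpen (φ.isOpen_inter_preimage_symm φ'.open_source) (by simp)

theorem fderiv_transition {φ φ' : OpenPartialHomeomorph M E}
    (h : φ ∈ IsManifold.maximalAtlas 𝓘(ℝ, E) ∞ M) (h' : φ' ∈ IsManifold.maximalAtlas 𝓘(ℝ, E) ∞ M)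
    {e : M} (he : e ∈ φ.source) (he' : e ∈ φ'.source) (w : TangentSpace 𝓘(ℝ, E) e) :
    NormedSpace.fromTangentSpace (𝕜 := ℝ) (φ' e) (mfderiv 𝓘(ℝ, E) 𝓘(ℝ, E) φ' e w) =
      fderiv ℝ (φ' ∘ φ.symm) (φ e)
        (NormedSpace.fromTangentSpace (𝕜 := ℝ) (φ e) (mfderiv 𝓘(ℝ, E) 𝓘(ℝ, E) φ e w)) := by
  have hm : φ e ∈ φ.target ∩ φ.symm ⁻¹' φ'.source :=
    ⟨φ.map_source he, by simpa [φ.left_inv he] using he'⟩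
  have h1 : MDifferentiableAt 𝓘(ℝ, E) 𝓘(ℝ, E) (φ' ∘ φ.symm) (φ e) :=
    (((contDiffOn_transition h h').contDiffAt
      ((φ.isOpen_inter_preimage_symm φ'.open_source).mem_nhds hm)).differentiableAt (by simp)).mdifferentiableAt
  have h2 : MDifferentiableAt 𝓘(ℝ, E) 𝓘(ℝ, E) φ e := mdifferentiableAt_of_mem_maximalAtlas
      (IsManifold.maximalAtlas_subset_of_le (by simp) h) he
  have key : mfderiv 𝓘(ℝ, E) 𝓘(ℝ, E) φ' e =
      mfderiv 𝓘(ℝ, E) 𝓘(ℝ, E) ((φ' ∘ φ.symm) ∘ φ) e := by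
    apply Filter.EventuallyEq.mfderiv_eq
    filter_upwards [φ.open_source.mem_nhds he] with y hy
    simp [φ.left_inv hy]
  rw [mfderiv_comp e h1 h2, mfderiv_eq_fderiv] at key
  exact congrArg (fun f => f w) key

end Transition

/-- A smooth fibre bundle has fibred coordinates around each point. -/
theorem exists_fibredChart [IsManifold 𝓘(ℝ, Eu n) ∞ X] [IsManifold 𝓘(ℝ, Eu n × G) ∞ M]
    (p : M → X) [IsSmoothFibreBundle (Eu n) (Eu n × G) G p] (e : M) : ∃ c : FibredChart n G p, e ∈ c.chart.source := by
  obtain ⟨V, _, _, _, t, ht, h1, h2⟩ :=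
    IsSmoothFibreBundle.exists_trivialization (EB := Eu n) (EM := Eu n × G) (F := G) (p := p) (p e)
  have hte : e ∈ t.source := t.mem_source.2 ht
  let φ := chartAt (Eu n) (p e)
  let χ := chartAt G (t e).2
  let ψ : OpenPartialHomeomorph M (Eu n × G) := t.toOpenPartialHomeomorph.trans (φ.prod χ)
  have hsrc : ∀ y ∈ ψ.source, y ∈ t.source ∧ p y ∈ φ.source ∧ (t y).2 ∈ χ.source := by
    intro y hy
    rw [OpenPartialHomeomorph.trans_source] at hy
    refine ⟨hy.1, ?_, hy.2.2⟩
    have := hy.2.1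
    rwa [← t.coe_fst hy.1]
  refine ⟨⟨φ, ψ, IsManifold.chart_mem_maximalAtlas _, ?_, fun y hy => (hsrc y hy).2.1, ?_⟩, ?_⟩
  · apply OpenPartialHomeomorph.mem_maximalAtlas_of_contMDiffOn
    · have h3 : ContMDiffOn (𝓘(ℝ, Eu n).prod 𝓘(ℝ, G)) (𝓘(ℝ, Eu n).prod 𝓘(ℝ, G)) ∞
          (φ.prod χ) (φ.prod χ).source :=
        (contMDiffOn_of_mem_maximalAtlas (IsManifold.chart_mem_maximalAtlas _)).prodMap
          (contMDiffOn_of_mem_maximalAtlas (IsManifold.chart_mem_maximalAtlas _))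
      have h4 : ContMDiffOn 𝓘(ℝ, Eu n × G) (𝓘(ℝ, Eu n).prod 𝓘(ℝ, G)) ∞ ψ ψ.source :=
        h3.comp (h1.mono fun y hy => (hsrc y hy).1) (fun y hy => by
          rw [OpenPartialHomeomorph.trans_source] at hy
          exact hy.2)
      rwa [← modelWithCornersSelf_prod, chartedSpaceSelf_prod] at h4
    · have h3 : ContMDiffOn (𝓘(ℝ, Eu n).prod 𝓘(ℝ, G)) (𝓘(ℝ, Eu n).prod 𝓘(ℝ, G)) ∞
          (φ.prod χ).symm (φ.prod χ).target :=
        (contMDiffOn_symm_of_mem_maximalAtlas (IsManifold.chart_mem_maximalAtlas _)).prodMap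
          (contMDiffOn_symm_of_mem_maximalAtlas (IsManifold.chart_mem_maximalAtlas _))
      have h4 : ContMDiffOn (𝓘(ℝ, Eu n).prod 𝓘(ℝ, G)) 𝓘(ℝ, Eu n × G) ∞ ψ.symm ψ.target :=
        h2.comp (h3.mono fun z hz => by
          rw [OpenPartialHomeomorph.trans_target] at hz
          exact hz.1) (fun z hz => by
          rw [OpenPartialHomeomorph.trans_target] at hz
          exact hz.2)
      rwa [← modelWithCornersSelf_prod, chartedSpaceSelf_prod] at h4
  · intro y hy
    show φ ((t y).1) = φ (p y)
    rw [t.coe_fst (hsrc y hy).1]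
  · rw [OpenPartialHomeomorph.trans_source]
    refine ⟨hte, ?_, mem_chart_source _ _⟩
    show (t e).1 ∈ φ.source
    rw [t.coe_fst hte]
    exact mem_chart_source _ _



namespace FibredChart

variable {p : M → X} (c : FibredChart n G p)

theorem baseDeriv_change {c c' : FibredChart n G p} {x : X} (hx : x ∈ c.base.source)
    (hx' : x ∈ c'.base.source) (w : TangentSpace 𝓘(ℝ, Eu n) x) :
    c'.baseDeriv x w = fderiv ℝ (c'.base ∘ c.base.symm) (c.base x) (c.baseDeriv x w) :=
  fderiv_transition c.base_mem c'.base_mem hx hx' w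

theorem chartDeriv_change {c c' : FibredChart n G p} {e : M} (he : e ∈ c.chart.source)
    (he' : e ∈ c'.chart.source) (w : TangentSpace 𝓘(ℝ, Eu n × G) e) :
    c'.chartDeriv e w = fderiv ℝ (c'.chart ∘ c.chart.symm) (c.chart e) (c.chartDeriv e w) :=
  fderiv_transition c.chart_mem c'.chart_mem he he' w

/-- The overlap of two fibred charts, in the coordinates of the first. -/
def overlap (c c' : FibredChart n G p) : Set (Eu n × G) :=
  c.chart.target ∩ c.chart.symm ⁻¹' c'.chart.source

theorem isOpen_overlap (c c' : FibredChart n G p) : IsOpen (c.overlap c') :=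
  c.chart.isOpen_inter_preimage_symm c'.chart.open_source

theorem overlap_symm_mem {c c' : FibredChart n G p} {z : Eu n × G} (hz : z ∈ c.overlap c') :
    c'.chart (c.chart.symm z) ∈ c'.overlap c :=
  ⟨c'.chart.map_source hz.2, by
    show c'.chart.symm _ ∈ c.chart.source
    rw [c'.chart.left_inv hz.2]; exact c.chart.map_target hz.1⟩

theorem base_overlap {c c' : FibredChart n G p} {z : Eu n × G} (hz : z ∈ c.overlap c') :
    z.1 ∈ c.base.target ∩ c.base.symm ⁻¹' c'.base.source := by
  have h1 := c.chart.map_target hz.1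
  have h2 := c.fst_chart _ h1
  rw [c.chart.right_inv hz.1] at h2
  refine ⟨h2 ▸ c.base.map_source (c.mapsTo _ h1), ?_⟩
  show c.base.symm z.1 ∈ c'.base.source
  rw [h2, c.base.left_inv (c.mapsTo _ h1)]
  exact c'.mapsTo _ hz.2

theorem contDiffOn_change (c c' : FibredChart n G p) :
    ContDiffOn ℝ ∞ (c'.chart ∘ c.chart.symm) (c.overlap c') :=
  contDiffOn_transition c.chart_mem c'.chart_mem

theorem contDiffOn_fderiv_change (c c' : FibredChart n G p) :
    ContDiffOn ℝ ∞ (fderiv ℝ (c'.chart ∘ c.chart.symm)) (c.overlap c') :=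
  contDiffOn_fderiv_transition c.chart_mem c'.chart_mem

theorem contDiffOn_fderiv_base (c c' : FibredChart n G p) :
    ContDiffOn ℝ ∞ (fun z : Eu n × G => fderiv ℝ (c'.base ∘ c.base.symm) z.1) (c.overlap c') :=
  (contDiffOn_fderiv_transition c.base_mem c'.base_mem).comp contDiff_fst.contDiffOn
    (fun _ hz => base_overlap hz)

theorem contDiffOn_fderiv_base' (c c' : FibredChart n G p) :
    ContDiffOn ℝ ∞ (fun z : Eu n × G =>
      fderiv ℝ (c.base ∘ c'.base.symm) ((c'.chart ∘ c.chart.symm) z).1) (c.overlap c') :=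
  (contDiffOn_fderiv_base c' c).comp (contDiffOn_change c c') (fun _ hz => overlap_symm_mem hz)

theorem contDiffOn_fderiv_change' (c c' : FibredChart n G p) :
    ContDiffOn ℝ ∞ (fun z : Eu n × G =>
      fderiv ℝ (c.chart ∘ c'.chart.symm) ((c'.chart ∘ c.chart.symm) z)) (c.overlap c') :=
  (contDiffOn_fderiv_change c' c).comp (contDiffOn_change c c') (fun _ hz => overlap_symm_mem hz)

theorem jetCoord_change {c c' : FibredChart n G p} {e : M} (he : e ∈ c.chart.source)
    (he' : e ∈ c'.chart.source) (a : Eu n →L[ℝ] G) (v : Eu n) :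
    c'.jetCoord e (c.jetOf he a) v =
      (fderiv ℝ (c'.chart ∘ c.chart.symm) (c.chart e)
        (fderiv ℝ (c.base ∘ c'.base.symm) (c'.chart e).1 v,
          a (fderiv ℝ (c.base ∘ c'.base.symm) (c'.chart e).1 v))).2 := by
  have h := baseDeriv_change (c'.mapsTo e he') (c.mapsTo e he) (c'.frame (p e) v)
  rw [baseDeriv_frame (c'.mapsTo e he'), ← c'.fst_chart e he'] at h
  simp [jetCoord, jetOf, chartDeriv_change he he', chartDeriv_chartFrame he, h]

end FibredChart

variable (n G) in
/-- The total space of the first jet bundle `J¹M`. -/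
structure JetBundle (p : M → X) where
  pt : M
  jet : Jet n G p pt

namespace FibredChart

variable {p : M → X} (c : FibredChart n G p)

open Classical in
/-- The coordinates `(x^l, y^i, y^i_l)` on `J¹M` induced by fibred coordinates on `M`. (The point
`j₀` is only used to give the inverse a value outside the target.) -/
def jetChart (j₀ : JetBundle n G p) :
    PartialEquiv (JetBundle n G p) (Eu n × (G × (Eu n →L[ℝ] G))) where
  toFun j := ((c.chart j.pt).1, (c.chart j.pt).2, c.jetCoord j.pt j.jet)
  invFun z :=
    if h : (z.1, z.2.1) ∈ c.chart.target then
      ⟨c.chart.symm (z.1, z.2.1), c.jetOf (c.chart.map_target h) z.2.2⟩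
    else j₀
  source := {j | j.pt ∈ c.chart.source}
  target := {z | (z.1, z.2.1) ∈ c.chart.target}
  map_source' j hj := c.chart.map_source hj
  map_target' z hz := by
    have hz' : (z.1, z.2.1) ∈ c.chart.target := hz
    simp only [hz', dif_pos]
    exact c.chart.map_target hz
  left_inv' := by
    rintro ⟨e, j⟩ he
    have he' : e ∈ c.chart.source := he
    have h : c.chart e ∈ c.chart.target := c.chart.map_source he'
    have key : ∀ e' (h1 : e' ∈ c.chart.source), e' = e →
        (⟨e', c.jetOf h1 (c.jetCoord e j)⟩ : JetBundle n G p) = ⟨e, j⟩ := by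
      rintro e' h1 rfl
      rw [c.jetOf_jetCoord]
    simp only [Prod.mk.eta, h, dif_pos]
    exact key _ _ (c.chart.left_inv he')
  right_inv' := by
    rintro ⟨x, y, a⟩ hz
    have hz' : (x, y) ∈ c.chart.target := hz
    rw [dif_pos hz']
    simp only [c.jetCoord_jetOf, c.chart.right_inv hz']

theorem jetChart_symm_apply (j₀ : JetBundle n G p) {z : Eu n × (G × (Eu n →L[ℝ] G))}
    (h : (z.1, z.2.1) ∈ c.chart.target) : (c.jetChart j₀).symm z =
      ⟨c.chart.symm (z.1, z.2.1), c.jetOf (c.chart.map_target h) z.2.2⟩ :=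
  dif_pos h

theorem jetChart_trans_source (c c' : FibredChart n G p) (j₀ j₀' : JetBundle n G p) :
    ((c.jetChart j₀).symm.trans (c'.jetChart j₀')).source =
      {z | (z.1, z.2.1) ∈ c.overlap c'} := by
  ext z
  rw [PartialEquiv.trans_source]
  constructor
  · rintro ⟨h1, h2⟩
    have h1' : (z.1, z.2.1) ∈ c.chart.target := h1
    rw [Set.mem_preimage, c.jetChart_symm_apply j₀ h1'] at h2
    exact ⟨h1', h2⟩
  · rintro ⟨h1, h2⟩
    refine ⟨h1, ?_⟩
    rw [Set.mem_preimage, c.jetChart_symm_apply j₀ h1]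
    exact h2

theorem isOpen_overlap_lift {P : Type*} [TopologicalSpace P] (c c' : FibredChart n G p) :
    IsOpen {z : Eu n × (G × P) | (z.1, z.2.1) ∈ c.overlap c'} :=
  (c.isOpen_overlap c').preimage (by fun_prop)

theorem jetChart_trans_contDiffOn (c c' : FibredChart n G p) (j₀ j₀' : JetBundle n G p) :
    ContDiffOn ℝ ∞ ((c.jetChart j₀).symm.trans (c'.jetChart j₀'))
      {z | (z.1, z.2.1) ∈ c.overlap c'} := by
  have hπ : ContDiff ℝ ∞ (fun z : Eu n × (G × (Eu n →L[ℝ] G)) => (z.1, z.2.1)) := by fun_prop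
  have hm : Set.MapsTo (fun z : Eu n × (G × (Eu n →L[ℝ] G)) => (z.1, z.2.1))
    {z | (z.1, z.2.1) ∈ c.overlap c'} (c.overlap c') := fun z hz => hz
  have h1 := (contDiffOn_change c c').comp hπ.contDiffOn hm
  have h2 := (contDiffOn_fderiv_change c c').comp hπ.contDiffOn hm
  have h3 := (contDiffOn_fderiv_base' c c').comp hπ.contDiffOn hm
  have key : ContDiffOn ℝ ∞ (fun z : Eu n × (G × (Eu n →L[ℝ] G)) =>
      ((((c'.chart ∘ c.chart.symm) (z.1, z.2.1)).1, ((c'.chart ∘ c.chart.symm) (z.1, z.2.1)).2,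
        (ContinuousLinearMap.snd ℝ (Eu n) G).comp
          ((fderiv ℝ (c'.chart ∘ c.chart.symm) (z.1, z.2.1)).comp
          (((ContinuousLinearMap.id ℝ (Eu n)).prod z.2.2).comp
          (fderiv ℝ (c.base ∘ c'.base.symm) ((c'.chart ∘ c.chart.symm) (z.1, z.2.1)).1)))) :
        Eu n × (G × (Eu n →L[ℝ] G)))) {z | (z.1, z.2.1) ∈ c.overlap c'} := by
    refine (contDiff_fst.comp_contDiffOn h1).prodMk
      ((contDiff_snd.comp_contDiffOn h1).prodMk ?_)
    rw [contDiffOn_clm_apply]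
    intro v
    have h4 := h3.clm_apply (contDiffOn_const (c := v))
    have h5 : ContDiffOn ℝ ∞ (fun z : Eu n × (G × (Eu n →L[ℝ] G)) => z.2.2)
      {z | (z.1, z.2.1) ∈ c.overlap c'} := by fun_prop
    exact contDiff_snd.comp_contDiffOn (h2.clm_apply (h4.prodMk (h5.clm_apply h4)))
  refine key.congr ?_
  rintro ⟨x, y, a⟩ hz
  have hz1 : (x, y) ∈ c.chart.target := hz.1
  have hz2 : c.chart.symm (x, y) ∈ c'.chart.source := hz.2
  show c'.jetChart j₀' ((c.jetChart j₀).symm (x, y, a)) = _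
  rw [c.jetChart_symm_apply j₀ hz1]
  refine Prod.ext rfl (Prod.ext rfl ?_)
  ext v
  show c'.jetCoord _ (c.jetOf (c.chart.map_target hz1) a) v = _
  rw [jetCoord_change (c.chart.map_target hz1) hz2, c.chart.right_inv hz1]
  rfl

end FibredChart

section JetManifold

variable [IsManifold 𝓘(ℝ, Eu n) ∞ X] [IsManifold 𝓘(ℝ, Eu n × G) ∞ M]

/-- Some fibred chart around `e`. -/
def chartOf (p : M → X) [IsSmoothFibreBundle (Eu n) (Eu n × G) G p] (e : M) : FibredChart n G p :=
  (exists_fibredChart p e).choose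

theorem mem_chartOf (p : M → X) [IsSmoothFibreBundle (Eu n) (Eu n × G) G p] (e : M) :
    e ∈ (chartOf (n := n) (G := G) p e).chart.source :=
  (exists_fibredChart p e).choose_spec

/-- The smooth structure of `J¹M`: its atlas consists of all induced coordinates. -/
def jetCore (p : M → X) [IsSmoothFibreBundle (Eu n) (Eu n × G) G p] :
    ChartedSpaceCore (Eu n × (G × (Eu n →L[ℝ] G))) (JetBundle n G p) where
  atlas := {f | ∃ (c : FibredChart n G p) (j₀ : JetBundle n G p), f = c.jetChart j₀}
  chartAt j := (chartOf p j.pt).jetChart j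
  mem_chart_source j := mem_chartOf p j.pt
  chart_mem_atlas j := ⟨_, _, rfl⟩
  open_source := by
    rintro _ _ ⟨c, j₀, rfl⟩ ⟨c', j₀', rfl⟩
    rw [FibredChart.jetChart_trans_source]
    exact c.isOpen_overlap_lift c'
  continuousOn_toFun := by
    rintro _ _ ⟨c, j₀, rfl⟩ ⟨c', j₀', rfl⟩
    rw [FibredChart.jetChart_trans_source]
    exact (c.jetChart_trans_contDiffOn c' j₀ j₀').continuousOn

variable (p : M → X) [IsSmoothFibreBundle (Eu n) (Eu n × G) G p]

instance : TopologicalSpace (JetBundle n G p) := (jetCore p).toTopologicalSpace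

instance : ChartedSpace (Eu n × (G × (Eu n →L[ℝ] G))) (JetBundle n G p) :=
  (jetCore p).toChartedSpace

instance : IsManifold 𝓘(ℝ, Eu n × (G × (Eu n →L[ℝ] G))) ∞ (JetBundle n G p) := by
  apply isManifold_of_contDiffOn
  intro f f' hf hf'
  obtain ⟨_, ⟨g, rfl⟩, _, ⟨⟨c, j₀, rfl⟩, rfl⟩, rfl⟩ := hf
  obtain ⟨_, ⟨g', rfl⟩, _, ⟨⟨c', j₀', rfl⟩, rfl⟩, rfl⟩ := hf'
  have h := c.jetChart_trans_contDiffOn c' j₀ j₀'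
  rw [← c.jetChart_trans_source c' j₀ j₀'] at h
  simp only [modelWithCornersSelf_coe, modelWithCornersSelf_coe_symm, Set.range_id, Set.inter_univ,
    Set.preimage_id_eq, Function.comp_id, Function.id_comp, id_eq]
  exact h

end JetManifold
/-- `Λⁿ T*ₓX`. -/
abbrev VolumeForm (n : ℕ) {X : Type*} [TopologicalSpace X] [ChartedSpace (Eu n) X] (x : X) :
    Type :=
  AlternatingMap ℝ (TangentSpace 𝓘(ℝ, Eu n) x) ℝ (Fin n)

/-- `dx^l ⊗ g`. -/
def elem (l : Fin n) (g : G) : Eu n →L[ℝ] G := (EuclideanSpace.proj l : Eu n →L[ℝ] ℝ).smulRight g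

theorem elem_apply (l : Fin n) (g : G) (v : Eu n) : elem l g v = v l • g := rfl

theorem elem_add (l : Fin n) (g g' : G) : elem l (g + g') = elem l g + elem l g' := by
  ext v; simp [elem_apply]

theorem elem_smul (l : Fin n) (r : ℝ) (g : G) : elem l (r • g) = r • elem l g := by
  ext v; simp [elem_apply, smul_comm r]

theorem sum_elem (b : Eu n →L[ℝ] G) : ∑ l, elem l (b (EuclideanSpace.single l 1)) = b := by
  ext v
  have hv : v = ∑ l, v l • (EuclideanSpace.single l 1 : Eu n) := by
    ext i
    simp [Pi.single_apply]
  conv_rhs => rw [hv]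
  simp [elem_apply, map_sum]

variable (n G) in
/-- The model space of the momenta `p^l_i`. -/
abbrev MomentumModel : Type _ := Fin n → (G →L[ℝ] ℝ)

/-- The contraction `p^l_i y^i_l`. -/
def pairing (P : MomentumModel n G) (b : Eu n →L[ℝ] G) : ℝ :=
  ∑ l, P l (b (EuclideanSpace.single l 1))

theorem pairing_add (P : MomentumModel n G) (b b' : Eu n →L[ℝ] G) :
    pairing P (b + b') = pairing P b + pairing P b' := by
  simp [pairing, Finset.sum_add_distrib]

theorem pairing_smul (P : MomentumModel n G) (r : ℝ) (b : Eu n →L[ℝ] G) :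
    pairing P (r • b) = r * pairing P b := by
  simp [pairing, Finset.mul_sum]

theorem add_pairing (P P' : MomentumModel n G) (b : Eu n →L[ℝ] G) :
    pairing (P + P') b = pairing P b + pairing P' b := by
  simp [pairing, Finset.sum_add_distrib]

theorem smul_pairing (P : MomentumModel n G) (r : ℝ) (b : Eu n →L[ℝ] G) :
    pairing (r • P) b = r * pairing P b := by
  simp [pairing, Finset.mul_sum]

theorem pairing_elem (P : MomentumModel n G) (l : Fin n) (g : G) : pairing P (elem l g) = P l g := by
  rw [pairing, Finset.sum_eq_single l]
  · simp [elem_apply]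
  · intro i _ hi
    simp [elem_apply, hi.symm]
  · simp

/-- `elem l` as a continuous linear map. -/
def elemL (l : Fin n) : G →L[ℝ] (Eu n →L[ℝ] G) :=
  ContinuousLinearMap.smulRightL ℝ (Eu n) G (EuclideanSpace.proj l)

theorem pairing_comp_elemL (φ : (Eu n →L[ℝ] G) →L[ℝ] ℝ) (b : Eu n →L[ℝ] G) :
    pairing (fun l => φ.comp (elemL l)) b = φ b := by
  conv_rhs => rw [← sum_elem b, map_sum]
  rfl

variable (n G) in
/-- The fibre of the Legendre bundle, `Λⁿ T*X ⊗ V*M ⊗ TX = Hom (T*X ⊗ VM, Λⁿ T*X)` at `e`. -/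
abbrev LegendreFibre (p : M → X) (e : M) : Type _ :=
  VertHom n G p e →ₗ[ℝ] VolumeForm n (p e)

variable (n G) in
/-- The total space of the Legendre bundle `Π`. -/
structure LegendreBundle (p : M → X) where
  pt : M
  mom : LegendreFibre n G p pt

namespace FibredChart

variable {p : M → X} (c : FibredChart n G p)

/-- The determinant on `ℝⁿ`. -/
def coordVol : AlternatingMap ℝ (Eu n) ℝ (Fin n) :=
  (EuclideanSpace.basisFun (Fin n) ℝ).toBasis.det

/-- The coordinate form `ω = dx¹ ∧ ⋯ ∧ dxⁿ` at `x`. -/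
def vol (x : X) : VolumeForm n x := coordVol.compLinearMap (c.baseDeriv x).toLinearMap

/-- The coefficient `α(∂₁, …, ∂ₙ)` of `α` with respect to `ω`. -/
def coef (x : X) (α : VolumeForm n x) : ℝ :=
  α fun l => c.frame x (EuclideanSpace.single l 1)

theorem coef_add (x : X) (α β : VolumeForm n x) : c.coef x (α + β) = c.coef x α + c.coef x β := rfl
theorem coef_smul (x : X) (r : ℝ) (α : VolumeForm n x) : c.coef x (r • α) = r * c.coef x α := rfl

theorem coef_vol {x : X} (hx : x ∈ c.base.source) : c.coef x (c.vol x) = 1 := by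
  have h : (fun l : Fin n => (EuclideanSpace.single l (1 : ℝ) : Eu n)) =
      (EuclideanSpace.basisFun (Fin n) ℝ).toBasis := by
    ext l i
    simp
  simp only [coef, vol, AlternatingMap.compLinearMap_apply, ContinuousLinearMap.coe_coe,
    baseDeriv_frame hx, coordVol]
  rw [h, Module.Basis.det_self]

theorem eq_coef_smul_vol {x : X} (hx : x ∈ c.base.source) (α : VolumeForm n x) :
    α = c.coef x α • c.vol x := by
  have h := AlternatingMap.eq_smul_basis_det (EuclideanSpace.basisFun (Fin n) ℝ).toBasis
    (α.compLinearMap (c.frame x).toLinearMap)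
  ext v
  have h2 := congrArg (fun f => f (fun l => c.baseDeriv x (v l))) h
  simpa [frame_baseDeriv hx, vol, coordVol, coef] using h2

/-- The coordinates of an element of `VertHom`. -/
def vertCoord (e : M) (w : VertHom n G p e) : Eu n →L[ℝ] G :=
  (ContinuousLinearMap.snd ℝ (Eu n) G).comp
    ((c.chartDeriv e).comp (w.1.comp (c.frame (p e))))

theorem vertCoord_vertOf {e : M} (he : e ∈ c.chart.source) (b : Eu n →L[ℝ] G) :
    c.vertCoord e (c.vertOf he b) = b := by
  ext v
  simp [vertCoord, vertOf, chartDeriv_chartFrame he, baseDeriv_frame (c.mapsTo e he)]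

theorem vertOf_vertCoord {e : M} (he : e ∈ c.chart.source) (w : VertHom n G p e) :
    c.vertOf he (c.vertCoord e w) = w := by
  have hw : (tangentMapAt n G p e).comp w.1 = 0 := w.2
  apply Subtype.ext
  ext v
  apply (c.chartDeriv_isInvertible he).injective
  have h1 : (c.chartDeriv e (w.1 v)).1 = 0 := by
    rw [chartDeriv_fst he]
    have := congrArg (fun f => f v) hw
    simp only [ContinuousLinearMap.comp_apply, zero_apply] at this
    rw [this, map_zero]
  simp only [vertOf, LinearMap.coe_mk, AddHom.coe_mk, ContinuousLinearMap.comp_apply,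
    chartDeriv_chartFrame he]
  refine Prod.ext ?_ ?_
  · simp [h1]
  · simp [vertCoord, frame_baseDeriv (c.mapsTo e he)]

theorem vertCoord_add (e : M) (w w' : VertHom n G p e) :
    c.vertCoord e (w + w') = c.vertCoord e w + c.vertCoord e w' := by
  ext v; simp [vertCoord]

theorem vertCoord_smul (e : M) (r : ℝ) (w : VertHom n G p e) :
    c.vertCoord e (r • w) = r • c.vertCoord e w := by
  ext v; simp [vertCoord]

/-- The element `w ↦ (p^l_i w^i_l) ω` of the Legendre bundle with momenta `p^l_i = P`. -/
def momOf (e : M) (P : MomentumModel n G) : LegendreFibre n G p e where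
  toFun w := pairing P (c.vertCoord e w) • c.vol (p e)
  map_add' w w' := by rw [vertCoord_add, pairing_add, add_smul]
  map_smul' r w := by rw [vertCoord_smul, pairing_smul, mul_smul, RingHom.id_apply]

variable [FiniteDimensional ℝ G]

open Classical in
/-- The momenta `p^l_i` of an element of the Legendre bundle. -/
def momCoord (e : M) (q : LegendreFibre n G p e) : MomentumModel n G := fun l =>
  if he : e ∈ c.chart.source then
    LinearMap.toContinuousLinearMap
      { toFun := fun g => c.coef (p e) (q (c.vertOf he (elem l g)))
        map_add' := fun g g' => by rw [elem_add, map_add, map_add, coef_add]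
        map_smul' := fun r g => by rw [elem_smul, map_smul, map_smul, coef_smul]; rfl }
  else 0

theorem momCoord_apply {e : M} (he : e ∈ c.chart.source) (q : LegendreFibre n G p e)
    (l : Fin n) (g : G) : c.momCoord e q l g = c.coef (p e) (q (c.vertOf he (elem l g))) := by
  rw [momCoord, dif_pos he]; rfl

theorem pairing_momCoord {e : M} (he : e ∈ c.chart.source) (q : LegendreFibre n G p e)
    (b : Eu n →L[ℝ] G) : pairing (c.momCoord e q) b = c.coef (p e) (q (c.vertOf he b)) := by
  have h : ∀ s : Finset (Fin n), c.coef (p e) (q (c.vertOf he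
      (∑ l ∈ s, elem l (b (EuclideanSpace.single l 1))))) =
      ∑ l ∈ s, c.coef (p e) (q (c.vertOf he (elem l (b (EuclideanSpace.single l 1))))) := by
    intro s
    induction s using Finset.cons_induction with
    | empty => simp; rfl
    | cons a s ha ih => rw [Finset.sum_cons, Finset.sum_cons, map_add, map_add, coef_add, ih]
  have h' := h Finset.univ
  rw [sum_elem] at h'
  rw [h', pairing]
  exact Finset.sum_congr rfl fun l _ => c.momCoord_apply he q l _

theorem momCoord_momOf {e : M} (he : e ∈ c.chart.source) (P : MomentumModel n G) :
    c.momCoord e (c.momOf e P) = P := by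
  ext l g
  rw [momCoord_apply c he]
  show c.coef _ (pairing P _ • c.vol _) = _
  rw [coef_smul, vertCoord_vertOf, coef_vol c (c.mapsTo e he), mul_one, pairing_elem]

theorem momOf_momCoord {e : M} (he : e ∈ c.chart.source) (q : LegendreFibre n G p e) :
    c.momOf e (c.momCoord e q) = q := by
  refine LinearMap.ext fun w => ?_
  show pairing (c.momCoord e q) (c.vertCoord e w) • c.vol _ = _
  rw [pairing_momCoord c he, vertOf_vertCoord, ← eq_coef_smul_vol c (c.mapsTo e he)]

/-- The coordinates `(x^l, y^i, p^l_i)` on `Π`. -/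
def momChart : PartialEquiv (LegendreBundle n G p)
    (Eu n × (G × MomentumModel n G)) where
  toFun q := ((c.chart q.pt).1, (c.chart q.pt).2, c.momCoord q.pt q.mom)
  invFun z := ⟨c.chart.symm (z.1, z.2.1), c.momOf _ z.2.2⟩
  source := {q | q.pt ∈ c.chart.source}
  target := {z | (z.1, z.2.1) ∈ c.chart.target}
  map_source' q hq := c.chart.map_source hq
  map_target' z hz := c.chart.map_target hz
  left_inv' := by
    rintro ⟨e, q⟩ he
    have he' : e ∈ c.chart.source := he
    have key : ∀ e' : M, e' = e →
        (⟨e', c.momOf e' (c.momCoord e q)⟩ : LegendreBundle n G p) = ⟨e, q⟩ := by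
      rintro e' rfl
      rw [c.momOf_momCoord he']
    exact key _ (c.chart.left_inv he')
  right_inv' := by
    rintro ⟨x, y, P⟩ hz
    have hz' : (x, y) ∈ c.chart.target := hz
    simp only [c.momCoord_momOf (c.chart.map_target hz'), c.chart.right_inv hz']

theorem momCoord_change {c c' : FibredChart n G p} {e : M} (he : e ∈ c.chart.source)
    (he' : e ∈ c'.chart.source) (P : MomentumModel n G) (l : Fin n) (g : G) :
    c'.momCoord e (c.momOf e P) l g =
      pairing P ((ContinuousLinearMap.snd ℝ (Eu n) G).comp
          ((fderiv ℝ (c.chart ∘ c'.chart.symm) (c'.chart e)).comp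
            ((ContinuousLinearMap.inr ℝ (Eu n) G).comp
              ((elem l g).comp (fderiv ℝ (c'.base ∘ c.base.symm) (c.chart e).1))))) *
        Matrix.det (Matrix.of fun i j =>
          fderiv ℝ (c.base ∘ c'.base.symm) (c'.chart e).1 (EuclideanSpace.single j 1) i) := by
  rw [momCoord_apply c' he']
  show c'.coef _ (pairing P _ • c.vol _) = _
  rw [coef_smul]
  congr 1
  · congr 1
    ext v
    have h := baseDeriv_change (c.mapsTo e he) (c'.mapsTo e he') (c.frame (p e) v)
    rw [baseDeriv_frame (c.mapsTo e he), ← c.fst_chart e he] at h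
    simp [vertCoord, vertOf, chartDeriv_change he' he, chartDeriv_chartFrame he', h]
  · simp only [coef, vol, coordVol, AlternatingMap.compLinearMap_apply,
      ContinuousLinearMap.coe_coe, Module.Basis.det_apply]
    congr 1
    ext i j
    have h := baseDeriv_change (c'.mapsTo e he') (c.mapsTo e he)
      (c'.frame (p e) (EuclideanSpace.single j 1))
    rw [baseDeriv_frame (c'.mapsTo e he'), ← c'.fst_chart e he'] at h
    simp [Module.Basis.toMatrix_apply, h]

theorem momChart_trans_source (c c' : FibredChart n G p) :
    (c.momChart.symm.trans c'.momChart).source = {z | (z.1, z.2.1) ∈ c.overlap c'} := rfl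

theorem momChart_trans_contDiffOn (c c' : FibredChart n G p) :
    ContDiffOn ℝ ∞ (c.momChart.symm.trans c'.momChart)
      {z | (z.1, z.2.1) ∈ c.overlap c'} := by
  have hπ : ContDiff ℝ ∞
    (fun z : Eu n × (G × MomentumModel n G) => (z.1, z.2.1)) := by fun_prop
  have hm : Set.MapsTo (fun z : Eu n × (G × MomentumModel n G) => (z.1, z.2.1))
    {z | (z.1, z.2.1) ∈ c.overlap c'} (c.overlap c') := fun z hz => hz
  have h1 := (contDiffOn_change c c').comp hπ.contDiffOn hm
  have h2 := (contDiffOn_fderiv_change' c c').comp hπ.contDiffOn hm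
  have h3 := (contDiffOn_fderiv_base' c c').comp hπ.contDiffOn hm
  have h4 := (contDiffOn_fderiv_base c c').comp hπ.contDiffOn hm
  have key : ContDiffOn ℝ ∞ (fun z : Eu n × (G × MomentumModel n G) =>
      c'.momCoord (c.chart.symm (z.1, z.2.1)) (c.momOf (c.chart.symm (z.1, z.2.1)) z.2.2))
      {z | (z.1, z.2.1) ∈ c.overlap c'} := by
    refine contDiffOn_pi.2 fun l => contDiffOn_clm_apply.2 fun g => ?_
    have : ContDiffOn ℝ ∞ (fun z : Eu n × (G × MomentumModel n G) =>
      pairing z.2.2 ((ContinuousLinearMap.snd ℝ (Eu n) G).comp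
          ((fderiv ℝ (c.chart ∘ c'.chart.symm) ((c'.chart ∘ c.chart.symm) (z.1, z.2.1))).comp
            ((ContinuousLinearMap.inr ℝ (Eu n) G).comp
              ((elem l g).comp (fderiv ℝ (c'.base ∘ c.base.symm) z.1))))) *
        Matrix.det (Matrix.of fun i j =>
          fderiv ℝ (c.base ∘ c'.base.symm) ((c'.chart ∘ c.chart.symm) (z.1, z.2.1)).1
            (EuclideanSpace.single j 1) i)) {z | (z.1, z.2.1) ∈ c.overlap c'} := by
      refine ContDiffOn.mul ?_ ?_
      · refine ContDiffOn.sum fun μ _ => ?_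
        have h5 : ContDiffOn ℝ ∞ (fun z : Eu n × (G × MomentumModel n G) => z.2.2 μ)
          {z | (z.1, z.2.1) ∈ c.overlap c'} := by fun_prop
        refine h5.clm_apply ?_
        have h6 : ContDiffOn ℝ ∞ (fun z : Eu n × (G × MomentumModel n G) =>
            (EuclideanSpace.single μ (1 : ℝ) : Eu n)) {z | (z.1, z.2.1) ∈ c.overlap c'} :=
          contDiffOn_const
        have h7 := (elem l g).contDiff.comp_contDiffOn (h4.clm_apply h6)
        exact contDiff_snd.comp_contDiffOn
          (h2.clm_apply ((ContinuousLinearMap.inr ℝ (Eu n) G).contDiff.comp_contDiffOn h7))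
      · simp only [Matrix.det_apply', Matrix.of_apply]
        refine ContDiffOn.sum fun σ _ => contDiffOn_const.mul (contDiffOn_prod fun i _ => ?_)
        exact (EuclideanSpace.proj (σ i) : Eu n →L[ℝ] ℝ).contDiff.comp_contDiffOn
          (h3.clm_apply contDiffOn_const)
    refine this.congr ?_
    rintro ⟨x, y, P⟩ hz
    have hz1 : (x, y) ∈ c.chart.target := hz.1
    show c'.momCoord (c.chart.symm (x, y)) _ l g = _
    rw [momCoord_change (c.chart.map_target hz1) hz.2, c.chart.right_inv hz1]
    rfl
  exact (contDiff_fst.comp_contDiffOn h1).prodMk ((contDiff_snd.comp_contDiffOn h1).prodMk key)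

end FibredChart

section LegendreManifold

variable [FiniteDimensional ℝ G] [IsManifold 𝓘(ℝ, Eu n) ∞ X] [IsManifold 𝓘(ℝ, Eu n × G) ∞ M]

/-- The smooth structure of `Π`. -/
def legendreCore (p : M → X) [IsSmoothFibreBundle (Eu n) (Eu n × G) G p] :
    ChartedSpaceCore (Eu n × (G × MomentumModel n G)) (LegendreBundle n G p) where
  atlas := {f | ∃ c : FibredChart n G p, f = c.momChart}
  chartAt q := (chartOf p q.pt).momChart
  mem_chart_source q := mem_chartOf p q.pt
  chart_mem_atlas q := ⟨_, rfl⟩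
  open_source := by
    rintro _ _ ⟨c, rfl⟩ ⟨c', rfl⟩
    rw [FibredChart.momChart_trans_source]
    exact c.isOpen_overlap_lift c'
  continuousOn_toFun := by
    rintro _ _ ⟨c, rfl⟩ ⟨c', rfl⟩
    rw [FibredChart.momChart_trans_source]
    exact (c.momChart_trans_contDiffOn c').continuousOn

variable (p : M → X) [IsSmoothFibreBundle (Eu n) (Eu n × G) G p]

instance : TopologicalSpace (LegendreBundle n G p) := (legendreCore p).toTopologicalSpace

instance : ChartedSpace (Eu n × (G × MomentumModel n G)) (LegendreBundle n G p) :=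
  (legendreCore p).toChartedSpace

instance : IsManifold 𝓘(ℝ, Eu n × (G × MomentumModel n G)) ∞ (LegendreBundle n G p) := by
  apply isManifold_of_contDiffOn
  intro f f' hf hf'
  obtain ⟨_, ⟨g, rfl⟩, _, ⟨⟨c, rfl⟩, rfl⟩, rfl⟩ := hf
  obtain ⟨_, ⟨g', rfl⟩, _, ⟨⟨c', rfl⟩, rfl⟩, rfl⟩ := hf'
  have h := c.momChart_trans_contDiffOn c'
  rw [← c.momChart_trans_source c'] at h
  simp only [modelWithCornersSelf_coe, modelWithCornersSelf_coe_symm, Set.range_id, Set.inter_univ,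
    Set.preimage_id_eq, Function.comp_id, Function.id_comp, id_eq]
  exact h

end LegendreManifold

variable (n G) in
/-- Fibre-preserving maps `J¹M → Λⁿ T*X` over `X` (no smoothness required). -/
abbrev LagrangianDensity (p : M → X) : Type _ := ∀ e : M, Jet n G p e → VolumeForm n (p e)

namespace FibredChart

variable {p : M → X} (c : FibredChart n G p)

open Classical in
/-- The function `𝓛(x^l, y^i, y^i_l)` with `L = 𝓛 ω` in the given coordinates. -/
def lagCoord (L : LagrangianDensity n G p) (z : Eu n × (G × (Eu n →L[ℝ] G))) : ℝ :=
  if h : (z.1, z.2.1) ∈ c.chart.target then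
    c.coef _ (L (c.chart.symm (z.1, z.2.1)) (c.jetOf (c.chart.map_target h) z.2.2))
  else 0

theorem lagCoord_chart (L : LagrangianDensity n G p) {e : M} (he : e ∈ c.chart.source)
    (a : Eu n →L[ℝ] G) :
    c.lagCoord L ((c.chart e).1, (c.chart e).2, a) = c.coef (p e) (L e (c.jetOf he a)) := by
  have h : c.chart e ∈ c.chart.target := c.chart.map_source he
  have key : ∀ e' (h1 : e' ∈ c.chart.source), e' = e →
      c.coef (p e') (L e' (c.jetOf h1 a)) = c.coef (p e) (L e (c.jetOf he a)) := by
    rintro e' h1 rfl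
    rfl
  simp only [lagCoord, Prod.mk.eta, h, dif_pos]
  exact key _ _ (c.chart.left_inv he)

end FibredChart

variable (n G) in
/-- Smooth global sections of `p : M → X`. -/
def IsSmoothSection (p : M → X) (s : X → M) : Prop :=
  ContMDiff 𝓘(ℝ, Eu n) 𝓘(ℝ, Eu n × G) ∞ s ∧ ∀ x, p (s x) = x

namespace FibredChart
variable {p : M → X} (c : FibredChart n G p)

/-- The coordinate expression `y^i = s^i(x)` of a section. -/
def sectionCoord (s : X → M) (x : Eu n) : G := (c.chart (s (c.base.symm x))).2

end FibredChart

variable (n G) in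
/-- `s` is a smooth section of `p : M → X` that satisfies the Euler-Lagrange equations
`(∂_i - d_l ∂^l_i) 𝓛 = 0` of `L = 𝓛 ω`, that is,
`∂𝓛/∂y^i (x, s, ∂s) - ∑ l, ∂/∂x^l [∂𝓛/∂y^i_l (x, s, ∂s)] = 0`, in all fibred coordinates. The vector `v`
is a direction in the fibre coordinates `y^i`. -/
def IsEulerLagrangeSolution (p : M → X) (L : LagrangianDensity n G p) (s : X → M) : Prop :=
  IsSmoothSection n G p s ∧
  ∀ (c : FibredChart n G p) (x : Eu n), x ∈ c.base.target → s (c.base.symm x) ∈ c.chart.source →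
    ∀ v : G,
      fderiv ℝ (fun y : G => c.lagCoord L (x, y, fderiv ℝ (c.sectionCoord s) x))
          (c.sectionCoord s x) v -
        ∑ l : Fin n, fderiv ℝ (fun x' : Eu n =>
            fderiv ℝ (fun a : Eu n →L[ℝ] G => c.lagCoord L (x', c.sectionCoord s x', a))
              (fderiv ℝ (c.sectionCoord s) x')
              (elem l v))
          x (EuclideanSpace.single l 1) = 0

variable (n G) in
/-- A smooth first-order Lagrangian `L = 𝓛 ω : J¹M → Λⁿ T*X`. -/
structure Lagrangian (p : M → X) where
  density : LagrangianDensity n G p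
  smooth : ∀ c : FibredChart n G p,
    ContDiffOn ℝ ∞ (c.lagCoord density) {z | (z.1, z.2.1) ∈ c.chart.target}

namespace FibredChart
variable {p : M → X} (c : FibredChart n G p)

theorem jetCoord_translate (e : M) (j : Jet n G p e) (w : VertHom n G p e) :
    c.jetCoord e (j.translate w) = c.jetCoord e j + c.vertCoord e w := by
  ext v; simp [vertCoord, jetCoord, Jet.translate]

theorem hasDerivAt_lagrangian (L : Lagrangian n G p) {e : M} (he : e ∈ c.chart.source)
    (j : Jet n G p e) (w : VertHom n G p e) (v : Fin n → TangentSpace 𝓘(ℝ, Eu n) (p e)) :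
    HasDerivAt (fun t : ℝ => L.density e (j.translate (t • w)) v)
      (c.momOf e (fun l => (fderiv ℝ (fun a => c.lagCoord L.density
        ((c.chart e).1, (c.chart e).2, a)) (c.jetCoord e j)).comp (elemL l)) w v) 0 := by
  have h0 : ∀ t : ℝ, L.density e (j.translate (t • w)) v =
      c.lagCoord L.density ((c.chart e).1, (c.chart e).2,
        c.jetCoord e j + t • c.vertCoord e w) * c.vol (p e) v := by
    intro t
    rw [c.lagCoord_chart L.density he, ← c.vertCoord_smul, ← c.jetCoord_translate,
      c.jetOf_jetCoord he]
    conv_lhs => rw [c.eq_coef_smul_vol (c.mapsTo e he) (L.density e (j.translate (t • w)))]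
    rfl
  have hopen : IsOpen {z : Eu n × (G × (Eu n →L[ℝ] G)) | (z.1, z.2.1) ∈ c.chart.target} :=
    c.chart.open_target.preimage (f := fun z : Eu n × (G × (Eu n →L[ℝ] G)) => (z.1, z.2.1))
      (by fun_prop)
  have h1 : DifferentiableAt ℝ (c.lagCoord L.density)
      ((c.chart e).1, (c.chart e).2, c.jetCoord e j) :=
    ((L.smooth c).contDiffAt (hopen.mem_nhds (c.chart.map_source he))).differentiableAt (by simp)
  have h2 : DifferentiableAt ℝ
      (fun a => c.lagCoord L.density ((c.chart e).1, (c.chart e).2, a)) (c.jetCoord e j) :=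
    h1.comp (c.jetCoord e j) (f := fun a => ((c.chart e).1, (c.chart e).2, a)) (by fun_prop)
  have h3 : HasDerivAt (fun t : ℝ => c.jetCoord e j + t • c.vertCoord e w) (c.vertCoord e w) 0 := by
    simpa using ((hasDerivAt_id (0 : ℝ)).smul_const (c.vertCoord e w)).const_add (c.jetCoord e j)
  have h4 := (HasFDerivAt.comp_hasDerivAt (0 : ℝ)
    (by simpa using h2.hasFDerivAt) h3).mul_const (c.vol (p e) v)
  refine (h4.congr_of_eventuallyEq (Filter.Eventually.of_forall h0)).congr_deriv ?_
  simp [momOf, pairing_comp_elemL]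

end FibredChart

section Legendre

variable [IsManifold 𝓘(ℝ, Eu n) ∞ X] [IsManifold 𝓘(ℝ, Eu n × G) ∞ M]
  {p : M → X} [IsSmoothFibreBundle (Eu n) (Eu n × G) G p]

theorem exists_fibreDeriv (L : Lagrangian n G p) (j : JetBundle n G p) :
    ∃ q : LegendreFibre n G p j.pt, ∀ w v,
      HasDerivAt (fun t : ℝ => L.density j.pt (j.jet.translate (t • w)) v) (q w v) 0 :=
  ⟨_, fun w v => (chartOf p j.pt).hasDerivAt_lagrangian L (mem_chartOf p j.pt) j.jet w v⟩

/-- The derivative of `L` along the fibre of `J¹M → M` at `j`; it is characterized by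
`hasDerivAt_fibreDeriv`. -/
def fibreDeriv (L : Lagrangian n G p) (j : JetBundle n G p) : LegendreFibre n G p j.pt :=
  (exists_fibreDeriv L j).choose

/-- The Legendre map `L̂ : J¹M → Π`, `p^l_i ∘ L̂ = ∂𝓛/∂y^i_l` (see `momCoord_fibreDeriv`). -/
def legendreMap (L : Lagrangian n G p) (j : JetBundle n G p) : LegendreBundle n G p :=
  ⟨j.pt, fibreDeriv L j⟩

theorem hasDerivAt_fibreDeriv (L : Lagrangian n G p) (j : JetBundle n G p) (w v) :
    HasDerivAt (fun t : ℝ => L.density j.pt (j.jet.translate (t • w)) v)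
      (fibreDeriv L j w v) 0 :=
  (exists_fibreDeriv L j).choose_spec w v

/-- `p^l_i ∘ L̂ = ∂𝓛/∂y^i_l` in all fibred coordinates. -/
theorem momCoord_fibreDeriv [FiniteDimensional ℝ G] (L : Lagrangian n G p) (j : JetBundle n G p)
    (c : FibredChart n G p) (hj : j.pt ∈ c.chart.source) (l : Fin n) (g : G) :
    c.momCoord j.pt (fibreDeriv L j) l g =
      fderiv ℝ (fun a => c.lagCoord L.density ((c.chart j.pt).1, (c.chart j.pt).2, a))
        (c.jetCoord j.pt j.jet) (elem l g) := by
  have : fibreDeriv L j = c.momOf j.pt (fun l =>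
      (fderiv ℝ (fun a => c.lagCoord L.density ((c.chart j.pt).1, (c.chart j.pt).2, a))
        (c.jetCoord j.pt j.jet)).comp (elemL l)) := by
    refine LinearMap.ext fun w => AlternatingMap.ext fun v => ?_
    exact (hasDerivAt_fibreDeriv L j w v).unique (c.hasDerivAt_lagrangian L hj j.jet w v)
  rw [this, c.momCoord_momOf hj]
  rfl

theorem mdifferentiableAt_pt (j : JetBundle n G p) :
    MDifferentiableAt 𝓘(ℝ, Eu n × (G × (Eu n →L[ℝ] G))) 𝓘(ℝ, Eu n × G)
      (JetBundle.pt : JetBundle n G p → M) j := by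
  let c := chartOf (n := n) (G := G) p j.pt
  have hj : j.pt ∈ c.chart.source := mem_chartOf p j.pt
  let f := chartAt (Eu n × (G × (Eu n →L[ℝ] G))) j
  have hf : ∀ i : JetBundle n G p, f i = ((c.chart i.pt).1, (c.chart i.pt).2, c.jetCoord i.pt i.jet) :=
    fun i => rfl
  have hs : f.source = {i | i.pt ∈ c.chart.source} := rfl
  have h1 : MDifferentiableAt 𝓘(ℝ, Eu n × (G × (Eu n →L[ℝ] G)))
      𝓘(ℝ, Eu n × (G × (Eu n →L[ℝ] G))) f j :=
    (contMDiffAt_of_mem_maximalAtlas (n := ∞) (IsManifold.chart_mem_maximalAtlas j)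
      (mem_chart_source _ j)).mdifferentiableAt (by simp)
  have h2 : MDifferentiableAt 𝓘(ℝ, Eu n × (G × (Eu n →L[ℝ] G))) 𝓘(ℝ, Eu n × G)
      (fun z : Eu n × (G × (Eu n →L[ℝ] G)) => (z.1, z.2.1)) (f j) := by
    apply DifferentiableAt.mdifferentiableAt
    fun_prop
  have h3 := (c.chart_mdiff).mdifferentiableAt_symm (c.chart.map_source hj)
  refine (h3.comp j (h2.comp j h1)).congr_of_eventuallyEq ?_
  filter_upwards [f.open_source.mem_nhds (mem_chart_source _ j)] with i hi
  rw [hs] at hi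
  simp [hf, c.chart.left_inv hi]

end Legendre

section Cartan

variable [IsManifold 𝓘(ℝ, Eu n) ∞ X] [IsManifold 𝓘(ℝ, Eu n × G) ∞ M]
  {p : M → X} [IsSmoothFibreBundle (Eu n) (Eu n × G) G p]

variable (n G) in
/-- The projection `J¹M → X`. -/
abbrev JetBundle.proj (p : M → X) (j : JetBundle n G p) : X := p j.pt

/-- The map `J¹J¹M → J¹M`, `(x, y, y_l, ŷ_l, …) ↦ (x, y, ŷ_l)`, which is the prolongation of the
projection `J¹M → M`. -/
def Jet.projectPt {j : JetBundle n G p}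
    (A : Jet n (G × (Eu n →L[ℝ] G)) (JetBundle.proj n G p) j) : Jet n G p j.pt :=
  ⟨(mfderiv 𝓘(ℝ, Eu n × (G × (Eu n →L[ℝ] G))) 𝓘(ℝ, Eu n × G)
      (JetBundle.pt : JetBundle n G p → M) j).comp A.1, by
    have h := A.2
    have h1 : tangentMapAt n (G × (Eu n →L[ℝ] G)) (JetBundle.proj n G p) j =
        (tangentMapAt n G p j.pt).comp (mfderiv 𝓘(ℝ, Eu n × (G × (Eu n →L[ℝ] G))) 𝓘(ℝ, Eu n × G)
          (JetBundle.pt : JetBundle n G p → M) j) :=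
      mfderiv_comp (I' := 𝓘(ℝ, Eu n × G)) (g := p) j
        (FibredChart.proj_mdifferentiableAt (mem_chartOf p j.pt)) (mdifferentiableAt_pt j)
    exact (congrArg (fun f => f.comp A.1) h1).symm.trans h⟩

/-- The Lagrangian `L̄ = (𝓛 + (ŷ^i_l - y^i_l) π^l_i) ω` on `J¹J¹M`, where `π^l_i = ∂𝓛/∂y^i_l`. -/
def cartanDensity (L : Lagrangian n G p) :
    LagrangianDensity n (G × (Eu n →L[ℝ] G)) (JetBundle.proj n G p) :=
  fun j A => L.density j.pt j.jet + fibreDeriv L j (A.projectPt.diff j.jet)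

/-- `s` is a smooth section of `J¹M → X` that satisfies the Cartan equations of `L`, which are the
Euler-Lagrange equations of `L̄`. -/
def IsCartanSolution (L : Lagrangian n G p) (s : X → JetBundle n G p) : Prop :=
  IsEulerLagrangeSolution n (G × (Eu n →L[ℝ] G)) (JetBundle.proj n G p) (cartanDensity L) s

end Cartan

section Hamiltonian

variable [FiniteDimensional ℝ G]

namespace FibredChart
variable {p : M → X} (c : FibredChart n G p)

open Classical in
/-- The function `𝓗(x^l, y^i, p^l_i)` for a map `h` from `Π` to forms
`p^l_i dy^i ∧ ω_l - 𝓗 ω`. The pull-back of such a form along the jet with `y^i_l = 0` is `-𝓗 ω`. -/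
def hamCoord (h : ∀ q : LegendreBundle n G p,
      AlternatingMap ℝ (TangentSpace 𝓘(ℝ, Eu n × G) q.pt) ℝ (Fin n))
    (z : Eu n × (G × MomentumModel n G)) : ℝ :=
  if hz : (z.1, z.2.1) ∈ c.chart.target then
    -c.coef _ ((h (c.momChart.symm z)).compLinearMap
      (c.jetOf (c.chart.map_target hz) 0).1.toLinearMap)
  else 0

end FibredChart

variable (n G) in
/-- A Hamiltonian: a smooth section `p = -𝓗` of `ζ : Z → Π`, where
`Z = T*M ∧ Λⁿ⁻¹ T*X` is the homogeneous Legendre bundle. The elements of `Z` are the `n`-forms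
`p^l_i dy^i ∧ ω_l + p ω` on the tangent spaces of `M`; they are the forms that vanish on any
two vertical vectors (`horizontal`). As a jet `A` pulls back such a form to `(p^l_i y^i_l + p) ω`, the
form lies over `q ∈ Π` iff its pull-back along `A + w` is that along `A` plus `q(w)` (`lifts`). -/
structure Hamiltonian (p : M → X) where
  form : ∀ q : LegendreBundle n G p,
    AlternatingMap ℝ (TangentSpace 𝓘(ℝ, Eu n × G) q.pt) ℝ (Fin n)
  horizontal : ∀ (q : LegendreBundle n G p) (v : Fin n → TangentSpace 𝓘(ℝ, Eu n × G) q.pt)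
    (i j : Fin n), i ≠ j → tangentMapAt n G p q.pt (v i) = 0 → tangentMapAt n G p q.pt (v j) = 0 →
      form q v = 0
  lifts : ∀ (q : LegendreBundle n G p) (j : Jet n G p q.pt) (w : VertHom n G p q.pt),
    (form q).compLinearMap (j.translate w).1.toLinearMap =
      (form q).compLinearMap j.1.toLinearMap + q.mom w
  smooth : ∀ c : FibredChart n G p,
    ContDiffOn ℝ ∞ (c.hamCoord form) {z | (z.1, z.2.1) ∈ c.chart.target}

namespace FibredChart
variable {p : M → X} (c : FibredChart n G p)

theorem hamCoord_chart (H : Hamiltonian n G p) {e : M} (he : e ∈ c.chart.source)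
    (P : MomentumModel n G) :
    c.hamCoord H.form ((c.chart e).1, (c.chart e).2, P) =
      -c.coef (p e) ((H.form ⟨e, c.momOf e P⟩).compLinearMap (c.jetOf he 0).1.toLinearMap) := by
  have h : c.chart e ∈ c.chart.target := c.chart.map_source he
  have key : ∀ e' (h1 : e' ∈ c.chart.source), e' = e →
      -c.coef (p e') ((H.form ⟨e', c.momOf e' P⟩).compLinearMap (c.jetOf h1 0).1.toLinearMap) =
      -c.coef (p e) ((H.form ⟨e, c.momOf e P⟩).compLinearMap (c.jetOf he 0).1.toLinearMap) := by
    rintro e' h1 rfl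
    rfl
  simp only [hamCoord, Prod.mk.eta, h, dif_pos]
  exact key _ _ (c.chart.left_inv he)

/-- In coordinates, the pull-back of the form along a jet is `(p^l_i y^i_l - 𝓗) ω`. -/
theorem coef_form (H : Hamiltonian n G p) {e : M} (he : e ∈ c.chart.source)
    (q : LegendreFibre n G p e) (j : Jet n G p e) :
    c.coef (p e) ((H.form ⟨e, q⟩).compLinearMap j.1.toLinearMap) =
      pairing (c.momCoord e q) (c.jetCoord e j) -
        c.hamCoord H.form ((c.chart e).1, (c.chart e).2, c.momCoord e q) := by
  rw [c.hamCoord_chart H he, c.momOf_momCoord he, c.pairing_momCoord he]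
  have hj : j = (c.jetOf he 0).translate (c.vertOf he (c.jetCoord e j)) := by
    apply c.ext_jet he
    rw [c.jetCoord_translate, c.jetCoord_jetOf, c.vertCoord_vertOf, zero_add]
  conv_lhs => rw [hj, H.lifts ⟨e, q⟩, coef_add]
  simp only
  ring

theorem momCoord_add {e : M} (he : e ∈ c.chart.source) (q q' : LegendreFibre n G p e) :
    c.momCoord e (q + q') = c.momCoord e q + c.momCoord e q' := by
  ext l g; simp only [c.momCoord_apply he, Pi.add_apply, add_apply, LinearMap.add_apply, coef_add]

theorem momCoord_smul {e : M} (he : e ∈ c.chart.source) (r : ℝ) (q : LegendreFibre n G p e) :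
    c.momCoord e (r • q) = r • c.momCoord e q := by
  ext l g; simp only [c.momCoord_apply he, Pi.smul_apply, smul_apply, LinearMap.smul_apply, coef_smul,
    smul_eq_mul]

theorem hasDerivAt_hamiltonian (H : Hamiltonian n G p) {e : M} (he : e ∈ c.chart.source)
    (q δ : LegendreFibre n G p e) (j : Jet n G p e)
    (v : Fin n → TangentSpace 𝓘(ℝ, Eu n) (p e)) :
    HasDerivAt (fun t : ℝ => (H.form ⟨e, q + t • δ⟩).compLinearMap j.1.toLinearMap v)
      ((pairing (c.momCoord e δ) (c.jetCoord e j) -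
        fderiv ℝ (fun P => c.hamCoord H.form ((c.chart e).1, (c.chart e).2, P)) (c.momCoord e q)
          (c.momCoord e δ)) * c.vol (p e) v) 0 := by
  have h0 : ∀ t : ℝ, (H.form ⟨e, q + t • δ⟩).compLinearMap j.1.toLinearMap v =
      (pairing (c.momCoord e q + t • c.momCoord e δ) (c.jetCoord e j) -
        c.hamCoord H.form ((c.chart e).1, (c.chart e).2, c.momCoord e q + t • c.momCoord e δ)) *
        c.vol (p e) v := by
    intro t
    rw [← c.momCoord_smul he, ← c.momCoord_add he, ← c.coef_form H he]
    conv_lhs => rw [c.eq_coef_smul_vol (c.mapsTo e he)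
      ((H.form ⟨e, q + t • δ⟩).compLinearMap j.1.toLinearMap)]
    rfl
  have hopen : IsOpen {z : Eu n × (G × MomentumModel n G) | (z.1, z.2.1) ∈ c.chart.target} :=
    c.chart.open_target.preimage
      (f := fun z : Eu n × (G × MomentumModel n G) => (z.1, z.2.1)) (by fun_prop)
  have h1 : DifferentiableAt ℝ (c.hamCoord H.form)
      ((c.chart e).1, (c.chart e).2, c.momCoord e q) :=
    ((H.smooth c).contDiffAt (hopen.mem_nhds (c.chart.map_source he))).differentiableAt (by simp)
  have h2 : DifferentiableAt ℝ
      (fun P => c.hamCoord H.form ((c.chart e).1, (c.chart e).2, P)) (c.momCoord e q) := by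
    have h6 : DifferentiableAt ℝ (fun P : MomentumModel n G =>
      ((c.chart e).1, (c.chart e).2, P)) (c.momCoord e q) := by fun_prop
    exact h1.comp (c.momCoord e q) h6
  have h3 : HasDerivAt (fun t : ℝ => c.momCoord e q + t • c.momCoord e δ) (c.momCoord e δ) 0 := by
    simpa using ((hasDerivAt_id (0 : ℝ)).smul_const (c.momCoord e δ)).const_add (c.momCoord e q)
  have h4 := HasFDerivAt.comp_hasDerivAt (0 : ℝ) (by simpa using h2.hasFDerivAt) h3
  have h5 : HasDerivAt (fun t : ℝ => pairing (c.momCoord e q + t • c.momCoord e δ) (c.jetCoord e j))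
      (pairing (c.momCoord e δ) (c.jetCoord e j)) 0 := by
    simp only [add_pairing, smul_pairing]
    simpa using ((hasDerivAt_id (0 : ℝ)).mul_const
      (pairing (c.momCoord e δ) (c.jetCoord e j))).const_add
        (pairing (c.momCoord e q) (c.jetCoord e j))
  exact ((h5.sub h4).mul_const (c.vol (p e) v)).congr_of_eventuallyEq
    (Filter.Eventually.of_forall h0)

theorem exists_bidual (φ : MomentumModel n G →L[ℝ] ℝ) :
    ∃ a : Eu n →L[ℝ] G, ∀ P : MomentumModel n G, pairing P a = φ P := by
  have h : ∀ l : Fin n, ∃ g : G, ∀ P : G →L[ℝ] ℝ, P g = φ (Pi.single l P) := by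
    intro l
    obtain ⟨g, hg⟩ := (Module.evalEquiv ℝ G).surjective
      ((φ.toLinearMap.comp (LinearMap.single ℝ (fun _ : Fin n => G →L[ℝ] ℝ) l)).comp
        (LinearMap.toContinuousLinearMap (𝕜 := ℝ) (E := G) (F' := ℝ)).toLinearMap)
    refine ⟨g, fun P => ?_⟩
    have := congrArg (fun f => f P.toLinearMap) hg
    have hP : LinearMap.toContinuousLinearMap P.toLinearMap = P := by ext; rfl
    simpa [hP] using this
  choose g hg using h
  refine ⟨∑ l, elem l (g l), fun P => ?_⟩
  have h1 : ∀ s : Finset (Fin n), pairing P (∑ l ∈ s, elem l (g l)) =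
      ∑ l ∈ s, φ (Pi.single l (P l)) := by
    intro s
    induction s using Finset.cons_induction with
    | empty => simp [pairing]
    | cons a s ha ih => rw [Finset.sum_cons, Finset.sum_cons, pairing_add, pairing_elem, hg, ih]
  rw [h1, ← map_sum, Finset.univ_sum_single]

end FibredChart

variable [IsManifold 𝓘(ℝ, Eu n) ∞ X] [IsManifold 𝓘(ℝ, Eu n × G) ∞ M]
  {p : M → X} [IsSmoothFibreBundle (Eu n) (Eu n × G) G p]

theorem exists_hamiltonianJet (H : Hamiltonian n G p) (q : LegendreBundle n G p) :
    ∃ j : Jet n G p q.pt, ∀ (δ : LegendreFibre n G p q.pt)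
      (v : Fin n → TangentSpace 𝓘(ℝ, Eu n) (p q.pt)),
      HasDerivAt (fun t : ℝ => (H.form ⟨q.pt, q.mom + t • δ⟩).compLinearMap j.1.toLinearMap v) 0 0 := by
  have hc := mem_chartOf (n := n) (G := G) p q.pt
  set c := chartOf (n := n) (G := G) p q.pt
  obtain ⟨a, ha⟩ := FibredChart.exists_bidual
    (fderiv ℝ (fun P => c.hamCoord H.form ((c.chart q.pt).1, (c.chart q.pt).2, P))
      (c.momCoord q.pt q.mom))
  refine ⟨c.jetOf hc a, fun δ v => ?_⟩
  have := c.hasDerivAt_hamiltonian H hc q.mom δ (c.jetOf hc a) v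
  rwa [c.jetCoord_jetOf, ha, sub_self, zero_mul] at this

/-- The Hamiltonian map `Ĥ : Π → J¹M`, `y^i_l ∘ Ĥ = ∂𝓗/∂p^l_i` (see `jetCoord_hamiltonianMap`). It is
characterized intrinsically by `hasDerivAt_hamiltonianMap`: at the jet `Ĥ(q)`, the derivative of
`p^l_i y^i_l - 𝓗` along the fibre of `Π → M` vanishes. -/
def hamiltonianMap (H : Hamiltonian n G p) (q : LegendreBundle n G p) : JetBundle n G p :=
  ⟨q.pt, (exists_hamiltonianJet H q).choose⟩

theorem hasDerivAt_hamiltonianMap (H : Hamiltonian n G p) (q : LegendreBundle n G p)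
    (δ : LegendreFibre n G p q.pt) (v : Fin n → TangentSpace 𝓘(ℝ, Eu n) (p q.pt)) :
    HasDerivAt (fun t : ℝ => (H.form ⟨q.pt, q.mom + t • δ⟩).compLinearMap
      (hamiltonianMap H q).jet.1.toLinearMap v) 0 0 :=
  (exists_hamiltonianJet H q).choose_spec δ v

/-- `y^i_l ∘ Ĥ = ∂𝓗/∂p^l_i` in all fibred coordinates. -/
theorem jetCoord_hamiltonianMap (H : Hamiltonian n G p) (q : LegendreBundle n G p)
    (c : FibredChart n G p) (hq : q.pt ∈ c.chart.source) (P : MomentumModel n G) :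
    pairing P (c.jetCoord q.pt (hamiltonianMap H q).jet) =
      fderiv ℝ (fun P' => c.hamCoord H.form ((c.chart q.pt).1, (c.chart q.pt).2, P'))
        (c.momCoord q.pt q.mom) P := by
  have h1 := hasDerivAt_hamiltonianMap H q (c.momOf q.pt P)
    (fun l => c.frame (p q.pt) (EuclideanSpace.single l 1))
  have h2 := c.hasDerivAt_hamiltonian H hq q.mom (c.momOf q.pt P) (hamiltonianMap H q).jet
    (fun l => c.frame (p q.pt) (EuclideanSpace.single l 1))
  have h3 := h2.unique h1
  have h4 : c.vol (p q.pt) (fun l => c.frame (p q.pt) (EuclideanSpace.single l 1)) = 1 :=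
    c.coef_vol (c.mapsTo _ hq)
  rw [h4, mul_one, c.momCoord_momOf hq] at h3
  linarith

/-- The Hamiltonian form `H = p^l_i dy^i ∧ ω_l - 𝓗 ω` as an `n`-form on the manifold `Π`. -/
def hamiltonianForm (H : Hamiltonian n G p) (q : LegendreBundle n G p) :
    AlternatingMap ℝ (TangentSpace 𝓘(ℝ, Eu n × (G × MomentumModel n G)) q) ℝ (Fin n) :=
  (H.form q).compLinearMap (mfderiv 𝓘(ℝ, Eu n × (G × MomentumModel n G))
    𝓘(ℝ, Eu n × G) (LegendreBundle.pt : LegendreBundle n G p → M) q).toLinearMap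

/-- The Lagrangian constraint space `N_L = L̂(J¹M)`. -/
abbrev constraintSpace (L : Lagrangian n G p) : Set (LegendreBundle n G p) :=
  Set.range (legendreMap L)

/-- The Legendre map as a surjection `J¹M → N_L`. -/
def legendreRestrict (L : Lagrangian n G p) (j : JetBundle n G p) : constraintSpace L :=
  ⟨legendreMap L j, j, rfl⟩

section Constraint

/-- The projection `N_L → X`. -/
abbrev constraintProj (L : Lagrangian n G p) (ν : constraintSpace L) : X := p ν.1.pt

/-- `L` is almost-regular: with the given smooth structure (coordinates `(x^l, y^i, z^a)`, `z ∈ ℝᵏ`),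
`N_L` is a closed imbedded subbundle of `Π → M`, and `L̂ : J¹M → N_L` is a fibred manifold
(a surjective submersion) with connected fibres. -/
structure IsAlmostRegular (k : ℕ) (L : Lagrangian n G p)
    [ChartedSpace (Eu n × (G × Eu k)) (constraintSpace L)] : Prop where
  isClosed : IsClosed (constraintSpace L)
  isManifold : IsManifold 𝓘(ℝ, Eu n × (G × Eu k)) ∞ (constraintSpace L)
  isSmoothEmbedding : Manifold.IsSmoothEmbedding 𝓘(ℝ, Eu n × (G × Eu k))
    𝓘(ℝ, Eu n × (G × MomentumModel n G)) ∞
    (Subtype.val : constraintSpace L → LegendreBundle n G p)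
  isSmoothFibreBundle : IsSmoothFibreBundle (Eu n × G) (Eu n × (G × Eu k)) (Eu k)
    (fun ν : constraintSpace L => ν.1.pt)
  isSubmersion : Manifold.IsSubmersion 𝓘(ℝ, Eu n × (G × (Eu n →L[ℝ] G)))
    𝓘(ℝ, Eu n × (G × Eu k)) ∞ (legendreRestrict L)
  isConnected_fibre : ∀ ν : constraintSpace L, IsConnected (legendreRestrict L ⁻¹' {ν})

/-- `H` is associated to `L`: on the constraint space `N_L`,
`p^l_i = ∂𝓛/∂y^i_l (x, y, ∂𝓗/∂p)` and `p^l_i ∂𝓗/∂p^l_i - 𝓗 = 𝓛 (x, y, ∂𝓗/∂p)`. (By `coef_form`, the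
left-hand side of the second relation is the pull-back of the form along the jet `Ĥ(q)`.) -/
structure IsAssociated (H : Hamiltonian n G p) (L : Lagrangian n G p) : Prop where
  legendre_hamiltonian : ∀ q ∈ constraintSpace L, legendreMap L (hamiltonianMap H q) = q
  energy : ∀ q ∈ constraintSpace L,
    (H.form q).compLinearMap (hamiltonianMap H q).jet.1.toLinearMap =
      L.density q.pt (hamiltonianMap H q).jet

/-- The constrained Lagrangian `L_N = h₀(i_N^* H)` on `J¹N_L`, where `i_N : N_L → Π` is the inclusion
and `h₀` is the pull-back of an `n`-form on `N_L` along jets of sections of `N_L → X`. -/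
def constrainedDensity (k : ℕ) (L : Lagrangian n G p) (H : Hamiltonian n G p)
    [ChartedSpace (Eu n × (G × Eu k)) (constraintSpace L)] :
    LagrangianDensity n (G × Eu k) (constraintProj L) :=
  fun ν A => ((hamiltonianForm H ν.1).compLinearMap
    (mfderiv 𝓘(ℝ, Eu n × (G × Eu k)) 𝓘(ℝ, Eu n × (G × MomentumModel n G))
      (Subtype.val : constraintSpace L → LegendreBundle n G p) ν).toLinearMap).compLinearMap
    A.1.toLinearMap

/-- `r` is a smooth section of `N_L → X` that satisfies the constrained Hamilton equations, which
are the Euler-Lagrange equations of `L_N`. -/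
def IsConstrainedHamiltonSolution (k : ℕ) (L : Lagrangian n G p) (H : Hamiltonian n G p)
    [ChartedSpace (Eu n × (G × Eu k)) (constraintSpace L)] (r : X → constraintSpace L) : Prop :=
  IsEulerLagrangeSolution n (G × Eu k) (constraintProj L) (constrainedDensity k L H) r

end Constraint

end Hamiltonian

end Jets

end Polysymplectic

end

open Polysymplectic

/-!
# Cartan equations and constrained Hamilton equations

Let `H` be a Hamiltonian associated to an almost-regular Lagrangian `L`. Every map `f : N → Π` over the
base pulls the Hamiltonian form back to a Lagrangian `h₀(f^* H)` on `J¹N` (`hamiltonianPullback`). The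
constrained Lagrangian is by definition the one for the inclusion `N_L → Π` (`constrainedDensity_eq`).
The Lagrangian `L̄` of the Cartan equations is the one for the Legendre map `J¹M → Π`
(`cartanDensity_eq`): this is the identity `𝓛 = π^l_i y^i_l - 𝓗 ∘ L̂` on `J¹M` (`form_legendreMap`). It holds
at the points `Ĥ(q)`, `q ∈ N_L`, because `H` is associated to `L`. The energy `π^l_i y^i_l - 𝓛` is
constant on each fibre of `L̂`, as the fibre is connected and, `L̂` being a submersion onto `N_L`, locally
connected by differentiable paths; and each fibre contains such a point.

The Euler-Lagrange expression is natural (`eulerLagrange_pullback`). For a pull-back along `f` its value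
at a section `s` in a vertical direction `v` is the expression of `p^l_i y^i_l - 𝓗` on `Π` at `f ∘ s` in
the direction `Tf(v)`. As `L̂` maps the vertical directions of `J¹M` onto those of `N_L`
(`fderiv_momentumRep_legendre`), the equations for `s` and for `L̂ ∘ s` are equivalent.

For the last assertion, `L̂ ∘ Ĥ'` is the identity of `N_L` for every associated `H'`, and `Ĥ'` is smooth
(`contMDiff_hamiltonianMap`), so the equivalence applies to `s = Ĥ' ∘ r`.
-/

open scoped Manifold ContDiff Topology

/-! ### Euler-Lagrange expressions and their naturality -/

namespace Polysymplectic

section EulerLagrange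

variable {n : ℕ} {G G' : Type*} [NormedAddCommGroup G] [NormedSpace ℝ G]
  [NormedAddCommGroup G'] [NormedSpace ℝ G']

/-- The Euler-Lagrange expression `∂_v ℓ (x, σ, Dσ) - ∑ l, ∂_l [∂ℓ/∂(dx^l ⊗ v) (x, σ, Dσ)]` of a function
`ℓ` of `(x, y, y_l)` at a map `σ`, in the fibre direction `v`. It agrees definitionally with the
left-hand side of the equations in `IsEulerLagrangeSolution`. -/
noncomputable def eulerLagrange (ℓ : Eu n × (G × (Eu n →L[ℝ] G)) → ℝ) (σ : Eu n → G) (x : Eu n)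
    (v : G) : ℝ :=
  fderiv ℝ (fun y : G => ℓ (x, y, fderiv ℝ σ x)) (σ x) v -
    ∑ l : Fin n, fderiv ℝ (fun x' : Eu n =>
      fderiv ℝ (fun a : Eu n →L[ℝ] G => ℓ (x', σ x', a)) (fderiv ℝ σ x') (elem l v))
      x (EuclideanSpace.single l 1)

/-- The Euler-Lagrange expression depends only on the germs of `ℓ` and `σ`. -/
theorem eulerLagrange_congr {ℓ ℓ' : Eu n × (G × (Eu n →L[ℝ] G)) → ℝ} {σ σ' : Eu n → G} {x : Eu n}
    (hσ : σ =ᶠ[𝓝 x] σ') (hc : ContDiffAt ℝ 2 σ x)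
    (hℓ : ℓ =ᶠ[𝓝 (x, σ x, fderiv ℝ σ x)] ℓ') (v : G) :
    eulerLagrange ℓ σ x v = eulerLagrange ℓ' σ' x v := by
  have hD : fderiv ℝ σ =ᶠ[𝓝 x] fderiv ℝ σ' := hσ.fderiv
  have hcD : ContinuousAt (fderiv ℝ σ) x := (hc.fderiv_right (m := 1) (by norm_num)).continuousAt
  have hlift : ContinuousAt (fun x' => (x', σ x', fderiv ℝ σ x')) x :=
    continuousAt_id.prodMk (hc.continuousAt.prodMk hcD)
  have h2 : ∀ᶠ x' in 𝓝 x, ℓ =ᶠ[𝓝 (x', σ x', fderiv ℝ σ x')] ℓ' :=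
    hlift.eventually hℓ.eventually_nhds
  unfold eulerLagrange
  congr 1
  · rw [← hσ.eq_of_nhds, ← hD.eq_of_nhds]
    have : Filter.Tendsto (fun y : G => (x, y, fderiv ℝ σ x)) (𝓝 (σ x))
      (𝓝 (x, σ x, fderiv ℝ σ x)) := Continuous.tendsto (by fun_prop) _
    have h3 : (fun y => ℓ (x, y, fderiv ℝ σ x)) =ᶠ[𝓝 (σ x)] (fun y => ℓ' (x, y, fderiv ℝ σ x)) :=
      this.eventually hℓ
    rw [h3.fderiv_eq]
  · refine Finset.sum_congr rfl fun l _ => ?_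
    congr 1
    apply Filter.EventuallyEq.fderiv_eq
    filter_upwards [h2, hσ, hD] with x' h3 h4 h5
    rw [← h4, ← h5]
    have : Filter.Tendsto (fun a : Eu n →L[ℝ] G => (x', σ x', a)) (𝓝 (fderiv ℝ σ x'))
      (𝓝 (x', σ x', fderiv ℝ σ x')) := Continuous.tendsto (by fun_prop) _
    have h6 : (fun a => ℓ (x', σ x', a)) =ᶠ[𝓝 (fderiv ℝ σ x')] (fun a => ℓ' (x', σ x', a)) :=
      this.eventually h3
    rw [h6.fderiv_eq]

theorem fderiv_fibre {ℓ : Eu n × (G × (Eu n →L[ℝ] G)) → ℝ} {x : Eu n} {y : G} {a : Eu n →L[ℝ] G}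
    (h : DifferentiableAt ℝ ℓ (x, y, a)) (b : Eu n →L[ℝ] G) :
    fderiv ℝ (fun a => ℓ (x, y, a)) a b = fderiv ℝ ℓ (x, y, a) (0, 0, b) := by
  have h1 : HasFDerivAt (fun a : Eu n →L[ℝ] G => (x, y, a))
      ((0 : (Eu n →L[ℝ] G) →L[ℝ] Eu n).prod
        ((0 : (Eu n →L[ℝ] G) →L[ℝ] G).prod (ContinuousLinearMap.id ℝ _))) a :=
    (hasFDerivAt_const x a).prodMk ((hasFDerivAt_const y a).prodMk (hasFDerivAt_id a))
  have h2 := HasFDerivAt.comp a h.hasFDerivAt h1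
  have h3 := h2.fderiv
  exact congrArg (fun f => f b) h3

/-- The first variation formula before integration: along a variation field `w`, the derivative of
`ℓ` at the 1-jet of `σ` in the direction of the 1-jet of `w` is the Euler-Lagrange expression plus a
divergence. Allowing `w` to depend on `x` makes the formula compatible with changes of fibre
coordinates. -/
theorem eulerLagrange_eq {ℓ : Eu n × (G × (Eu n →L[ℝ] G)) → ℝ} {σ : Eu n → G} {x : Eu n}
    (hℓ : ContDiffAt ℝ 2 ℓ (x, σ x, fderiv ℝ σ x)) (hσ : ContDiffAt ℝ 2 σ x) (w : Eu n → G)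
    (hw : DifferentiableAt ℝ w x) :
    fderiv ℝ ℓ (x, σ x, fderiv ℝ σ x) (0, w x, fderiv ℝ w x) -
      ∑ l : Fin n, fderiv ℝ (fun x' => fderiv ℝ ℓ (x', σ x', fderiv ℝ σ x') (0, 0, elem l (w x'))) x
        (EuclideanSpace.single l 1) = eulerLagrange ℓ σ x (w x) := by
  have hDσ : ContDiffAt ℝ 1 (fderiv ℝ σ) x := hσ.fderiv_right (m := 1) (by norm_num)
  have hlift : ContDiffAt ℝ 1 (fun x' => (x', σ x', fderiv ℝ σ x')) x :=
    contDiffAt_id.prodMk ((hσ.of_le (by norm_num)).prodMk hDσ)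
  have hDℓ : ContDiffAt ℝ 1 (fderiv ℝ ℓ) (x, σ x, fderiv ℝ σ x) :=
    hℓ.fderiv_right (m := 1) (by norm_num)
  have hQ : ContDiffAt ℝ 1 (fun x' => fderiv ℝ ℓ (x', σ x', fderiv ℝ σ x')) x :=
    ContDiffAt.comp (g := fderiv ℝ ℓ) x hDℓ hlift
  have hQd := hQ.differentiableAt (by norm_num)
  have hev : ∀ᶠ x' in 𝓝 x, DifferentiableAt ℝ ℓ (x', σ x', fderiv ℝ σ x') := by
    refine hlift.continuousAt.eventually ?_
    filter_upwards [hℓ.eventually (by simp)] with z hz using hz.differentiableAt (by norm_num)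
  have key : ∀ (l : Fin n) (u : Eu n → G), DifferentiableAt ℝ u x → 
      fderiv ℝ (fun x' => fderiv ℝ ℓ (x', σ x', fderiv ℝ σ x') (0, 0, elem l (u x'))) x
        (EuclideanSpace.single l 1) =
      fderiv ℝ (fun x' => fderiv ℝ ℓ (x', σ x', fderiv ℝ σ x')) x (EuclideanSpace.single l 1)
        (0, 0, elem l (u x)) +
      fderiv ℝ ℓ (x, σ x, fderiv ℝ σ x)
        (0, 0, elem l (fderiv ℝ u x (EuclideanSpace.single l 1))) := by
    intro l u hu
    have h1 : HasFDerivAt (fun x' => ((0, 0, elemL l (u x')) : Eu n × (G × (Eu n →L[ℝ] G))))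
      ((0 : Eu n →L[ℝ] Eu n).prod ((0 : Eu n →L[ℝ] G).prod ((elemL l).comp (fderiv ℝ u x)))) x :=
      (hasFDerivAt_const _ _).prodMk ((hasFDerivAt_const _ _).prodMk
        (HasFDerivAt.comp (g := elemL l) x
          (elemL (n := n) (G := G) l).hasFDerivAt hu.hasFDerivAt))
    have h2 := (hQd.hasFDerivAt.clm_apply h1).fderiv
    have h3 := congrArg (fun f => f (EuclideanSpace.single l 1)) h2
    refine h3.trans ?_
    simp only [add_apply, ContinuousLinearMap.comp_apply, ContinuousLinearMap.flip_apply]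
    rw [add_comm]
    rfl
  have hE : ∀ l : Fin n, fderiv ℝ (fun x' : Eu n =>
      fderiv ℝ (fun a : Eu n →L[ℝ] G => ℓ (x', σ x', a)) (fderiv ℝ σ x') (elem l (w x)))
      x (EuclideanSpace.single l 1) =
      fderiv ℝ (fun x' => fderiv ℝ ℓ (x', σ x', fderiv ℝ σ x')) x (EuclideanSpace.single l 1)
        (0, 0, elem l (w x)) := by
    intro l
    have h1 : (fun x' : Eu n =>
      fderiv ℝ (fun a : Eu n →L[ℝ] G => ℓ (x', σ x', a)) (fderiv ℝ σ x') (elem l (w x))) =ᶠ[𝓝 x]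
      (fun x' => fderiv ℝ ℓ (x', σ x', fderiv ℝ σ x') (0, 0, elem l (w x))) := by
      filter_upwards [hev] with x' hx' using fderiv_fibre hx' _
    rw [h1.fderiv_eq, key l (fun _ => w x) (differentiableAt_const _)]
    have h0 : elem l (0 : G) = (0 : Eu n →L[ℝ] G) := (elemL l).map_zero
    have h00 : ((0, 0, 0) : Eu n × (G × (Eu n →L[ℝ] G))) = 0 := rfl
    simp [h0, h00]
  have hy : fderiv ℝ (fun y : G => ℓ (x, y, fderiv ℝ σ x)) (σ x) (w x) =
      fderiv ℝ ℓ (x, σ x, fderiv ℝ σ x) (0, w x, 0) := by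
    have h1 : HasFDerivAt (fun y : G => (x, y, fderiv ℝ σ x))
      ((0 : G →L[ℝ] Eu n).prod ((ContinuousLinearMap.id ℝ G).prod
        (0 : G →L[ℝ] (Eu n →L[ℝ] G)))) (σ x) :=
      (hasFDerivAt_const _ _).prodMk ((hasFDerivAt_id _).prodMk (hasFDerivAt_const _ _))
    have h2 := (HasFDerivAt.comp (σ x) hev.self_of_nhds.hasFDerivAt h1).fderiv
    exact congrArg (fun f => f (w x)) h2
  have hsum : ∑ l, fderiv ℝ ℓ (x, σ x, fderiv ℝ σ x)
        (0, 0, elem l (fderiv ℝ w x (EuclideanSpace.single l 1))) =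
      fderiv ℝ ℓ (x, σ x, fderiv ℝ σ x) (0, 0, fderiv ℝ w x) := by
    rw [← map_sum]
    congr 1
    refine Prod.ext (by simp [Prod.fst_sum]) (Prod.ext (by simp [Prod.fst_sum, Prod.snd_sum]) ?_)
    simp only [Prod.snd_sum]
    exact sum_elem _
  have hsplit : ((0, w x, fderiv ℝ w x) : Eu n × (G × (Eu n →L[ℝ] G))) =
      (0, w x, 0) + (0, 0, fderiv ℝ w x) := by simp
  unfold eulerLagrange
  rw [Finset.sum_congr rfl fun l _ => key l w hw, Finset.sum_add_distrib, hsum, hsplit, map_add, hy,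
    Finset.sum_congr rfl fun l _ => hE l]
  ring


/-- The 1-jet prolongation `(x, y, a) ↦ (x, Φ, Φ_x + Φ_y ∘ a)` of the map `(x, y) ↦ (x, Φ (x, y))`. -/
noncomputable def prolong (Φ : Eu n × G → G') (z : Eu n × (G × (Eu n →L[ℝ] G))) :
    Eu n × (G' × (Eu n →L[ℝ] G')) :=
  (z.1, Φ (z.1, z.2.1),
    (fderiv ℝ Φ (z.1, z.2.1)).comp ((ContinuousLinearMap.id ℝ (Eu n)).prod z.2.2))

theorem contDiffAt_prolong {Φ : Eu n × G → G'} {x : Eu n} {y : G} (hΦ : ContDiffAt ℝ 3 Φ (x, y))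
    (a : Eu n →L[ℝ] G) : ContDiffAt ℝ 2 (prolong Φ) (x, y, a) := by
  have h0 : ContDiffAt ℝ 2 (fun z : Eu n × (G × (Eu n →L[ℝ] G)) => (z.1, z.2.1)) (x, y, a) := by
    fun_prop
  have h1 : ContDiffAt ℝ 2 (fun z : Eu n × (G × (Eu n →L[ℝ] G)) => Φ (z.1, z.2.1)) (x, y, a) :=
    ContDiffAt.comp (g := Φ) (x, y, a) (hΦ.of_le (by norm_num)) h0
  have h2 : ContDiffAt ℝ 2 (fun z : Eu n × (G × (Eu n →L[ℝ] G)) => fderiv ℝ Φ (z.1, z.2.1))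
      (x, y, a) :=
    ContDiffAt.comp (g := fderiv ℝ Φ) (x, y, a) (hΦ.fderiv_right (m := 2) (by norm_num)) h0
  have h3 : ContDiffAt ℝ 2 (fun z : Eu n × (G × (Eu n →L[ℝ] G)) =>
      (ContinuousLinearMap.id ℝ (Eu n)).prod z.2.2) (x, y, a) := by
    have h4 : (fun z : Eu n × (G × (Eu n →L[ℝ] G)) =>
        (ContinuousLinearMap.id ℝ (Eu n)).prod z.2.2) = fun z =>
        ContinuousLinearMap.inl ℝ (Eu n) G + (ContinuousLinearMap.inr ℝ (Eu n) G).comp z.2.2 := by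
      funext z
      ext <;> simp
    rw [h4]
    exact contDiffAt_const.add (contDiffAt_const.clm_comp (by fun_prop))
  exact contDiffAt_fst.prodMk (h1.prodMk (h2.clm_comp h3))

theorem fderiv_prolong_vert {Φ : Eu n × G → G'} {x : Eu n} {y : G} (hΦ : ContDiffAt ℝ 3 Φ (x, y))
    (a b : Eu n →L[ℝ] G) : fderiv ℝ (prolong Φ) (x, y, a) (0, 0, b) =
      (0, 0, (fderiv ℝ Φ (x, y)).comp ((0 : Eu n →L[ℝ] Eu n).prod b)) := by
  have hd := ((contDiffAt_prolong hΦ a).differentiableAt (by norm_num)).hasFDerivAt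
  have h1 : HasDerivAt (fun t : ℝ => ((x, y, a) : Eu n × (G × (Eu n →L[ℝ] G))) + t • (0, 0, b))
      (0, 0, b) 0 := by
    simpa only [id, one_smul] using ((hasDerivAt_id (0 : ℝ)).smul_const
      ((0, 0, b) : Eu n × (G × (Eu n →L[ℝ] G)))).const_add (x, y, a)
  have h2 := HasFDerivAt.comp_hasDerivAt (0 : ℝ) (by simpa using hd) h1
  have h3 : prolong Φ ∘ (fun t : ℝ => ((x, y, a) : Eu n × (G × (Eu n →L[ℝ] G))) + t • (0, 0, b)) =
      fun t : ℝ => prolong Φ (x, y, a) +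
        t • (0, 0, (fderiv ℝ Φ (x, y)).comp ((0 : Eu n →L[ℝ] Eu n).prod b)) := by
    funext t
    refine Prod.ext (by simp [prolong]) (Prod.ext (by simp [prolong]) ?_)
    ext u
    simp only [Function.comp, prolong, Prod.fst_add, Prod.snd_add, Prod.smul_fst, Prod.smul_snd,
      smul_zero, add_zero, ContinuousLinearMap.comp_apply, ContinuousLinearMap.prod_apply,
      add_apply, smul_apply, ← map_smul, ← map_add]
    simp
  rw [h3] at h2
  have h4 : HasDerivAt (fun t : ℝ => prolong Φ (x, y, a) +
        t • ((0, 0, (fderiv ℝ Φ (x, y)).comp ((0 : Eu n →L[ℝ] Eu n).prod b)) :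
          Eu n × (G' × (Eu n →L[ℝ] G'))))
      (0, 0, (fderiv ℝ Φ (x, y)).comp ((0 : Eu n →L[ℝ] Eu n).prod b)) 0 := by
    simpa using ((hasDerivAt_id (0 : ℝ)).smul_const
      ((0, 0, (fderiv ℝ Φ (x, y)).comp ((0 : Eu n →L[ℝ] Eu n).prod b)) :
          Eu n × (G' × (Eu n →L[ℝ] G')))).const_add (prolong Φ (x, y, a))
  exact h2.unique h4

theorem fderiv_prolong_fibre {Φ : Eu n × G → G'} {x : Eu n} {y : G} (hΦ : ContDiffAt ℝ 3 Φ (x, y))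
    (a : Eu n →L[ℝ] G) (v : G) : fderiv ℝ (prolong Φ) (x, y, a) (0, v, 0) =
      (0, fderiv ℝ Φ (x, y) (0, v), (fderiv ℝ (fderiv ℝ Φ) (x, y) (0, v)).comp
        ((ContinuousLinearMap.id ℝ (Eu n)).prod a)) := by
  have hd := ((contDiffAt_prolong hΦ a).differentiableAt (by norm_num)).hasFDerivAt
  have hl : ∀ z : Eu n × (G × (Eu n →L[ℝ] G)),
    HasDerivAt (fun t : ℝ => ((x, y, a) : Eu n × (G × (Eu n →L[ℝ] G))) + t • z) z 0 := by
    intro z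
    simpa using ((hasDerivAt_id (0 : ℝ)).smul_const z).const_add (x, y, a)
  have hl' : HasDerivAt (fun t : ℝ => ((x, y + t • v) : Eu n × G)) (0, v) 0 := by
    refine (hasDerivAt_const _ _).prodMk ?_
    simpa using ((hasDerivAt_id (0 : ℝ)).smul_const v).const_add y
  have h2 := HasFDerivAt.comp_hasDerivAt (0 : ℝ) (by simpa using hd) (hl (0, v, 0))
  have h5 : HasDerivAt (fun t : ℝ => Φ (x, y + t • v)) (fderiv ℝ Φ (x, y) (0, v)) 0 :=
    HasFDerivAt.comp_hasDerivAt (0 : ℝ)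
      (by simpa using (hΦ.differentiableAt (by norm_num)).hasFDerivAt) hl'
  have h6 : HasDerivAt (fun t : ℝ => fderiv ℝ Φ (x, y + t • v))
      (fderiv ℝ (fderiv ℝ Φ) (x, y) (0, v)) 0 :=
    HasFDerivAt.comp_hasDerivAt (0 : ℝ)
      (by simpa using ((hΦ.fderiv_right (m := 2) (by norm_num)).differentiableAt
        (by norm_num)).hasFDerivAt) hl'
  have h7 : HasDerivAt (fun t : ℝ => (fderiv ℝ Φ (x, y + t • v)).comp
      ((ContinuousLinearMap.id ℝ (Eu n)).prod a))
      ((fderiv ℝ (fderiv ℝ Φ) (x, y) (0, v)).comp ((ContinuousLinearMap.id ℝ (Eu n)).prod a)) 0 := by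
    simpa using h6.clm_comp (hasDerivAt_const (0 : ℝ) ((ContinuousLinearMap.id ℝ (Eu n)).prod a))
  have h8 := (hasDerivAt_const (0 : ℝ) x).prodMk (h5.prodMk h7)
  refine h2.unique (h8.congr_of_eventuallyEq (Filter.Eventually.of_forall fun t => ?_))
  simp [prolong]

theorem eventually_fderiv_comp_section {Φ : Eu n × G → G'} {σ : Eu n → G} {x : Eu n}
    (hσ : ContDiffAt ℝ 2 σ x) (hΦ : ContDiffAt ℝ 3 Φ (x, σ x)) :
    ∀ᶠ x' in 𝓝 x, fderiv ℝ (fun x' => Φ (x', σ x')) x' =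
      (fderiv ℝ Φ (x', σ x')).comp ((ContinuousLinearMap.id ℝ (Eu n)).prod (fderiv ℝ σ x')) := by
  have h0 : ContinuousAt (fun x' => (x', σ x')) x := continuousAt_id.prodMk hσ.continuousAt
  filter_upwards [hσ.eventually (by simp), h0.eventually (hΦ.eventually (by simp))] with x' h1 h2
  exact (HasFDerivAt.comp (g := Φ) x' (h2.differentiableAt (by norm_num)).hasFDerivAt
    ((hasFDerivAt_id x').prodMk (h1.differentiableAt (by norm_num)).hasFDerivAt)).fderiv

/-- Naturality of the Euler-Lagrange expression: for the pull-back of `ℓ` along the prolongation of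
`(x, y) ↦ (x, Φ (x, y))` it is that of `ℓ` at the image of `σ`, in the image of the direction `v`. `Φ` is
not assumed to be a diffeomorphism, nor a submersion. -/
theorem eulerLagrange_pullback {ℓ : Eu n × (G' × (Eu n →L[ℝ] G')) → ℝ} {Φ : Eu n × G → G'}
    {σ : Eu n → G} {x : Eu n} (hσ : ContDiffAt ℝ 2 σ x) (hΦ : ContDiffAt ℝ 3 Φ (x, σ x))
    (hℓ : ContDiffAt ℝ 2 ℓ (prolong Φ (x, σ x, fderiv ℝ σ x))) (v : G) :
    eulerLagrange (ℓ ∘ prolong Φ) σ x v =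
    eulerLagrange ℓ (fun x' => Φ (x', σ x')) x (fderiv ℝ Φ (x, σ x) (0, v)) := by
  have hDσ : ContDiffAt ℝ 1 (fderiv ℝ σ) x := hσ.fderiv_right (m := 1) (by norm_num)
  have hlift : ContinuousAt (fun x' => (x', σ x', fderiv ℝ σ x')) x :=
    continuousAt_id.prodMk (hσ.continuousAt.prodMk hDσ.continuousAt)
  have hgraph : ContDiffAt ℝ 2 (fun x' => (x', σ x')) x := contDiffAt_id.prodMk hσ
  have hgraphD : HasFDerivAt (fun x' => (x', σ x'))
      ((ContinuousLinearMap.id ℝ (Eu n)).prod (fderiv ℝ σ x)) x :=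
    (hasFDerivAt_id x).prodMk (hσ.differentiableAt (by norm_num)).hasFDerivAt
  have hτ : ContDiffAt ℝ 2 (fun x' => Φ (x', σ x')) x :=
    ContDiffAt.comp (g := Φ) x (hΦ.of_le (by norm_num)) hgraph
  have hDΦ : ContDiffAt ℝ 2 (fderiv ℝ Φ) (x, σ x) := hΦ.fderiv_right (m := 2) (by norm_num)
  have hDΦd := hDΦ.differentiableAt (by norm_num)
  have hev := eventually_fderiv_comp_section hσ hΦ
  have hpro : ∀ᶠ x' in 𝓝 x, prolong Φ (x', σ x', fderiv ℝ σ x') =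
      (x', Φ (x', σ x'), fderiv ℝ (fun x' => Φ (x', σ x')) x') := by
    filter_upwards [hev] with x' hx'
    rw [hx', prolong]
  have hℓp : ContDiffAt ℝ 2 (ℓ ∘ prolong Φ) (x, σ x, fderiv ℝ σ x) :=
    hℓ.comp _ (contDiffAt_prolong hΦ _)
  have hw : HasFDerivAt (fun x' => fderiv ℝ Φ (x', σ x') (0, v))
      (((fderiv ℝ (fderiv ℝ Φ) (x, σ x)).comp
        ((ContinuousLinearMap.id ℝ (Eu n)).prod (fderiv ℝ σ x))).flip (0, v)) x := by
    have h1 := HasFDerivAt.comp (g := fderiv ℝ Φ) x hDΦd.hasFDerivAt hgraphD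
    simpa using h1.clm_apply (hasFDerivAt_const ((0, v) : Eu n × G) x)
  -- Symmetry of the second derivative of `Φ`: varying along the fibre and then taking the total
  -- derivative agrees with the opposite order.
  have hwsymm : fderiv ℝ (fun x' => fderiv ℝ Φ (x', σ x') (0, v)) x =
      (fderiv ℝ (fderiv ℝ Φ) (x, σ x) (0, v)).comp
        ((ContinuousLinearMap.id ℝ (Eu n)).prod (fderiv ℝ σ x)) := by
    rw [hw.fderiv]
    ext u
    have hs : IsSymmSndFDerivAt ℝ Φ (x, σ x) :=
      hΦ.isSymmSndFDerivAt (by simp; norm_num)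
    exact hs _ _
  have hℓ' : ContDiffAt ℝ 2 ℓ (x, Φ (x, σ x), fderiv ℝ (fun x' => Φ (x', σ x')) x) := by
    rwa [← hpro.self_of_nhds]
  have hA := eulerLagrange_eq hℓp hσ (fun _ => v) (differentiableAt_const v)
  have hB := eulerLagrange_eq hℓ' hτ (fun x' => fderiv ℝ Φ (x', σ x') (0, v))
    hw.differentiableAt
  rw [← hA, ← hB]
  have hΦev : ∀ᶠ x' in 𝓝 x, ContDiffAt ℝ 3 Φ (x', σ x') :=
    hgraph.continuousAt.eventually (hΦ.eventually (by simp))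
  have hℓev : ∀ᶠ x' in 𝓝 x, ContDiffAt ℝ 2 ℓ (prolong Φ (x', σ x', fderiv ℝ σ x')) := by
    have h1 : ContinuousAt (fun x' => prolong Φ (x', σ x', fderiv ℝ σ x')) x :=
      ContinuousAt.comp (g := prolong Φ) (contDiffAt_prolong hΦ _).continuousAt hlift
    exact h1.eventually (hℓ.eventually (by simp))
  have hchain : ∀ᶠ x' in 𝓝 x, ∀ u, fderiv ℝ (ℓ ∘ prolong Φ) (x', σ x', fderiv ℝ σ x') u =
      fderiv ℝ ℓ (x', Φ (x', σ x'), fderiv ℝ (fun x' => Φ (x', σ x')) x')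
        (fderiv ℝ (prolong Φ) (x', σ x', fderiv ℝ σ x') u) := by
    filter_upwards [hΦev, hℓev, hpro] with x' h1 h2 h3 u
    rw [fderiv_comp _ (h2.differentiableAt (by norm_num))
      ((contDiffAt_prolong h1 _).differentiableAt (by norm_num)), h3]
    rfl
  congr 1
  · rw [hchain.self_of_nhds, hwsymm]
    congr 1
    have h1 : fderiv ℝ (fun _ : Eu n => v) x = 0 := by simp
    rw [h1]
    exact fderiv_prolong_fibre hΦ _ v
  · refine Finset.sum_congr rfl fun l _ => ?_
    congr 1
    apply Filter.EventuallyEq.fderiv_eq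
    filter_upwards [hchain, hΦev] with x' h1 h2
    rw [h1, fderiv_prolong_vert h2]
    congr 4
    ext u
    simp only [ContinuousLinearMap.comp_apply, ContinuousLinearMap.prod_apply, elem_apply,
      zero_apply, ← map_smul, Prod.smul_mk, smul_zero]

end EulerLagrange
end Polysymplectic

/-! ### Fibred coordinates over a prescribed base chart -/

namespace Polysymplectic
universe u

section Charts

variable {n : ℕ} {G : Type*} [NormedAddCommGroup G] [NormedSpace ℝ G]
  {X : Type*} [TopologicalSpace X] [ChartedSpace (Eu n) X]
  {M : Type*} [TopologicalSpace M] [ChartedSpace (Eu n × G) M]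

/-- Fibred coordinates exist over any prescribed chart of the base. Hence bundles over `X` can be
compared in fibred coordinates with the same `x^l`. -/
theorem exists_fibredChart_with_base [IsManifold 𝓘(ℝ, Eu n) ∞ X] [IsManifold 𝓘(ℝ, Eu n × G) ∞ M]
    (p : M → X) [IsSmoothFibreBundle (Eu n) (Eu n × G) G p] (φ : OpenPartialHomeomorph X (Eu n))
    (hφ : φ ∈ IsManifold.maximalAtlas 𝓘(ℝ, Eu n) ∞ X) (e : M) (he : p e ∈ φ.source) :
    ∃ c : FibredChart n G p, c.base = φ ∧ e ∈ c.chart.source := by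
  obtain ⟨V, _, _, _, t, ht, h1, h2⟩ :=
    IsSmoothFibreBundle.exists_trivialization (EB := Eu n) (EM := Eu n × G) (F := G) (p := p) (p e)
  have hte : e ∈ t.source := t.mem_source.2 ht
  let χ := chartAt G (t e).2
  let ψ : OpenPartialHomeomorph M (Eu n × G) := t.toOpenPartialHomeomorph.trans (φ.prod χ)
  have hsrc : ∀ y ∈ ψ.source, y ∈ t.source ∧ p y ∈ φ.source ∧ (t y).2 ∈ χ.source := by
    intro y hy
    rw [OpenPartialHomeomorph.trans_source] at hy
    refine ⟨hy.1, ?_, hy.2.2⟩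
    have := hy.2.1
    rwa [← t.coe_fst hy.1]
  refine ⟨⟨φ, ψ, hφ, ?_, fun y hy => (hsrc y hy).2.1, ?_⟩, rfl, ?_⟩
  · apply OpenPartialHomeomorph.mem_maximalAtlas_of_contMDiffOn
    · have h3 : ContMDiffOn (𝓘(ℝ, Eu n).prod 𝓘(ℝ, G)) (𝓘(ℝ, Eu n).prod 𝓘(ℝ, G)) ∞
          (φ.prod χ) (φ.prod χ).source :=
        (contMDiffOn_of_mem_maximalAtlas hφ).prodMap
          (contMDiffOn_of_mem_maximalAtlas (IsManifold.chart_mem_maximalAtlas _))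
      have h4 : ContMDiffOn 𝓘(ℝ, Eu n × G) (𝓘(ℝ, Eu n).prod 𝓘(ℝ, G)) ∞ ψ ψ.source :=
        h3.comp (h1.mono fun y hy => (hsrc y hy).1) (fun y hy => by
          rw [OpenPartialHomeomorph.trans_source] at hy
          exact hy.2)
      rwa [← modelWithCornersSelf_prod, chartedSpaceSelf_prod] at h4
    · have h3 : ContMDiffOn (𝓘(ℝ, Eu n).prod 𝓘(ℝ, G)) (𝓘(ℝ, Eu n).prod 𝓘(ℝ, G)) ∞
          (φ.prod χ).symm (φ.prod χ).target :=
        (contMDiffOn_symm_of_mem_maximalAtlas hφ).prodMap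
          (contMDiffOn_symm_of_mem_maximalAtlas (IsManifold.chart_mem_maximalAtlas _))
      have h4 : ContMDiffOn (𝓘(ℝ, Eu n).prod 𝓘(ℝ, G)) 𝓘(ℝ, Eu n × G) ∞ ψ.symm ψ.target :=
        h2.comp (h3.mono fun z hz => by
          rw [OpenPartialHomeomorph.trans_target] at hz
          exact hz.1) (fun z hz => by
          rw [OpenPartialHomeomorph.trans_target] at hz
          exact hz.2)
      rwa [← modelWithCornersSelf_prod, chartedSpaceSelf_prod] at h4
  · intro y hy
    show φ ((t y).1) = φ (p y)
    rw [t.coe_fst (hsrc y hy).1]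
  · rw [OpenPartialHomeomorph.trans_source]
    refine ⟨hte, ?_, mem_chart_source _ _⟩
    show (t e).1 ∈ φ.source
    rw [t.coe_fst hte]
    exact he

/-- If `q : N → M` is a fibre bundle, fibred coordinates on `M → X` extend to fibred coordinates on
the composite `N → X`. -/
theorem FibredChart.exists_comp {F : Type*} [NormedAddCommGroup F] [NormedSpace ℝ F]
    {N : Type u} [TopologicalSpace N] [ChartedSpace (Eu n × (G × F)) N]
    [IsManifold 𝓘(ℝ, Eu n × (G × F)) ∞ N] {p : M → X} (c : FibredChart n G p) (q : N → M)
    (hq : IsSmoothFibreBundle (Eu n × G) (Eu n × (G × F)) F q) (ν : N)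
    (hν : q ν ∈ c.chart.source) :
    ∃ c' : FibredChart n (G × F) (fun ν => p (q ν)), c'.base = c.base ∧ ν ∈ c'.chart.source := by
  obtain ⟨V, _, _, _, t, ht, h1, h2⟩ := hq.exists_trivialization (q ν)
  have hte : ν ∈ t.source := t.mem_source.2 ht
  let χ := chartAt F (t ν).2
  let α : ((Eu n × G) × F) ≃L[ℝ] (Eu n × (G × F)) := ContinuousLinearEquiv.prodAssoc ℝ (Eu n) G F
  let ψ : OpenPartialHomeomorph N (Eu n × (G × F)) :=
    (t.toOpenPartialHomeomorph.trans (c.chart.prod χ)).transHomeomorph α.toHomeomorph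
  have hsrc : ∀ y ∈ ψ.source, y ∈ t.source ∧ q y ∈ c.chart.source ∧ (t y).2 ∈ χ.source := by
    intro y hy
    refine ⟨hy.1, ?_, hy.2.2⟩
    have := hy.2.1
    rwa [← t.coe_fst hy.1]
  refine ⟨⟨c.base, ψ, c.base_mem, ?_, fun y hy => c.mapsTo _ (hsrc y hy).2.1, ?_⟩, rfl, ?_⟩
  · apply OpenPartialHomeomorph.mem_maximalAtlas_of_contMDiffOn
    · have h3 : ContMDiffOn (𝓘(ℝ, Eu n × G).prod 𝓘(ℝ, F)) (𝓘(ℝ, Eu n × G).prod 𝓘(ℝ, F)) ∞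
          (c.chart.prod χ) (c.chart.prod χ).source :=
        (contMDiffOn_of_mem_maximalAtlas c.chart_mem).prodMap
          (contMDiffOn_of_mem_maximalAtlas (IsManifold.chart_mem_maximalAtlas _))
      have h4 : ContMDiffOn 𝓘(ℝ, Eu n × (G × F)) (𝓘(ℝ, Eu n × G).prod 𝓘(ℝ, F)) ∞
          ((c.chart.prod χ) ∘ t) ψ.source :=
        h3.comp (h1.mono fun y hy => (hsrc y hy).1) (fun y hy => hy.2)
      rw [← modelWithCornersSelf_prod, chartedSpaceSelf_prod] at h4
      exact α.contDiff.contMDiff.comp_contMDiffOn h4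
    · have h3 : ContMDiffOn (𝓘(ℝ, Eu n × G).prod 𝓘(ℝ, F)) (𝓘(ℝ, Eu n × G).prod 𝓘(ℝ, F)) ∞
          (c.chart.prod χ).symm (c.chart.prod χ).target :=
        (contMDiffOn_symm_of_mem_maximalAtlas c.chart_mem).prodMap
          (contMDiffOn_symm_of_mem_maximalAtlas (IsManifold.chart_mem_maximalAtlas _))
      have h4 : ContMDiffOn (𝓘(ℝ, Eu n × G).prod 𝓘(ℝ, F)) 𝓘(ℝ, Eu n × (G × F)) ∞
          (t.toOpenPartialHomeomorph.trans (c.chart.prod χ)).symm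
          (t.toOpenPartialHomeomorph.trans (c.chart.prod χ)).target :=
        h2.comp (h3.mono fun z hz => by
          rw [OpenPartialHomeomorph.trans_target] at hz
          exact hz.1) (fun z hz => by
          rw [OpenPartialHomeomorph.trans_target] at hz
          exact hz.2)
      have h5 : ContMDiff 𝓘(ℝ, Eu n × (G × F)) (𝓘(ℝ, Eu n × G).prod 𝓘(ℝ, F)) ∞ α.symm := by
        rw [← modelWithCornersSelf_prod, chartedSpaceSelf_prod]
        exact α.symm.contDiff.contMDiff
      exact h4.comp h5.contMDiffOn (fun z hz => hz)
  · intro y hy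
    show (c.chart (t y).1).1 = c.base (p (q y))
    rw [t.coe_fst (hsrc y hy).1, c.fst_chart _ (hsrc y hy).2.1]
  · refine ⟨hte, ?_, mem_chart_source _ _⟩
    show (t ν).1 ∈ c.chart.source
    rw [t.coe_fst hte]
    exact hν

variable [IsManifold 𝓘(ℝ, Eu n) ∞ X] [IsManifold 𝓘(ℝ, Eu n × G) ∞ M]
  {p : M → X} [IsSmoothFibreBundle (Eu n) (Eu n × G) G p]

/-- Fibred coordinates `(x^l, y^i)` on `M → X` induce fibred coordinates `(x^l, y^i, y^i_l)` on
`J¹M → X`. -/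
theorem FibredChart.exists_jet (c : FibredChart n G p) (j : JetBundle n G p) :
    ∃ c' : FibredChart n (G × (Eu n →L[ℝ] G)) (JetBundle.proj n G p), c'.base = c.base ∧
      c'.chart.source = {i | i.pt ∈ c.chart.source} ∧
      (∀ i, c'.chart i = ((c.chart i.pt).1, (c.chart i.pt).2, c.jetCoord i.pt i.jet)) := by
  let ψ := (jetCore p).openPartialHomeomorph (c.jetChart j) ⟨c, j, rfl⟩
  have hψ : ψ ∈ atlas (Eu n × (G × (Eu n →L[ℝ] G))) (JetBundle n G p) := by
    exact Set.mem_iUnion₂.2 ⟨_, ⟨c, j, rfl⟩, rfl⟩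
  exact ⟨⟨c.base, ψ, c.base_mem, IsManifold.subset_maximalAtlas hψ, fun i hi => c.mapsTo _ hi,
    fun i hi => c.fst_chart _ hi⟩, rfl, rfl, fun i => rfl⟩

/-- The coordinates `(x^l, y^i, p^l_i)` on `Π` as a local homeomorphism. -/
noncomputable def FibredChart.momHomeo [FiniteDimensional ℝ G] (c : FibredChart n G p) :
    OpenPartialHomeomorph (LegendreBundle n G p) (Eu n × (G × MomentumModel n G)) :=
  (legendreCore p).openPartialHomeomorph c.momChart ⟨c, rfl⟩

theorem FibredChart.momHomeo_mem [FiniteDimensional ℝ G] (c : FibredChart n G p) :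
    c.momHomeo ∈ IsManifold.maximalAtlas 𝓘(ℝ, Eu n × (G × MomentumModel n G)) ∞
      (LegendreBundle n G p) := by
  apply IsManifold.subset_maximalAtlas
  exact Set.mem_iUnion₂.2 ⟨_, ⟨c, rfl⟩, rfl⟩

theorem FibredChart.momHomeo_apply [FiniteDimensional ℝ G] (c : FibredChart n G p)
    (q : LegendreBundle n G p) :
    c.momHomeo q = ((c.chart q.pt).1, (c.chart q.pt).2, c.momCoord q.pt q.mom) := rfl

end Charts

end Polysymplectic

/-! ### Submersions and their fibres -/

section Submersion

variable {E E' : Type*} [NormedAddCommGroup E] [NormedSpace ℝ E]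
  [NormedAddCommGroup E'] [NormedSpace ℝ E']
  {M N : Type*} [TopologicalSpace M] [ChartedSpace E M] [TopologicalSpace N] [ChartedSpace E' N]
  {f : M → N} {x : M}

namespace Manifold.IsSubmersionAt

theorem codChart_apply (h : IsSubmersionAt 𝓘(ℝ, E) 𝓘(ℝ, E') ∞ f x) {z : E}
    (hz : z ∈ h.domChart.target) : h.codChart (f (h.domChart.symm z)) = (h.equiv z).1 := by
  have hz' : z ∈ (h.domChart.extend 𝓘(ℝ, E)).target := by simpa using hz
  simpa using h.writtenInCharts hz'

theorem apply_mem_codChart_source (h : IsSubmersionAt 𝓘(ℝ, E) 𝓘(ℝ, E') ∞ f x) {z : E}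
    (hz : z ∈ h.domChart.target) : f (h.domChart.symm z) ∈ h.codChart.source :=
  h.source_subset_preimage_source (h.domChart.map_target hz)

/-- The differential of a submersion is surjective, since the normal form `(u, v) ↦ u` has the local
section `u ↦ (u, v₀)`. -/
theorem surjective_mfderiv (h : IsSubmersionAt 𝓘(ℝ, E) 𝓘(ℝ, E') ∞ f x) :
    Function.Surjective (mfderiv 𝓘(ℝ, E) 𝓘(ℝ, E') f x) := by
  let a : E' → E := fun u => h.equiv.symm (u, (h.equiv (h.domChart x)).2)
  have ha : Differentiable ℝ a := by fun_prop
  have hx := h.mem_domChart_source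
  have hfx := h.mem_codChart_source
  have h0 : h.codChart (f x) = (h.equiv (h.domChart x)).1 := by
    have := h.codChart_apply (h.domChart.map_source hx)
    rwa [h.domChart.left_inv hx] at this
  have ha0 : a (h.codChart (f x)) = h.domChart x := by simp [a, h0]
  have hs0 : h.domChart.symm (a (h.codChart (f x))) = x := by rw [ha0, h.domChart.left_inv hx]
  have h1 : MDifferentiableAt 𝓘(ℝ, E') 𝓘(ℝ, E') h.codChart (f x) :=
    mdifferentiableAt_of_mem_maximalAtlas
      (IsManifold.maximalAtlas_subset_of_le (by simp) h.codChart_mem_maximalAtlas) hfx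
  have h2 : MDifferentiableAt 𝓘(ℝ, E') 𝓘(ℝ, E) a (h.codChart (f x)) :=
    (ha _).mdifferentiableAt
  have h3 : MDifferentiableAt 𝓘(ℝ, E) 𝓘(ℝ, E) h.domChart.symm (a (h.codChart (f x))) := by
    rw [ha0]
    exact mdifferentiableAt_symm_of_mem_maximalAtlas
      (IsManifold.maximalAtlas_subset_of_le (by simp) h.domChart_mem_maximalAtlas)
      (h.domChart.map_source hx)
  have h4 := (h3.comp _ h2).comp (f x) h1
  have h5 : MDifferentiableAt 𝓘(ℝ, E) 𝓘(ℝ, E') f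
      (((h.domChart.symm ∘ a) ∘ h.codChart) (f x)) := by
    show MDifferentiableAt _ _ _ (h.domChart.symm (a (h.codChart (f x))))
    rw [hs0]
    exact h.contMDiffAt.mdifferentiableAt (by simp)
  have h6 : f ∘ ((h.domChart.symm ∘ a) ∘ h.codChart) =ᶠ[𝓝 (f x)] id := by
    have hc : ContinuousAt (a ∘ h.codChart) (f x) :=
      ha.continuous.continuousAt.comp (h.codChart.continuousAt hfx)
    have hm : ∀ᶠ y in 𝓝 (f x), a (h.codChart y) ∈ h.domChart.target := by
      refine hc.eventually (h.domChart.open_target.mem_nhds ?_)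
      show a (h.codChart (f x)) ∈ _
      rw [ha0]
      exact h.domChart.map_source hx
    filter_upwards [hm, h.codChart.open_source.mem_nhds hfx] with y hy hy'
    apply h.codChart.injOn (h.apply_mem_codChart_source hy) hy'
    show h.codChart (f (h.domChart.symm (a (h.codChart y)))) = _
    rw [h.codChart_apply hy]
    simp [a]
  have h7 := h6.mfderiv_eq (I := 𝓘(ℝ, E')) (I' := 𝓘(ℝ, E'))
  rw [mfderiv_comp (f x) h5 h4, mfderiv_id] at h7
  intro w
  -- The value at `f x` of the local section equals `x` only propositionally.
  have h8 : ∀ y, y = x → ∀ (A : E' →L[ℝ] E) (w : E'),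
      (mfderiv 𝓘(ℝ, E) 𝓘(ℝ, E') f y : E →L[ℝ] E') (A w) = w →
      ∃ v : E, (mfderiv 𝓘(ℝ, E) 𝓘(ℝ, E') f x : E →L[ℝ] E') v = w := by
    rintro y rfl A w hw
    exact ⟨_, hw⟩
  exact h8 _ hs0 _ w (congrArg (fun B => B w) h7)

/-- Nearby points of a fibre of a submersion are joined by a differentiable path in the fibre: a
segment in the coordinates of the normal form `(u, v) ↦ u`. -/
theorem eventually_exists_path (h : IsSubmersionAt 𝓘(ℝ, E) 𝓘(ℝ, E') ∞ f x) :
    ∀ᶠ y in 𝓝 x, f y = f x → ∃ γ : ℝ → M, γ 0 = x ∧ γ 1 = y ∧ ∀ t ∈ Set.Icc (0 : ℝ) 1,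
      MDifferentiableAt 𝓘(ℝ, ℝ) 𝓘(ℝ, E) γ t ∧ f (γ t) = f x := by
  have hx := h.mem_domChart_source
  obtain ⟨ε, hε, hball⟩ := Metric.isOpen_iff.1 h.domChart.open_target _ (h.domChart.map_source hx)
  have hev : ∀ᶠ y in 𝓝 x, h.domChart y ∈ Metric.ball (h.domChart x) ε :=
    (h.domChart.continuousAt hx).eventually (Metric.ball_mem_nhds _ hε)
  filter_upwards [hev, h.domChart.open_source.mem_nhds hx] with y hy hys hfy
  let b : ℝ → E := fun t => h.domChart x + t • (h.domChart y - h.domChart x)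
  have hb : ∀ t ∈ Set.Icc (0 : ℝ) 1, b t ∈ h.domChart.target := fun t ht =>
    hball ((convex_ball _ _).add_smul_sub_mem (Metric.mem_ball_self hε) hy ht)
  have hbd : Differentiable ℝ b := by fun_prop
  refine ⟨h.domChart.symm ∘ b, by simp [b, h.domChart.left_inv hx],
    by simp [b, h.domChart.left_inv hys], fun t ht => ⟨?_, ?_⟩⟩
  · have h3 : MDifferentiableAt 𝓘(ℝ, E) 𝓘(ℝ, E) h.domChart.symm (b t) :=
      mdifferentiableAt_symm_of_mem_maximalAtlas
        (IsManifold.maximalAtlas_subset_of_le (by simp) h.domChart_mem_maximalAtlas) (hb t ht)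
    exact h3.comp t (hbd t).mdifferentiableAt
  · apply h.codChart.injOn (h.apply_mem_codChart_source (hb t ht)) h.mem_codChart_source
    show h.codChart (f (h.domChart.symm (b t))) = _
    have e1 := h.codChart_apply (h.domChart.map_source hx)
    have e2 := h.codChart_apply (h.domChart.map_source hys)
    rw [h.domChart.left_inv hx] at e1
    rw [h.domChart.left_inv hys, hfy, e1] at e2
    rw [h.codChart_apply (hb t ht), e1]
    simp [b, map_add, map_smul, map_sub, ← e2]

end Manifold.IsSubmersionAt
end Submersion

/-! ### The Poincaré-Cartan identity -/

namespace Polysymplectic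

theorem FibredChart.differentiableAt_lagCoord {n : ℕ} {G : Type*} [NormedAddCommGroup G]
    [NormedSpace ℝ G] {X : Type*} [TopologicalSpace X] [ChartedSpace (Eu n) X]
    {M : Type*} [TopologicalSpace M] [ChartedSpace (Eu n × G) M] {p : M → X} (c : FibredChart n G p)
    (L : Lagrangian n G p) {z : Eu n × (G × (Eu n →L[ℝ] G))} (hz : (z.1, z.2.1) ∈ c.chart.target) :
    DifferentiableAt ℝ (c.lagCoord L.density) z := by
  have hopen : IsOpen {z : Eu n × (G × (Eu n →L[ℝ] G)) | (z.1, z.2.1) ∈ c.chart.target} :=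
    c.chart.open_target.preimage
      (f := fun z : Eu n × (G × (Eu n →L[ℝ] G)) => (z.1, z.2.1)) (by fun_prop)
  exact ((L.smooth c).contDiffAt (hopen.mem_nhds hz)).differentiableAt (by simp)

section Energy

variable {n : ℕ} {G : Type*} [NormedAddCommGroup G] [NormedSpace ℝ G] [FiniteDimensional ℝ G]
  {X : Type*} [TopologicalSpace X] [ChartedSpace (Eu n) X]
  {M : Type*} [TopologicalSpace M] [ChartedSpace (Eu n × G) M]
  [IsManifold 𝓘(ℝ, Eu n) ∞ X] [IsManifold 𝓘(ℝ, Eu n × G) ∞ M]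
  {p : M → X} [IsSmoothFibreBundle (Eu n) (Eu n × G) G p]

/-- On a fibre of the Legendre map the momenta are constant and equal to `∂𝓛/∂y^i_l`, so that the energy
`p^l_i y^i_l - 𝓛` has zero derivative along a path in the fibre. -/
theorem energy_eq_of_path (L : Lagrangian n G p) (q : LegendreBundle n G p) (c : FibredChart n G p)
    (hq : q.pt ∈ c.chart.source) (γ : ℝ → JetBundle n G p)
    (hγ : ∀ t ∈ Set.Icc (0 : ℝ) 1,
      MDifferentiableAt 𝓘(ℝ, ℝ) 𝓘(ℝ, Eu n × (G × (Eu n →L[ℝ] G))) γ t ∧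
        legendreMap L (γ t) = q) :
    ∀ t ∈ Set.Icc (0 : ℝ) 1,
    pairing (c.momCoord q.pt q.mom) (c.jetCoord (γ t).pt (γ t).jet) -
      c.lagCoord L.density ((c.chart q.pt).1, (c.chart q.pt).2, c.jetCoord (γ t).pt (γ t).jet) =
    pairing (c.momCoord q.pt q.mom) (c.jetCoord (γ 0).pt (γ 0).jet) -
      c.lagCoord L.density ((c.chart q.pt).1, (c.chart q.pt).2, c.jetCoord (γ 0).pt (γ 0).jet) := by
  obtain ⟨c', -, hs, hc'⟩ := c.exists_jet (γ 0)
  set a : ℝ → Eu n →L[ℝ] G := fun t => c.jetCoord (γ t).pt (γ t).jet with ha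
  have hmem : ∀ t ∈ Set.Icc (0 : ℝ) 1, (γ t).pt ∈ c.chart.source := by
    intro t ht
    have : (γ t).pt = q.pt := congrArg LegendreBundle.pt (hγ t ht).2
    rwa [this]
  have had : ∀ t ∈ Set.Icc (0 : ℝ) 1, DifferentiableAt ℝ a t := by
    intro t ht
    have h1 := (c'.chart_mdiff.mdifferentiableAt (x := γ t) (by rw [hs]; exact hmem t ht)).comp t
      (hγ t ht).1
    have h2 := h1.differentiableAt.snd.snd
    exact h2.congr_of_eventuallyEq (Filter.Eventually.of_forall fun t => by simp [hc', ha])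
  have hmom : ∀ t ∈ Set.Icc (0 : ℝ) 1, ∀ b, pairing (c.momCoord q.pt q.mom) b =
      fderiv ℝ (fun a => c.lagCoord L.density ((c.chart q.pt).1, (c.chart q.pt).2, a)) (a t) b := by
    intro t ht b
    rw [← pairing_comp_elemL]
    congr 1
    have h1 := (hγ t ht).2
    have h2 := hmem t ht
    ext l g
    show c.momCoord q.pt q.mom l g =
      fderiv ℝ (fun a => c.lagCoord L.density ((c.chart q.pt).1, (c.chart q.pt).2, a))
        (c.jetCoord (γ t).pt (γ t).jet) (elem l g)
    generalize γ t = j at h1 h2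
    subst h1
    exact momCoord_fibreDeriv L j c h2 l g
  have hE : ∀ t ∈ Set.Icc (0 : ℝ) 1, HasDerivAt (fun t => pairing (c.momCoord q.pt q.mom) (a t) -
      c.lagCoord L.density ((c.chart q.pt).1, (c.chart q.pt).2, a t)) 0 t := by
    intro t ht
    have h1 := (had t ht).hasDerivAt
    let B : (Eu n →L[ℝ] G) →L[ℝ] ℝ := LinearMap.toContinuousLinearMap
      { toFun := pairing (c.momCoord q.pt q.mom)
        map_add' := pairing_add _
        map_smul' := pairing_smul _ }
    have h2 : HasDerivAt (fun t => pairing (c.momCoord q.pt q.mom) (a t))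
      (pairing (c.momCoord q.pt q.mom) (deriv a t)) t :=
      HasFDerivAt.comp_hasDerivAt t B.hasFDerivAt h1
    have h3 : DifferentiableAt ℝ
        (fun a => c.lagCoord L.density ((c.chart q.pt).1, (c.chart q.pt).2, a)) (a t) :=
      DifferentiableAt.comp (g := c.lagCoord L.density) (a t)
        (c.differentiableAt_lagCoord L (c.chart.map_source hq)) (by fun_prop)
    have h4 := HasFDerivAt.comp_hasDerivAt t h3.hasFDerivAt h1
    have h5 := h2.sub h4
    rwa [hmom t ht, sub_self] at h5
  intro t ht
  exact constant_of_has_deriv_right_zero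
    (fun t ht => (hE t ht).continuousAt.continuousWithinAt)
    (fun t ht => (hE t ⟨ht.1, ht.2.le⟩).hasDerivWithinAt) t ht

/-- The Poincaré-Cartan identity `π^l_i y^i_l - 𝓗 ∘ L̂ = 𝓛` on all of `J¹M`. It is one of the defining
relations of an associated Hamiltonian at the jets `Ĥ(q)`, `q ∈ N_L`. Both sides change by the same amount
along the fibre of `L̂` over `q`, which contains `Ĥ(q)` and is connected. -/
theorem form_legendreMap {k : ℕ} {L : Lagrangian n G p}
    [ChartedSpace (Eu n × (G × Eu k)) (constraintSpace L)]
    (hL : IsAlmostRegular k L) {H : Hamiltonian n G p} (hH : IsAssociated H L)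
    (j : JetBundle n G p) :
    (H.form (legendreMap L j)).compLinearMap j.jet.1.toLinearMap = L.density j.pt j.jet := by
  set ν := legendreRestrict L j with hν
  have hc := mem_chartOf (n := n) (G := G) p j.pt
  set c := chartOf (n := n) (G := G) p j.pt
  let g : legendreRestrict L ⁻¹' {ν} → ℝ := fun i =>
    pairing (c.momCoord ν.1.pt ν.1.mom) (c.jetCoord i.1.pt i.1.jet) -
      c.lagCoord L.density ((c.chart ν.1.pt).1, (c.chart ν.1.pt).2, c.jetCoord i.1.pt i.1.jet)
  have hg : IsLocallyConstant g := by
    rw [IsLocallyConstant.iff_eventually_eq]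
    intro i
    have hi : legendreRestrict L i.1 = ν := i.2
    filter_upwards [continuousAt_subtype_val.eventually
      (hL.isSubmersion.isSubmersionAt i.1).eventually_exists_path] with i' h1
    have hi' : legendreRestrict L i'.1 = ν := i'.2
    obtain ⟨γ, h2, h3, h4⟩ := h1 (hi'.trans hi.symm)
    have h5 := energy_eq_of_path L ν.1 c hc γ
      (fun t ht => ⟨(h4 t ht).1, congrArg Subtype.val ((h4 t ht).2.trans hi)⟩) 1 (by simp)
    rwa [h2, h3] at h5
  have := Subtype.preconnectedSpace (hL.isConnected_fibre ν).isPreconnected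
  have hj₁ : legendreRestrict L (hamiltonianMap H ν.1) = ν :=
    Subtype.ext (hH.legendre_hamiltonian ν.1 ν.2)
  have h1 := hg.apply_eq_of_preconnectedSpace ⟨j, rfl⟩ ⟨hamiltonianMap H ν.1, hj₁⟩
  have hcoef : ∀ i : Jet n G p j.pt, c.coef (p j.pt) (L.density j.pt i) =
      c.lagCoord L.density ((c.chart j.pt).1, (c.chart j.pt).2, c.jetCoord j.pt i) := by
    intro i
    rw [c.lagCoord_chart _ hc, c.jetOf_jetCoord hc]
  have h2 := congrArg (c.coef (p j.pt)) (hH.energy ν.1 ν.2)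
  have h3 : c.coef (p j.pt) ((H.form ν.1).compLinearMap (hamiltonianMap H ν.1).jet.1.toLinearMap) = _ :=
    c.coef_form H hc ν.1.mom (hamiltonianMap H ν.1).jet
  have h4 : c.coef (p j.pt) ((H.form ν.1).compLinearMap j.jet.1.toLinearMap) = _ :=
    c.coef_form H hc ν.1.mom j.jet
  have h5 : c.coef (p j.pt) (L.density j.pt (hamiltonianMap H ν.1).jet) = _ :=
    hcoef (hamiltonianMap H ν.1).jet
  have h6 : c.coef (p j.pt) ((H.form ν.1).compLinearMap j.jet.1.toLinearMap) =
      c.coef (p j.pt) (L.density j.pt j.jet) := by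
    have h7 : pairing (c.momCoord j.pt ν.1.mom) (c.jetCoord j.pt j.jet) -
      c.lagCoord L.density ((c.chart j.pt).1, (c.chart j.pt).2, c.jetCoord j.pt j.jet) =
      pairing (c.momCoord j.pt ν.1.mom) (c.jetCoord j.pt (hamiltonianMap H ν.1).jet) -
      c.lagCoord L.density ((c.chart j.pt).1, (c.chart j.pt).2,
        c.jetCoord j.pt (hamiltonianMap H ν.1).jet) := h1
    rw [h4, hcoef]
    have h8 := h3.symm.trans (h2.trans h5)
    linarith
  rw [c.eq_coef_smul_vol (c.mapsTo _ hc) (L.density j.pt j.jet), ← h6]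
  exact c.eq_coef_smul_vol (c.mapsTo _ hc) _

end Energy
end Polysymplectic

/-! ### Pull-backs of the Hamiltonian form -/

namespace Polysymplectic

section Pullback

variable {n : ℕ} {G F : Type*} [NormedAddCommGroup G] [NormedSpace ℝ G]
  [NormedAddCommGroup F] [NormedSpace ℝ F]
  {X : Type*} [TopologicalSpace X] [ChartedSpace (Eu n) X]
  {M : Type*} [TopologicalSpace M] [ChartedSpace (Eu n × G) M]
  {N : Type*} [TopologicalSpace N] [ChartedSpace (Eu n × F) N]
  {p : M → X}

/-- The coordinate expression of a map between manifolds. -/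
noncomputable def inCharts (c : OpenPartialHomeomorph N (Eu n × F))
    (c' : OpenPartialHomeomorph M (Eu n × G)) (g : N → M) : Eu n × F → Eu n × G :=
  fun z => c' (g (c.symm z))

theorem inCharts_contDiffAt {c : OpenPartialHomeomorph N (Eu n × F)}
    {c' : OpenPartialHomeomorph M (Eu n × G)}
    (hc : c ∈ IsManifold.maximalAtlas 𝓘(ℝ, Eu n × F) ∞ N)
    (hc' : c' ∈ IsManifold.maximalAtlas 𝓘(ℝ, Eu n × G) ∞ M) {g : N → M} {z : Eu n × F}
    (hz : z ∈ c.target) (hz' : g (c.symm z) ∈ c'.source)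
    (hg : ContMDiffAt 𝓘(ℝ, Eu n × F) 𝓘(ℝ, Eu n × G) ∞ g (c.symm z)) :
    ContDiffAt ℝ ∞ (inCharts c c' g) z := by
  rw [← contMDiffAt_iff_contDiffAt]
  exact (contMDiffAt_of_mem_maximalAtlas hc' hz').comp z
    (hg.comp z ((contMDiffOn_symm_of_mem_maximalAtlas hc).contMDiffAt (c.open_target.mem_nhds hz)))

theorem chartDeriv_mfderiv (c : FibredChart n G p) {pN : N → X} (cN : FibredChart n F pN)
    {g : N → M} {ν : N} (hν : ν ∈ cN.chart.source) (hg : g ν ∈ c.chart.source)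
    (hd : ContMDiffAt 𝓘(ℝ, Eu n × F) 𝓘(ℝ, Eu n × G) ∞ g ν)
    (w : TangentSpace 𝓘(ℝ, Eu n × F) ν) :
    c.chartDeriv (g ν) (mfderiv 𝓘(ℝ, Eu n × F) 𝓘(ℝ, Eu n × G) g ν w) =
      fderiv ℝ (inCharts cN.chart c.chart g) (cN.chart ν) (cN.chartDeriv ν w) := by
  have h1 := c.chart_mdiff.mdifferentiableAt hg
  have h2 := cN.chart_mdiff.mdifferentiableAt hν
  have h3 : MDifferentiableAt 𝓘(ℝ, Eu n × F) 𝓘(ℝ, Eu n × G) (inCharts cN.chart c.chart g)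
      (cN.chart ν) := by
    refine ((inCharts_contDiffAt cN.chart_mem c.chart_mem (cN.chart.map_source hν) ?_
      ?_).differentiableAt (by simp)).mdifferentiableAt
    · rwa [cN.chart.left_inv hν]
    · rwa [cN.chart.left_inv hν]
  have key : mfderiv 𝓘(ℝ, Eu n × F) 𝓘(ℝ, Eu n × G) (c.chart ∘ g) ν =
      mfderiv 𝓘(ℝ, Eu n × F) 𝓘(ℝ, Eu n × G) (inCharts cN.chart c.chart g ∘ cN.chart) ν := by
    apply Filter.EventuallyEq.mfderiv_eq
    filter_upwards [cN.chart.open_source.mem_nhds hν] with y hy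
    simp [inCharts, cN.chart.left_inv hy]
  rw [mfderiv_comp ν h1 (hd.mdifferentiableAt (by simp)), mfderiv_comp ν h3 h2,
    mfderiv_eq_fderiv] at key
  exact congrArg (fun f => f w) key

/-- The prolongation `J¹N → J¹M` of a map `g : N → M` over `X`. -/
noncomputable def Jet.map (g : N → M) {ν : N}
    (hp : MDifferentiableAt 𝓘(ℝ, Eu n × G) 𝓘(ℝ, Eu n) p (g ν))
    (hg : MDifferentiableAt 𝓘(ℝ, Eu n × F) 𝓘(ℝ, Eu n × G) g ν)
    (A : Jet n F (fun ν => p (g ν)) ν) : Jet n G p (g ν) :=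
  ⟨(mfderiv 𝓘(ℝ, Eu n × F) 𝓘(ℝ, Eu n × G) g ν).comp A.1, by
    have h1 : tangentMapAt n F (fun ν => p (g ν)) ν =
        (tangentMapAt n G p (g ν)).comp (mfderiv 𝓘(ℝ, Eu n × F) 𝓘(ℝ, Eu n × G) g ν) :=
      mfderiv_comp (I' := 𝓘(ℝ, Eu n × G)) (g := p) ν hp hg
    exact (congrArg (fun f => f.comp A.1) h1).symm.trans A.2⟩

/-- In fibred coordinates with the same `x^l`, the prolongation of `g` is `a ↦ g_x + g_y ∘ a`. -/
theorem jetCoord_map (c : FibredChart n G p) {g : N → M} (cN : FibredChart n F (fun ν => p (g ν)))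
    (hb : cN.base = c.base) {ν : N} (hν : ν ∈ cN.chart.source) (hg : g ν ∈ c.chart.source)
    (hp : MDifferentiableAt 𝓘(ℝ, Eu n × G) 𝓘(ℝ, Eu n) p (g ν))
    (hd : ContMDiffAt 𝓘(ℝ, Eu n × F) 𝓘(ℝ, Eu n × G) ∞ g ν)
    (a : Eu n →L[ℝ] F) :
    c.jetCoord (g ν) ((cN.jetOf hν a).map g hp (hd.mdifferentiableAt (by simp))) =
      (ContinuousLinearMap.snd ℝ (Eu n) G).comp
        ((fderiv ℝ (inCharts cN.chart c.chart g) (cN.chart ν)).comp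
          ((ContinuousLinearMap.id ℝ (Eu n)).prod a)) := by
  ext u
  have h1 : cN.baseDeriv (p (g ν)) (c.frame (p (g ν)) u) = u := by
    have : cN.baseDeriv (p (g ν)) = c.baseDeriv (p (g ν)) := by
      unfold FibredChart.baseDeriv
      rw [hb]
    rw [this, c.baseDeriv_frame (c.mapsTo _ hg)]
  show (c.chartDeriv (g ν) (mfderiv 𝓘(ℝ, Eu n × F) 𝓘(ℝ, Eu n × G) g ν
    ((cN.jetOf hν a).1 (c.frame (p (g ν)) u)))).2 = _
  rw [chartDeriv_mfderiv c cN hν hg hd]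
  show (fderiv ℝ (inCharts cN.chart c.chart g) (cN.chart ν) (cN.chartDeriv ν (cN.chartFrame ν
    (cN.baseDeriv (p (g ν)) (c.frame (p (g ν)) u),
      a (cN.baseDeriv (p (g ν)) (c.frame (p (g ν)) u)))))).2 = _
  rw [cN.chartDeriv_chartFrame hν, h1]
  rfl

variable [FiniteDimensional ℝ G]

/-- The Lagrangian `h₀(f^* H)` on `J¹N` defined by the Hamiltonian form and a map `f : N → Π`. The
pull-back is taken through the projection `N → M`, because the values of `H.form` are forms on the
tangent spaces of `M`. -/
noncomputable def hamiltonianPullback (H : Hamiltonian n G p) (f : N → LegendreBundle n G p) :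
    LagrangianDensity n F (fun ν => p (f ν).pt) :=
  fun ν A => (H.form (f ν)).compLinearMap
    ((mfderiv 𝓘(ℝ, Eu n × F) 𝓘(ℝ, Eu n × G) (fun ν => (f ν).pt) ν).comp A.1).toLinearMap

/-- The function `p^l_i y^i_l - 𝓗` of the coordinates of a jet of a section of `Π → X`. -/
noncomputable def FibredChart.hamiltonianLagrangian (c : FibredChart n G p) (H : Hamiltonian n G p)
    (z : Eu n × ((G × MomentumModel n G) × (Eu n →L[ℝ] (G × MomentumModel n G)))) : ℝ :=
  pairing z.2.1.2 ((ContinuousLinearMap.fst ℝ G (MomentumModel n G)).comp z.2.2) -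
    c.hamCoord H.form (z.1, z.2.1)

theorem FibredChart.contDiffAt_hamCoord (c : FibredChart n G p) (H : Hamiltonian n G p)
    {z : Eu n × (G × MomentumModel n G)} (hz : (z.1, z.2.1) ∈ c.chart.target) :
    ContDiffAt ℝ ∞ (c.hamCoord H.form) z := by
  have hopen : IsOpen {z : Eu n × (G × MomentumModel n G) | (z.1, z.2.1) ∈ c.chart.target} :=
    c.chart.open_target.preimage
      (f := fun z : Eu n × (G × MomentumModel n G) => (z.1, z.2.1)) (by fun_prop)
  exact (H.smooth c).contDiffAt (hopen.mem_nhds hz)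

theorem FibredChart.contDiffAt_hamiltonianLagrangian (c : FibredChart n G p) (H : Hamiltonian n G p)
    {z : Eu n × ((G × MomentumModel n G) × (Eu n →L[ℝ] (G × MomentumModel n G)))}
    (hz : (z.1, z.2.1.1) ∈ c.chart.target) :
    ContDiffAt ℝ ∞ (c.hamiltonianLagrangian H) z := by
  refine ContDiffAt.sub ?_ ?_
  · unfold pairing
    refine ContDiffAt.sum fun l _ => ?_
    have h1 : ContDiffAt ℝ ∞ (fun z : Eu n × ((G × MomentumModel n G) ×
        (Eu n →L[ℝ] (G × MomentumModel n G))) => z.2.1.2 l) z := by fun_prop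
    have h2 : ContDiffAt ℝ ∞ (fun z : Eu n × ((G × MomentumModel n G) ×
        (Eu n →L[ℝ] (G × MomentumModel n G))) => (z.2.2 (EuclideanSpace.single l 1)).1) z := by
      fun_prop
    exact h1.clm_apply h2
  · exact ContDiffAt.comp (g := c.hamCoord H.form) z (c.contDiffAt_hamCoord H hz) (by fun_prop)

/-- The fibre coordinates `(y^i, p^l_i)` of a map `f : N → Π` in terms of coordinates on `N`. -/
noncomputable def FibredChart.momentumRep (c : FibredChart n G p)
    (cN : OpenPartialHomeomorph N (Eu n × F)) (f : N → LegendreBundle n G p) (z : Eu n × F) :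
    G × MomentumModel n G :=
  ((c.chart (f (cN.symm z)).pt).2, c.momCoord (f (cN.symm z)).pt (f (cN.symm z)).mom)

end Pullback

section HamiltonianPullback

variable {n : ℕ} {G F : Type*} [NormedAddCommGroup G] [NormedSpace ℝ G] [FiniteDimensional ℝ G]
  [NormedAddCommGroup F] [NormedSpace ℝ F]
  {X : Type*} [TopologicalSpace X] [ChartedSpace (Eu n) X]
  {M : Type*} [TopologicalSpace M] [ChartedSpace (Eu n × G) M]
  [IsManifold 𝓘(ℝ, Eu n) ∞ X] [IsManifold 𝓘(ℝ, Eu n × G) ∞ M]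
  {p : M → X} [IsSmoothFibreBundle (Eu n) (Eu n × G) G p]
  {N : Type*} [TopologicalSpace N] [ChartedSpace (Eu n × F) N]

theorem contMDiff_pt : ContMDiff 𝓘(ℝ, Eu n × (G × MomentumModel n G)) 𝓘(ℝ, Eu n × G) ∞
    (LegendreBundle.pt : LegendreBundle n G p → M) := by
  intro q
  have hc := mem_chartOf (n := n) (G := G) p q.pt
  set c := chartOf (n := n) (G := G) p q.pt
  have h1 : ContMDiffAt 𝓘(ℝ, Eu n × (G × MomentumModel n G)) 𝓘(ℝ, Eu n × (G × MomentumModel n G)) ∞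
      c.momHomeo q := contMDiffAt_of_mem_maximalAtlas c.momHomeo_mem hc
  have h2 : ContMDiffAt 𝓘(ℝ, Eu n × (G × MomentumModel n G)) 𝓘(ℝ, Eu n × G) ∞
      (fun z : Eu n × (G × MomentumModel n G) => (z.1, z.2.1)) (c.momHomeo q) := by
    rw [contMDiffAt_iff_contDiffAt]
    fun_prop
  have h3 : ContMDiffAt 𝓘(ℝ, Eu n × G) 𝓘(ℝ, Eu n × G) ∞ c.chart.symm (c.chart q.pt) :=
    (contMDiffOn_symm_of_mem_maximalAtlas c.chart_mem).contMDiffAt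
      (c.chart.open_target.mem_nhds (c.chart.map_source hc))
  refine (ContMDiffAt.comp (g := c.chart.symm) q h3 (h2.comp q h1)).congr_of_eventuallyEq ?_
  filter_upwards [c.momHomeo.open_source.mem_nhds (show q ∈ c.momHomeo.source from hc)] with i hi
  have hi' : i.pt ∈ c.chart.source := hi
  simp [c.momHomeo_apply, c.chart.left_inv hi']

theorem inCharts_momHomeo (c : FibredChart n G p) {f : N → LegendreBundle n G p}
    (cN : FibredChart n F (fun ν => p (f ν).pt)) (hb : cN.base = c.base) {z : Eu n × F}
    (hz : z ∈ cN.chart.target) (hz' : (f (cN.chart.symm z)).pt ∈ c.chart.source) :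
    inCharts cN.chart c.momHomeo f z = (z.1, c.momentumRep cN.chart f z) := by
  refine Prod.ext ?_ rfl
  show (c.chart (f (cN.chart.symm z)).pt).1 = z.1
  have h := cN.fst_chart _ (cN.chart.map_target hz)
  rw [cN.chart.right_inv hz] at h
  rw [c.fst_chart _ hz', h, hb]

theorem contDiffAt_momentumRep (c : FibredChart n G p) {f : N → LegendreBundle n G p}
    (hf : ContMDiff 𝓘(ℝ, Eu n × F) 𝓘(ℝ, Eu n × (G × MomentumModel n G)) ∞ f)
    (cN : FibredChart n F (fun ν => p (f ν).pt)) {z : Eu n × F}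
    (hz : z ∈ cN.chart.target) (hz' : (f (cN.chart.symm z)).pt ∈ c.chart.source) :
    ContDiffAt ℝ ∞ (c.momentumRep cN.chart f) z :=
  contDiffAt_snd.comp z
    (inCharts_contDiffAt cN.chart_mem c.momHomeo_mem hz hz' hf.contMDiffAt)

/-- In coordinates, `h₀(f^* H)` is the pull-back of `p^l_i y^i_l - 𝓗` along the prolongation of `f`. -/
theorem lagCoord_hamiltonianPullback (c : FibredChart n G p) (H : Hamiltonian n G p)
    {f : N → LegendreBundle n G p}
    (hf : ContMDiff 𝓘(ℝ, Eu n × F) 𝓘(ℝ, Eu n × (G × MomentumModel n G)) ∞ f)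
    (cN : FibredChart n F (fun ν => p (f ν).pt)) (hb : cN.base = c.base)
    {z : Eu n × (F × (Eu n →L[ℝ] F))} (hz : (z.1, z.2.1) ∈ cN.chart.target)
    (hz' : (f (cN.chart.symm (z.1, z.2.1))).pt ∈ c.chart.source) :
    cN.lagCoord (hamiltonianPullback H f) z =
      c.hamiltonianLagrangian H (prolong (c.momentumRep cN.chart f) z) := by
  set ν := cN.chart.symm (z.1, z.2.1) with hν
  have hνs : ν ∈ cN.chart.source := cN.chart.map_target hz
  have hνc : cN.chart ν = (z.1, z.2.1) := cN.chart.right_inv hz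
  have hz1 : z = ((cN.chart ν).1, (cN.chart ν).2, z.2.2) := by rw [hνc]
  have hg : ContMDiff 𝓘(ℝ, Eu n × F) 𝓘(ℝ, Eu n × G) ∞ (fun ν => (f ν).pt) := contMDiff_pt.comp hf
  have hp : MDifferentiableAt 𝓘(ℝ, Eu n × G) 𝓘(ℝ, Eu n) p (f ν).pt :=
    FibredChart.proj_mdifferentiableAt hz'
  have h1 : cN.lagCoord (hamiltonianPullback H f) z =
      cN.coef (p (f ν).pt) (hamiltonianPullback H f ν (cN.jetOf hνs z.2.2)) := by
    conv_lhs => rw [hz1]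
    exact cN.lagCoord_chart _ hνs _
  have h2 : cN.coef (p (f ν).pt) = c.coef (p (f ν).pt) := by
    unfold FibredChart.coef FibredChart.frame FibredChart.baseDeriv
    rw [hb]
  have h3 := c.coef_form H hz' (f ν).mom ((cN.jetOf hνs z.2.2).map (fun ν => (f ν).pt) hp
    (hg.contMDiffAt.mdifferentiableAt (by simp)))
  have h4 := jetCoord_map c (g := fun ν => (f ν).pt) cN hb hνs hz' hp hg.contMDiffAt z.2.2
  rw [h1, h2]
  refine h3.trans ?_
  rw [h4, hνc]
  have h5 : (c.chart (f ν).pt).1 = z.1 := by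
    have h := cN.fst_chart ν hνs
    rw [hνc] at h
    rw [c.fst_chart _ hz', ← hb, ← h]
  have h6 := (contDiffAt_momentumRep c hf cN hz hz').differentiableAt (by simp)
  have h8 : (ContinuousLinearMap.snd ℝ (Eu n) G).comp
      (fderiv ℝ (inCharts cN.chart c.chart fun ν => (f ν).pt) (z.1, z.2.1)) =
      (ContinuousLinearMap.fst ℝ G (MomentumModel n G)).comp
        (fderiv ℝ (c.momentumRep cN.chart f) (z.1, z.2.1)) := by
    have h9 := (inCharts_contDiffAt cN.chart_mem c.chart_mem hz hz'
      hg.contMDiffAt).differentiableAt (by simp)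
    have h10 := h9.hasFDerivAt.snd
    have h11 := h6.hasFDerivAt.fst
    exact h10.unique h11
  rw [← ContinuousLinearMap.comp_assoc, h8, ContinuousLinearMap.comp_assoc, h5]
  rfl

/-- The Euler-Lagrange expression of `h₀(f^* H)` at a section `s` depends on `s` only through `f ∘ s`, and
on the direction only through its image in `Π`. -/
theorem eulerLagrange_hamiltonianPullback (c : FibredChart n G p) (H : Hamiltonian n G p)
    {f : N → LegendreBundle n G p}
    (hf : ContMDiff 𝓘(ℝ, Eu n × F) 𝓘(ℝ, Eu n × (G × MomentumModel n G)) ∞ f)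
    (cN : FibredChart n F (fun ν => p (f ν).pt)) (hb : cN.base = c.base)
    {s : X → N} (hs : IsSmoothSection n F (fun ν => p (f ν).pt) s) {x : Eu n}
    (hx : x ∈ cN.base.target) (hx' : s (cN.base.symm x) ∈ cN.chart.source)
    (hc : (f (s (cN.base.symm x))).pt ∈ c.chart.source) (v : F) :
    eulerLagrange (cN.lagCoord (hamiltonianPullback H f)) (cN.sectionCoord s) x v =
      eulerLagrange (c.hamiltonianLagrangian H)
        (fun x' => (c.momHomeo (f (s (c.base.symm x')))).2) x
        (fderiv ℝ (c.momentumRep cN.chart f) (cN.chart (s (cN.base.symm x))) (0, v)) := by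
  have hbs : ContMDiffAt 𝓘(ℝ, Eu n) 𝓘(ℝ, Eu n) ∞ cN.base.symm x :=
    (contMDiffOn_symm_of_mem_maximalAtlas cN.base_mem).contMDiffAt
      (cN.base.open_target.mem_nhds hx)
  have hsb : ContMDiffAt 𝓘(ℝ, Eu n) 𝓘(ℝ, Eu n × F) ∞ (fun x' => s (cN.base.symm x')) x :=
    hs.1.contMDiffAt.comp x hbs
  have hσ : ContDiffAt ℝ ∞ (cN.sectionCoord s) x := by
    have h1 : ContMDiffAt 𝓘(ℝ, Eu n) 𝓘(ℝ, Eu n × F) ∞ (fun x' => cN.chart (s (cN.base.symm x'))) x :=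
      (contMDiffAt_of_mem_maximalAtlas cN.chart_mem hx').comp x hsb
    exact contDiffAt_snd.comp x (contMDiffAt_iff_contDiffAt.1 h1)
  have hfst : ∀ x' ∈ cN.base.target, s (cN.base.symm x') ∈ cN.chart.source →
      cN.chart (s (cN.base.symm x')) = (x', cN.sectionCoord s x') := by
    intro x' h1 h2
    refine Prod.ext ?_ rfl
    rw [cN.fst_chart _ h2]
    show cN.base (p (f (s (cN.base.symm x'))).pt) = x'
    exact (congrArg cN.base (hs.2 _)).trans (cN.base.right_inv h1)
  have h0 := hfst x hx hx'
  have hsymm : cN.chart.symm (x, cN.sectionCoord s x) = s (cN.base.symm x) := by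
    rw [← h0, cN.chart.left_inv hx']
  have htgt : (x, cN.sectionCoord s x) ∈ cN.chart.target := by
    rw [← h0]; exact cN.chart.map_source hx'
  have hc' : (f (cN.chart.symm (x, cN.sectionCoord s x))).pt ∈ c.chart.source := by rwa [hsymm]
  have hΦ := contDiffAt_momentumRep c hf cN htgt hc'
  have hg : ContMDiff 𝓘(ℝ, Eu n × F) 𝓘(ℝ, Eu n × G) ∞ (fun ν => (f ν).pt) := contMDiff_pt.comp hf
  rw [h0]
  have hev : ∀ᶠ y in 𝓝 (x, cN.sectionCoord s x), y ∈ cN.chart.target ∧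
      (f (cN.chart.symm y)).pt ∈ c.chart.source := by
    refine Filter.Eventually.and (cN.chart.open_target.mem_nhds htgt) ?_
    have h1 : ContinuousAt (fun y => (f (cN.chart.symm y)).pt) (x, cN.sectionCoord s x) :=
      hg.continuous.continuousAt.comp (cN.chart.continuousAt_symm htgt)
    exact h1.eventually (c.chart.open_source.mem_nhds hc')
  have hlag : cN.lagCoord (hamiltonianPullback H f) =ᶠ[𝓝 (x, cN.sectionCoord s x,
      fderiv ℝ (cN.sectionCoord s) x)]
      c.hamiltonianLagrangian H ∘ prolong (c.momentumRep cN.chart f) := by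
    have h1 : Filter.Tendsto (fun z : Eu n × (F × (Eu n →L[ℝ] F)) => (z.1, z.2.1))
        (𝓝 (x, cN.sectionCoord s x, fderiv ℝ (cN.sectionCoord s) x))
        (𝓝 (x, cN.sectionCoord s x)) := Continuous.tendsto (by fun_prop)
          (x, cN.sectionCoord s x, fderiv ℝ (cN.sectionCoord s) x)
    filter_upwards [h1.eventually hev] with z hz
    exact lagCoord_hamiltonianPullback c H hf cN hb hz.1 hz.2
  have hℓ : ContDiffAt ℝ ∞ (c.hamiltonianLagrangian H)
      (prolong (c.momentumRep cN.chart f) (x, cN.sectionCoord s x,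
        fderiv ℝ (cN.sectionCoord s) x)) := by
    apply c.contDiffAt_hamiltonianLagrangian
    have h1 := inCharts_momHomeo c cN hb htgt hc'
    have h2 : (c.chart (f (cN.chart.symm (x, cN.sectionCoord s x))).pt).1 = x :=
      congrArg Prod.fst h1
    have h3 := c.chart.map_source hc'
    have h4 : c.chart (f (cN.chart.symm (x, cN.sectionCoord s x))).pt =
      (x, (c.chart (f (cN.chart.symm (x, cN.sectionCoord s x))).pt).2) := Prod.ext h2 rfl
    rw [h4] at h3
    exact h3
  have hle : ∀ m : ℕ, ((m : ℕ∞) : WithTop ℕ∞) ≤ ∞ := fun m => by exact_mod_cast le_top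
  have hσ2 : ContDiffAt ℝ 2 (cN.sectionCoord s) x := hσ.of_le (hle 2)
  have hΦ3 : ContDiffAt ℝ 3 (c.momentumRep cN.chart f) (x, cN.sectionCoord s x) :=
    hΦ.of_le (hle 3)
  rw [eulerLagrange_congr Filter.EventuallyEq.rfl hσ2 hlag,
    eulerLagrange_pullback hσ2 hΦ3 (hℓ.of_le (hle 2))]
  apply eulerLagrange_congr _ _ Filter.EventuallyEq.rfl
  · have h1 : ∀ᶠ x' in 𝓝 x, s (cN.base.symm x') ∈ cN.chart.source :=
      hsb.continuousAt.eventually (cN.chart.open_source.mem_nhds hx')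
    filter_upwards [h1, cN.base.open_target.mem_nhds hx] with x' h2 h3
    rw [← hfst x' h3 h2, FibredChart.momentumRep, cN.chart.left_inv h2, hb]
    rfl
  · exact ContDiffAt.comp (g := c.momentumRep cN.chart f) x (hΦ3.of_le (by norm_num))
      (contDiffAt_id.prodMk hσ2)

end HamiltonianPullback
end Polysymplectic

/-! ### Cartan equations and constrained Hamilton equations -/

namespace Polysymplectic

section Reduction

variable {n k : ℕ} {G : Type*} [NormedAddCommGroup G] [NormedSpace ℝ G] [FiniteDimensional ℝ G]
  {X : Type*} [TopologicalSpace X] [ChartedSpace (Eu n) X]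
  {M : Type*} [TopologicalSpace M] [ChartedSpace (Eu n × G) M]
  [IsManifold 𝓘(ℝ, Eu n) ∞ X] [IsManifold 𝓘(ℝ, Eu n × G) ∞ M]
  {p : M → X} [IsSmoothFibreBundle (Eu n) (Eu n × G) G p]
  {L : Lagrangian n G p} [ChartedSpace (Eu n × (G × Eu k)) (constraintSpace L)]

theorem IsAlmostRegular.contMDiff_val (hL : IsAlmostRegular k L) :
    ContMDiff 𝓘(ℝ, Eu n × (G × Eu k)) 𝓘(ℝ, Eu n × (G × MomentumModel n G)) ∞
      (Subtype.val : constraintSpace L → LegendreBundle n G p) :=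
  hL.isSmoothEmbedding.contMDiff

theorem IsAlmostRegular.contMDiff_legendreRestrict (hL : IsAlmostRegular k L) :
    ContMDiff 𝓘(ℝ, Eu n × (G × (Eu n →L[ℝ] G))) 𝓘(ℝ, Eu n × (G × Eu k)) ∞ (legendreRestrict L) :=
  hL.isSubmersion.contMDiff

theorem IsAlmostRegular.contMDiff_legendreMap (hL : IsAlmostRegular k L) :
    ContMDiff 𝓘(ℝ, Eu n × (G × (Eu n →L[ℝ] G))) 𝓘(ℝ, Eu n × (G × MomentumModel n G)) ∞
      (legendreMap L) :=
  hL.contMDiff_val.comp hL.contMDiff_legendreRestrict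

/-- The Lagrangian `L̄` of the Cartan equations is `h₀(L̂^* H)`. -/
theorem cartanDensity_eq (hL : IsAlmostRegular k L) {H : Hamiltonian n G p}
    (hH : IsAssociated H L) : cartanDensity L = hamiltonianPullback H (legendreMap L) := by
  funext j A
  have h1 := (H.lifts (legendreMap L j) j.jet (A.projectPt.diff j.jet)).trans
    (congrArg (fun α : VolumeForm n (p j.pt) => α + fibreDeriv L j (A.projectPt.diff j.jet))
      (form_legendreMap hL hH j))
  have h2 : j.jet.translate (A.projectPt.diff j.jet) = A.projectPt := by
    ext v
    simp [Jet.translate, Jet.diff]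
  have h3 := congrArg (fun B : Jet n G p j.pt =>
    (H.form (legendreMap L j)).compLinearMap B.1.toLinearMap) h2
  exact h1.symm.trans h3

/-- The constrained Lagrangian `h₀(i_N^* H)` as a pull-back along the inclusion `N_L → Π`. -/
theorem constrainedDensity_eq (hL : IsAlmostRegular k L) (H : Hamiltonian n G p) :
    constrainedDensity k L H =
      hamiltonianPullback H (Subtype.val : constraintSpace L → LegendreBundle n G p) := by
  funext ν A
  have h1 : mfderiv 𝓘(ℝ, Eu n × (G × Eu k)) 𝓘(ℝ, Eu n × G)
      (fun ν : constraintSpace L => ν.1.pt) ν = _ :=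
    mfderiv_comp (I' := 𝓘(ℝ, Eu n × (G × MomentumModel n G)))
      (g := (LegendreBundle.pt : LegendreBundle n G p → M)) ν
      (contMDiff_pt.contMDiffAt.mdifferentiableAt (by simp))
      (hL.contMDiff_val.contMDiffAt.mdifferentiableAt (by simp))
  unfold hamiltonianPullback
  rw [h1]
  rfl

theorem IsSmoothSection.legendreRestrict (hL : IsAlmostRegular k L) {s : X → JetBundle n G p}
    (hs : IsSmoothSection n (G × (Eu n →L[ℝ] G)) (JetBundle.proj n G p) s) :
    IsSmoothSection n (G × Eu k) (constraintProj L) (legendreRestrict L ∘ s) :=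
  ⟨hL.contMDiff_legendreRestrict.comp hs.1, hs.2⟩

/-- The images in `Π` of the vertical directions of `J¹M` at `j` are the images of the vertical directions
of `N_L` at `L̂(j)`: they correspond under the vertical part of the differential of the submersion
`J¹M → N_L`, which is surjective. -/
theorem fderiv_momentumRep_legendre (hL : IsAlmostRegular k L)
    (c : FibredChart n (G × (Eu n →L[ℝ] G)) (JetBundle.proj n G p))
    (c' : FibredChart n (G × Eu k) (constraintProj L)) (hb : c'.base = c.base)
    (cM : FibredChart n G p) {j : JetBundle n G p} (hj : j ∈ c.chart.source)
    (hj' : legendreRestrict L j ∈ c'.chart.source) (hjM : j.pt ∈ cM.chart.source) :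
    ∃ T : (G × (Eu n →L[ℝ] G)) → G × Eu k, Function.Surjective T ∧ ∀ v,
      fderiv ℝ (cM.momentumRep c.chart (legendreMap L)) (c.chart j) (0, v) =
      fderiv ℝ (cM.momentumRep c'.chart (Subtype.val : constraintSpace L → LegendreBundle n G p))
        (c'.chart (legendreRestrict L j)) (0, T v) := by
  let Ψ := inCharts c.chart c'.chart (legendreRestrict L)
  have hz := c.chart.map_source hj
  have hleft := c.chart.left_inv hj
  have hΨ : DifferentiableAt ℝ Ψ (c.chart j) :=
    (inCharts_contDiffAt c.chart_mem c'.chart_mem hz (by rwa [hleft])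
      hL.contMDiff_legendreRestrict.contMDiffAt).differentiableAt (by simp)
  have hΨj : Ψ (c.chart j) = c'.chart (legendreRestrict L j) := by simp [Ψ, inCharts, hleft]
  have hev : ∀ᶠ z in 𝓝 (c.chart j), z ∈ c.chart.target ∧
      legendreRestrict L (c.chart.symm z) ∈ c'.chart.source := by
    refine Filter.Eventually.and (c.chart.open_target.mem_nhds hz) ?_
    have h1 : ContinuousAt (fun z => legendreRestrict L (c.chart.symm z)) (c.chart j) :=
      hL.contMDiff_legendreRestrict.continuous.continuousAt.comp (c.chart.continuousAt_symm hz)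
    refine h1.eventually (c'.chart.open_source.mem_nhds ?_)
    rwa [← hleft] at hj'
  have hfst : (fun z => (Ψ z).1) =ᶠ[𝓝 (c.chart j)] Prod.fst := by
    filter_upwards [hev] with z h1
    show (c'.chart (legendreRestrict L (c.chart.symm z))).1 = z.1
    have h2 := c.fst_chart _ (c.chart.map_target h1.1)
    rw [c.chart.right_inv h1.1] at h2
    rw [c'.fst_chart _ h1.2, h2, hb]
    rfl
  have hfst' : ∀ w, (fderiv ℝ Ψ (c.chart j) w).1 = w.1 := by
    intro w
    have h1 := hfst.fderiv_eq (𝕜 := ℝ)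
    rw [hΨ.hasFDerivAt.fst.fderiv, fderiv_fst] at h1
    exact congrArg (fun f => f w) h1
  have hsurj : Function.Surjective (fderiv ℝ Ψ (c.chart j)) := by
    intro w
    obtain ⟨u, hu⟩ := (hL.isSubmersion.isSubmersionAt j).surjective_mfderiv
      (c'.chartFrame (legendreRestrict L j) w)
    refine ⟨c.chartDeriv j u, ?_⟩
    rw [← chartDeriv_mfderiv c' c hj hj' hL.contMDiff_legendreRestrict.contMDiffAt u]
    exact (congrArg _ hu).trans (c'.chartDeriv_chartFrame hj' w)
  have hcomp : cM.momentumRep c.chart (legendreMap L) =ᶠ[𝓝 (c.chart j)]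
      cM.momentumRep c'.chart (Subtype.val : constraintSpace L → LegendreBundle n G p) ∘ Ψ := by
    filter_upwards [hev] with z h1
    simp only [FibredChart.momentumRep, Function.comp, Ψ, inCharts]
    rw [c'.chart.left_inv h1.2]
    rfl
  have hd : DifferentiableAt ℝ (cM.momentumRep c'.chart
      (Subtype.val : constraintSpace L → LegendreBundle n G p)) (Ψ (c.chart j)) := by
    refine (contDiffAt_momentumRep cM hL.contMDiff_val c' ?_ ?_).differentiableAt (by simp)
    · rw [hΨj]; exact c'.chart.map_source hj'
    · rw [hΨj, c'.chart.left_inv hj']; exact hjM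
  refine ⟨fun v => (fderiv ℝ Ψ (c.chart j) (0, v)).2, fun w => ?_, fun v => ?_⟩
  · obtain ⟨⟨u, v⟩, h⟩ := hsurj (0, w)
    have h1 := hfst' (u, v)
    rw [h] at h1
    have h2 : u = 0 := h1.symm
    subst h2
    exact ⟨v, congrArg Prod.snd h⟩
  · rw [hcomp.fderiv_eq, fderiv_comp _ hd hΨ, ContinuousLinearMap.comp_apply, hΨj]
    congr 1
    exact Prod.ext (hfst' (0, v)) rfl

/-- The equivalence at one point, in fibred coordinates on `J¹M` and `N_L` with the same `x^l`. -/
theorem cartan_iff_constrained (hL : IsAlmostRegular k L) {H : Hamiltonian n G p}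
    (hH : IsAssociated H L) {s : X → JetBundle n G p}
    (hs : IsSmoothSection n (G × (Eu n →L[ℝ] G)) (JetBundle.proj n G p) s)
    (c : FibredChart n (G × (Eu n →L[ℝ] G)) (JetBundle.proj n G p))
    (c' : FibredChart n (G × Eu k) (constraintProj L)) (hb : c'.base = c.base)
    {x : Eu n} (hx : x ∈ c.base.target) (hc : s (c.base.symm x) ∈ c.chart.source)
    (hc' : legendreRestrict L (s (c.base.symm x)) ∈ c'.chart.source) :
    (∀ v, eulerLagrange (c.lagCoord (cartanDensity L)) (c.sectionCoord s) x v = 0) ↔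
    (∀ v, eulerLagrange (c'.lagCoord (constrainedDensity k L H))
      (c'.sectionCoord (legendreRestrict L ∘ s)) x v = 0) := by
  obtain ⟨cM, hcM, hM⟩ := exists_fibredChart_with_base (G := G) p c.base c.base_mem
    (s (c.base.symm x)).pt (c.mapsTo _ hc)
  obtain ⟨T, hT, hTv⟩ := fderiv_momentumRep_legendre hL c c' hb cM hc hc' hM
  have key : ∀ v, eulerLagrange (c.lagCoord (cartanDensity L)) (c.sectionCoord s) x v =
      eulerLagrange (c'.lagCoord (constrainedDensity k L H))
        (c'.sectionCoord (legendreRestrict L ∘ s)) x (T v) := by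
    intro v
    have hJ := eulerLagrange_hamiltonianPullback cM H hL.contMDiff_legendreMap c hcM.symm hs hx hc
      hM v
    have hN := eulerLagrange_hamiltonianPullback cM H hL.contMDiff_val c' (hb.trans hcM.symm)
      (hs.legendreRestrict hL) (by rwa [hb]) (by rw [hb]; exact hc') (by rw [hb]; exact hM) (T v)
    rw [cartanDensity_eq hL hH, constrainedDensity_eq hL H]
    refine hJ.trans (Eq.trans ?_ hN.symm)
    rw [hTv, hb]
    rfl
  constructor
  · intro h w
    obtain ⟨v, rfl⟩ := hT w
    rw [← key, h]
  · intro h v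
    rw [key, h]

/-- In either direction, the given chart is matched by one with the same `x^l` on the other bundle, so
that only changes of fibre coordinates occur. -/
theorem isCartanSolution_iff (hL : IsAlmostRegular k L) {H : Hamiltonian n G p}
    (hH : IsAssociated H L) {s : X → JetBundle n G p}
    (hs : IsSmoothSection n (G × (Eu n →L[ℝ] G)) (JetBundle.proj n G p) s) :
    IsCartanSolution L s ↔ IsConstrainedHamiltonSolution k L H (legendreRestrict L ∘ s) := by
  have := hL.isManifold
  constructor
  · rintro ⟨-, h⟩
    refine ⟨hs.legendreRestrict hL, fun c' x hx hc' => ?_⟩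
    obtain ⟨cM, hcM, hM⟩ := exists_fibredChart_with_base (G := G) p c'.base c'.base_mem
      (s (c'.base.symm x)).pt (c'.mapsTo _ hc')
    obtain ⟨c, hc, hcs, -⟩ := cM.exists_jet (s (c'.base.symm x))
    have hb : c.base = c'.base := hc.trans hcM
    have h1 : s (c.base.symm x) ∈ c.chart.source := by rw [hcs, hb]; exact hM
    exact (cartan_iff_constrained hL hH hs c c' hb.symm (by rwa [hb]) h1
      (by rw [hb]; exact hc')).1 (h c x (by rwa [hb]) h1)
  · rintro ⟨-, h⟩
    refine ⟨hs, fun c x hx hc => ?_⟩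
    obtain ⟨cM, hcM, hM⟩ := exists_fibredChart_with_base (G := G) p c.base c.base_mem
      (s (c.base.symm x)).pt (c.mapsTo _ hc)
    obtain ⟨c', hc', hcs⟩ := cM.exists_comp (fun ν : constraintSpace L => ν.1.pt)
      hL.isSmoothFibreBundle (legendreRestrict L (s (c.base.symm x))) hM
    have hb : c'.base = c.base := hc'.trans hcM
    exact (cartan_iff_constrained hL hH hs c c' hb hx hc hcs).2
      (h c' x (by rwa [hb]) (by rw [hb]; exact hcs))

end Reduction

/-! ### Smoothness of the Hamiltonian map -/

section HamiltonianMap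

variable {n m : ℕ}
  {X : Type*} [TopologicalSpace X] [ChartedSpace (Eu n) X]
  {M : Type*} [TopologicalSpace M] [ChartedSpace (Eu n × Eu m) M]
  [IsManifold 𝓘(ℝ, Eu n) ∞ X] [IsManifold 𝓘(ℝ, Eu n × Eu m) ∞ M]
  {p : M → X} [IsSmoothFibreBundle (Eu n) (Eu n × Eu m) (Eu m) p]

theorem contMDiff_hamiltonianMap (H : Hamiltonian n (Eu m) p) :
    ContMDiff 𝓘(ℝ, Eu n × (Eu m × MomentumModel n (Eu m)))
      𝓘(ℝ, Eu n × (Eu m × (Eu n →L[ℝ] Eu m))) ∞ (hamiltonianMap H) := by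
  intro q
  have hq := mem_chartOf (n := n) (G := Eu m) p q.pt
  set c := chartOf (n := n) (G := Eu m) p q.pt
  obtain ⟨cJ, -, hJs, hJ⟩ := c.exists_jet (hamiltonianMap H q)
  have hqs : q ∈ c.momHomeo.source := hq
  -- The inverse of the isomorphism `a ↦ pairing · a` onto the dual space of the momenta.
  let B : (MomentumModel n (Eu m) →L[ℝ] ℝ) → (Eu n →L[ℝ] Eu m) := fun φ =>
    ∑ l, elemL l (WithLp.toLp 2 fun i => φ (Pi.single l (EuclideanSpace.proj i)))
  have hB : ContDiff ℝ ∞ B := by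
    refine ContDiff.sum fun l _ =>
      (elemL (n := n) (G := Eu m) l).contDiff.comp ?_
    rw [contDiff_euclidean]
    intro i
    fun_prop
  have hBa : ∀ (a : Eu n →L[ℝ] Eu m) (φ : MomentumModel n (Eu m) →L[ℝ] ℝ),
      (∀ P, pairing P a = φ P) → B φ = a := by
    intro a φ h
    conv_rhs => rw [← sum_elem a]
    refine Finset.sum_congr rfl fun l _ => ?_
    show elem l _ = _
    congr 1
    ext i
    show φ (Pi.single l (EuclideanSpace.proj i)) = _
    rw [← h, pairing, Finset.sum_eq_single l]
    · simp
    · intro l' _ hl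
      simp [Pi.single_eq_of_ne hl]
    · simp
  let D : Eu n × (Eu m × MomentumModel n (Eu m)) → Eu n × (Eu m × (Eu n →L[ℝ] Eu m)) := fun z =>
    (z.1, z.2.1, B ((fderiv ℝ (c.hamCoord H.form) z).comp
      ((ContinuousLinearMap.inr ℝ (Eu n) (Eu m × MomentumModel n (Eu m))).comp
        (ContinuousLinearMap.inr ℝ (Eu m) (MomentumModel n (Eu m))))))
  have hham : ∀ i : LegendreBundle n (Eu m) p, i.pt ∈ c.chart.source →
      ContDiffAt ℝ ∞ (c.hamCoord H.form) (c.momHomeo i) := fun i hi =>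
    c.contDiffAt_hamCoord H (c.chart.map_source hi)
  have hD : ContDiffAt ℝ ∞ D (c.momHomeo q) := by
    refine contDiffAt_fst.prodMk (contDiffAt_snd.fst.prodMk (hB.contDiffAt.comp _ ?_))
    exact ((hham q hq).fderiv_right (m := ∞) (by simp)).clm_comp contDiffAt_const
  have hDq : ∀ i : LegendreBundle n (Eu m) p, i.pt ∈ c.chart.source →
      D (c.momHomeo i) = cJ.chart (hamiltonianMap H i) := by
    intro i hi
    rw [hJ]
    refine Prod.ext rfl (Prod.ext rfl ?_)
    apply hBa
    intro P
    refine (jetCoord_hamiltonianMap H i c hi P).trans ?_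
    have h1 : HasFDerivAt (fun P' : MomentumModel n (Eu m) =>
        ((c.chart i.pt).1, (c.chart i.pt).2, P'))
        ((ContinuousLinearMap.inr ℝ (Eu n) (Eu m × MomentumModel n (Eu m))).comp
        (ContinuousLinearMap.inr ℝ (Eu m) (MomentumModel n (Eu m)))) (c.momCoord i.pt i.mom) :=
      (hasFDerivAt_prodMk_right (c.chart i.pt).1
        ((c.chart i.pt).2, c.momCoord i.pt i.mom)).comp _ (hasFDerivAt_prodMk_right _ _)
    have h2 : HasFDerivAt (c.hamCoord H.form) (fderiv ℝ (c.hamCoord H.form) (c.momHomeo i))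
      ((c.chart i.pt).1, (c.chart i.pt).2, c.momCoord i.pt i.mom) :=
      ((hham i hi).differentiableAt (by simp)).hasFDerivAt
    exact congrArg (fun f => f P) (HasFDerivAt.comp (f := fun P' : MomentumModel n (Eu m) =>
      ((c.chart i.pt).1, (c.chart i.pt).2, P')) (c.momCoord i.pt i.mom) h2 h1).fderiv
  have h1 : ContMDiffAt 𝓘(ℝ, Eu n × (Eu m × MomentumModel n (Eu m)))
      𝓘(ℝ, Eu n × (Eu m × MomentumModel n (Eu m))) ∞ c.momHomeo q :=
    contMDiffAt_of_mem_maximalAtlas c.momHomeo_mem hqs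
  have h3 : ContMDiffAt 𝓘(ℝ, Eu n × (Eu m × (Eu n →L[ℝ] Eu m)))
      𝓘(ℝ, Eu n × (Eu m × (Eu n →L[ℝ] Eu m))) ∞ cJ.chart.symm (D (c.momHomeo q)) := by
    refine (contMDiffOn_symm_of_mem_maximalAtlas cJ.chart_mem).contMDiffAt
      (cJ.chart.open_target.mem_nhds ?_)
    rw [hDq q hq]
    exact cJ.chart.map_source (by rw [hJs]; exact hq)
  refine (ContMDiffAt.comp (g := cJ.chart.symm) q h3
    (ContMDiffAt.comp (g := D) q hD.contMDiffAt h1)).congr_of_eventuallyEq ?_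
  filter_upwards [c.momHomeo.open_source.mem_nhds hqs] with i hi
  have hi' : i.pt ∈ c.chart.source := hi
  have h4 : hamiltonianMap H i ∈ cJ.chart.source := by rw [hJs]; exact hi'
  simp [hDq i hi', cJ.chart.left_inv h4]

end HamiltonianMap
end Polysymplectic

open Polysymplectic
theorem theorem3p01 {n m k : ℕ}
    {X : Type*} [TopologicalSpace X] [ChartedSpace (Eu n) X] [IsManifold 𝓘(ℝ, Eu n) ∞ X]
    {Y : Type*} [TopologicalSpace Y] [ChartedSpace (Eu n × Eu m) Y]
    [IsManifold 𝓘(ℝ, Eu n × Eu m) ∞ Y]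
    (π : Y → X) [IsSmoothFibreBundle (Eu n) (Eu n × Eu m) (Eu m) π]
    (L : Lagrangian n (Eu m) π)
    [ChartedSpace (Eu n × (Eu m × Eu k)) (constraintSpace L)]
    (hL : IsAlmostRegular k L)
    (H : Hamiltonian n (Eu m) π) (hH : IsAssociated H L) :
    (∀ s : X → JetBundle n (Eu m) π,
      IsSmoothSection n (Eu m × (Eu n →L[ℝ] Eu m)) (JetBundle.proj n (Eu m) π) s →
        (IsCartanSolution L s ↔ IsConstrainedHamiltonSolution k L H (legendreRestrict L ∘ s))) ∧
    (∀ H' : Hamiltonian n (Eu m) π, IsAssociated H' L →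
      ∀ r : X → constraintSpace L, IsConstrainedHamiltonSolution k L H r →
        IsCartanSolution L (fun x => hamiltonianMap H' (r x))) := by
  refine ⟨fun s hs => isCartanSolution_iff hL hH hs, fun H' hH' r hr => ?_⟩
  have hs : IsSmoothSection n (Eu m × (Eu n →L[ℝ] Eu m)) (JetBundle.proj n (Eu m) π)
      (fun x => hamiltonianMap H' (r x)) :=
    ⟨(contMDiff_hamiltonianMap H').comp (hL.contMDiff_val.comp hr.1.1), hr.1.2⟩
  rw [isCartanSolution_iff hL hH hs]
  have : legendreRestrict L ∘ (fun x => hamiltonianMap H' (r x)) = r :=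
    funext fun x => Subtype.ext (hH'.legendre_hamiltonian (r x).1 (r x).2)
  rwa [this]
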